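/- Let $n\ge 2$, $H>0$, $T>0$, and let $\Sigma\subset\mathbb{R}^{n-1}$ be a bounded, connected, open set with Lipschitz boundary; write $x=(\bar x,x_n)\in\mathbb{R}^{n-1}\times\mathbb{R}$. Put $\Omega=\Sigma\times(-H,H)$, $\Omega^+=\Sigma\times(0,H)$, $\Omega^-=\Sigma\times(-H,0)$, $Y=(0,1)^{n-1}$, $Z=Y\times(-1,1)$. Let $Z^*\subset Z$ be a connected open Lipschitz domain such that $S_*^\pm=\{y\in\partial Z^*: y_n=\pm1\}$ is (the closure of) a Lipschitz domain in $\mathbb{R}^{n-1}$ of positive measure and such that $N=\partial Z^*\setminus(S_*^+\cup S_*^-)$ has positive distance to $\partial Z\setminus (Y\times\{\pm1\})$. For $0<\epsilon<H$ with $\epsilon^{-1}\in\mathbb{N}$ let $\Omega_\epsilon^+=\Sigma\times(\epsilon,H)$, $\Omega_\epsilon^-=\Sigma\times(-H,-\epsilon)$, $I_\epsilon=\{\bar k\in\mathbb{Z}^{n-1}:\epsilon(Z+(\bar k,0))\subset\Sigma\times(-\epsilon,\epsilon)\}$, and let $\Omega_{*,\epsilon}^M$, $S_{*,\epsilon}^\pm$,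 $N_\epsilon$ be the unions over $\bar k\in I_\epsilon$ of the sets $\epsilon(A+(\bar k,0))$ with $A=Z^*$, $S_*^\pm$, $N$ respectively. Let $\Omega_\epsilon$ be the interior of $\Omega_\epsilon^+\cup\Omega_\epsilon^-\cup\Omega_{*,\epsilon}^M\cup S_{*,\epsilon}^+\cup S_{*,\epsilon}^-$, assumed to have Lipschitz boundary. Superscripts $\pm,M$ denote restriction to $\Omega_\epsilon^\pm$, $\Omega_{*,\epsilon}^M$. Data: $D^\pm>0$; $D^M\in L^\infty(Z^*)^{n\times n}$ with $D^M(y)\xi\cdot\xi\ge c_0|\xi|^2$ for a.e. $y\in Z^*$, all $\xi\in\mathbb{R}^n$ and some $c_0>0$; $f^\pm\in C^0([0,T]\times\overline\Omega\times\mathbb{R})$, $g\in C^0([0,T]\times\overline{Z^*}\times\mathbb{R})$, $h\in C^0([0,T]\times\overline N\times\mathbb{R})$, all Lipschitz in the last variable, uniformly in the others; $u_i^\pm\in L^2(\Omega^\pm)$, $u_i^M\in L^2(\Sigma,C^0(\overline{Z^*}))$. Functions of $y$ given on the cell are extended $Y$-periodically in $\bar y$; $g_\epsilon(t,x,z)=g(t,x/\epsilon,z)$,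 $h_\epsilon(t,x,z)=h(t,x/\epsilon,z)$; and $u_{\epsilon,i}$ equals $u_i^\pm$ in $\Omega_\epsilon^\pm$ and $u_i^M(\bar x,x/\epsilon)$ in $\Omega_{*,\epsilon}^M$. Let $\mathcal L_\epsilon=L^2(\Omega_\epsilon)$ with inner product $(w,v)_{\mathcal L_\epsilon}=(w,v)_{\Omega_\epsilon^+}+(w,v)_{\Omega_\epsilon^-}+\frac1\epsilon(w,v)_{\Omega_{*,\epsilon}^M}$; let $\mathcal H_\epsilon=H^1(\Omega_\epsilon)$ with inner product $(w,v)_{\mathcal L_\epsilon}+(\nabla w,\nabla v)_{\Omega_\epsilon^+}+(\nabla w,\nabla v)_{\Omega_\epsilon^-}+\epsilon(\nabla w,\nabla v)_{\Omega_{*,\epsilon}^M}$; let $\mathcal H_{\epsilon,0}^M$ be the space of $v\in H^1(\Omega_{*,\epsilon}^M)$ with zero trace on $S_{*,\epsilon}^\pm$, with inner product $\frac1\epsilon(w,v)_{\Omega_{*,\epsilon}^M}+\epsilon(\nabla w,\nabla v)_{\Omega_{*,\epsilon}^M}$. A weak solution is $u_\epsilon\in L^2((0,T),\mathcal H_\epsilon)$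 with $\partial_tu_\epsilon\in L^2((0,T),\mathcal H_\epsilon')$ (in the sense of the triple $\mathcal H_\epsilon\subset\mathcal L_\epsilon\subset\mathcal H_\epsilon'$) such that $u_\epsilon(0)=u_{\epsilon,i}$ (for the representative in $C^0([0,T],\mathcal L_\epsilon)$) and, for a.e. $t\in(0,T)$ and all $\phi\in\mathcal H_\epsilon$, $$\langle\partial_tu_\epsilon,\phi\rangle+\sum_\pm D^\pm(\nabla u_\epsilon^\pm,\nabla\phi)_{\Omega_\epsilon^\pm}+\epsilon\big(D^M(\tfrac{\cdot}{\epsilon})\nabla u_\epsilon^M,\nabla\phi\big)_{\Omega_{*,\epsilon}^M}=\sum_\pm(f^\pm(u_\epsilon^\pm),\phi)_{\Omega_\epsilon^\pm}+\tfrac1\epsilon(g_\epsilon(u_\epsilon^M),\phi)_{\Omega_{*,\epsilon}^M}-(h_\epsilon(u_\epsilon^M),\phi)_{N_\epsilon},$$ where the last term is an integral of traces with respect to surface measure. Then there is a constant $C>0$, independent of $\epsilon$, such that for all such $\epsilon$ every weak solution $u_\epsilon$ satisfies $$\|\partial_tu_\epsilon\|_{L^2((0,T),\mathcal H_\epsilon')}+\|u_\epsilon\|_{L^2((0,T),\mathcal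 H_\epsilon)}\le C.$$ Moreover $u_\epsilon^M$ has a time derivative $\partial_tu_\epsilon^M\in L^2((0,T),(\mathcal H_{\epsilon,0}^M)')$, in the sense of the triple $\mathcal H_{\epsilon,0}^M\subset L^2(\Omega_{*,\epsilon}^M)\subset(\mathcal H_{\epsilon,0}^M)'$ with the usual inner product on $L^2(\Omega_{*,\epsilon}^M)$, and $$\|\partial_tu_\epsilon^M\|_{L^2((0,T),(\mathcal H_{\epsilon,0}^M)')}\le C\epsilon.$$ -/

import Mathlib

open MeasureTheory Set Filter Topology
open scoped ENNReal NNReal ContDiff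

noncomputable section

namespace ThinChannels

/-! ### Euclidean space and its last coordinate -/

/-- The space `ℝⁿ` with `n = m + 1`; the last coordinate is the transversal one. -/
abbrev Space (m : ℕ) : Type := EuclideanSpace ℝ (Fin (m + 1))

/-- The space `ℝⁿ⁻¹` of the tangential coordinates. -/
abbrev Base (m : ℕ) : Type := EuclideanSpace ℝ (Fin m)

variable {m : ℕ}

/-- The tangential part `x̄` of `x = (x̄, xₙ)`. -/
def bar (x : Space m) : Base m := WithLp.toLp 2 (fun i : Fin m => x i.castSucc)

/-- The last coordinate `xₙ` of `x = (x̄, xₙ)`. -/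
def lastCoord (x : Space m) : ℝ := x (Fin.last m)

/-- The point `(a, s)` of `ℝⁿ⁻¹ × ℝ`. -/
def joinLast (a : Fin m → ℝ) (s : ℝ) : Space m :=
  WithLp.toLp 2 (Fin.snoc (α := fun _ => ℝ) a s)

/-- The lattice vector `(k̄, 0)`. -/
def latticeVec (k : Fin m → ℤ) : Space m := joinLast (fun i => (k i : ℝ)) 0

/-- Reduction of a point modulo `ℤⁿ⁻¹ × {0}` to the cell `[0,1)ⁿ⁻¹ × ℝ`. Composing a function given
on the standard cell with this map is the `Y`-periodic extension of that function. -/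
def cellArg (y : Space m) : Space m :=
  joinLast (fun i => Int.fract (y i.castSucc)) (lastCoord y)

/-- The set `U` has a Lipschitz boundary: near each boundary point, `U` is the set of points below
the graph of a Lipschitz function, in the direction of a suitable unit vector `e`. -/
def HasLipschitzBoundary {d : ℕ} (U : Set (EuclideanSpace ℝ (Fin d))) : Prop :=
  ∀ p ∈ frontier U, ∃ (e : EuclideanSpace ℝ (Fin d)) (γ : EuclideanSpace ℝ (Fin d) → ℝ) (K : ℝ≥0)
    (δ : ℝ), ‖e‖ = 1 ∧ LipschitzWith K γ ∧ 0 < δ ∧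
      ∀ x ∈ Metric.ball p δ, (x ∈ U ↔ inner ℝ x e < γ (x - (inner ℝ x e : ℝ) • e))

/-! ### Geometry -/

/-- The standard cell `Z = Y × (-1, 1)` with `Y = (0,1)ⁿ⁻¹`. -/
def stdCell (m : ℕ) : Set (Space m) :=
  {y | (∀ i, bar y i ∈ Ioo (0 : ℝ) 1) ∧ lastCoord y ∈ Ioo (-1 : ℝ) 1}

/-- The lateral boundary `∂Z \ (S⁺ ∪ S⁻)` of the standard cell, `S^± = Y × {±1}`. -/
def stdCellLateral (m : ℕ) : Set (Space m) :=
  frontier (stdCell m) \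
    {y | (∀ i, bar y i ∈ Ioo (0 : ℝ) 1) ∧ (lastCoord y = 1 ∨ lastCoord y = -1)}

/-- For `s = ±1`, the part `S_*^± = {y ∈ ∂Z* : yₙ = ±1}` of the boundary of `Z*`. -/
def cellMouth (Zs : Set (Space m)) (s : ℝ) : Set (Space m) := {y ∈ frontier Zs | lastCoord y = s}

/-- The lateral boundary `N = ∂Z* \ (S_*⁺ ∪ S_*⁻)` of the standard channel. -/
def cellLateral (Zs : Set (Space m)) : Set (Space m) :=
  frontier Zs \ (cellMouth Zs 1 ∪ cellMouth Zs (-1))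

/-- The fixed geometric data: the half height `H`, the cross section `Σ` and the standard channel
domain `Z*`, with the standing assumptions on them. -/
structure ChannelGeometry (m : ℕ) where
  /-- half height of the macroscopic domain -/
  H : ℝ
  /-- the cross section `Σ` -/
  Sig : Set (Base m)
  /-- the standard channel domain `Z*` -/
  Zs : Set (Space m)
  H_pos : 0 < H
  Sig_open : IsOpen Sig
  Sig_connected : IsConnected Sig
  Sig_bounded : Bornology.IsBounded Sig
  Sig_lipschitz : HasLipschitzBoundary Sig
  Zs_open : IsOpen Zs
  Zs_connected : IsConnected Zs
  Zs_lipschitz : HasLipschitzBoundary Zs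
  Zs_subset : Zs ⊆ stdCell m
  /-- `S_*^±` is (the closure of) a Lipschitz domain of `ℝⁿ⁻¹` of positive measure -/
  mouth_lipschitz : ∀ s : ℝ, s = 1 ∨ s = -1 → ∃ O : Set (Base m), IsOpen O ∧
    HasLipschitzBoundary O ∧ 0 < volume O ∧ bar '' cellMouth Zs s = closure O
  /-- the lateral boundaries of `Z*` and of `Z` have positive distance -/
  lateral_dist : ∃ δ : ℝ, 0 < δ ∧ ∀ y ∈ cellLateral Zs, ∀ z ∈ stdCellLateral m, δ ≤ dist y z

namespace ChannelGeometry

variable (G : ChannelGeometry m)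

/-- `Ω = Σ × (-H, H)`. -/
def Omega : Set (Space m) := {x | bar x ∈ G.Sig ∧ lastCoord x ∈ Ioo (-G.H) G.H}

/-- `Ω⁺ = Σ × (0, H)`. -/
def OmegaPlus : Set (Space m) := {x | bar x ∈ G.Sig ∧ lastCoord x ∈ Ioo 0 G.H}

/-- `Ω⁻ = Σ × (-H, 0)`. -/
def OmegaMinus : Set (Space m) := {x | bar x ∈ G.Sig ∧ lastCoord x ∈ Ioo (-G.H) 0}

/-- The upper bulk domain `Ω_ε⁺ = Σ × (ε, H)`. -/
def bulkPlus (ε : ℝ) : Set (Space m) := {x | bar x ∈ G.Sig ∧ lastCoord x ∈ Ioo ε G.H}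

/-- The lower bulk domain `Ω_ε⁻ = Σ × (-H, -ε)`. -/
def bulkMinus (ε : ℝ) : Set (Space m) := {x | bar x ∈ G.Sig ∧ lastCoord x ∈ Ioo (-G.H) (-ε)}

/-- The thin layer `Ω_ε^M = Σ × (-ε, ε)`. -/
def layer (ε : ℝ) : Set (Space m) := {x | bar x ∈ G.Sig ∧ lastCoord x ∈ Ioo (-ε) ε}

/-- The scaled and translated copy `ε (A + (k̄, 0))` of a set `A`. -/
def cellCopy (ε : ℝ) (k : Fin m → ℤ) (A : Set (Space m)) : Set (Space m) :=
  (fun y => ε • (y + latticeVec k)) '' A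

/-- The index set `I_ε` of the cells that lie in the layer. -/
def cells (ε : ℝ) : Set (Fin m → ℤ) := {k | cellCopy ε k (stdCell m) ⊆ G.layer ε}

/-- The channel domain `Ω_{*,ε}^M`. -/
def channels (ε : ℝ) : Set (Space m) := ⋃ k ∈ G.cells ε, cellCopy ε k G.Zs

/-- For `s = ±1`, the interface `S_{*,ε}^±` between the channels and the bulk domains. -/
def mouths (ε s : ℝ) : Set (Space m) := ⋃ k ∈ G.cells ε, cellCopy ε k (cellMouth G.Zs s)

/-- The lateral boundary `N_ε` of the channels. -/
def lateral (ε : ℝ) : Set (Space m) := ⋃ k ∈ G.cells ε, cellCopy ε k (cellLateral G.Zs)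

/-- The microscopic domain `Ω_ε`. The sets `S_{*,ε}^±` are taken with their edges, so the interior is
taken to make the union an open set. -/
def microDomain (ε : ℝ) : Set (Space m) :=
  interior (G.bulkPlus ε ∪ G.bulkMinus ε ∪ G.channels ε ∪ G.mouths ε 1 ∪ G.mouths ε (-1))

/-- The measure `dx` on `Ω_ε^±` and `w dx` on `Ω_{*,ε}^M`. -/
def weighted (ε : ℝ) (w : ℝ≥0∞) : Measure (Space m) :=
  volume.restrict (G.bulkPlus ε) + volume.restrict (G.bulkMinus ε)
    + w • volume.restrict (G.channels ε)

end ChannelGeometry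

/-! ### Weak gradients, weighted Sobolev spaces, traces -/

/-- `g` is the weak gradient of `u` on the open set `U`. -/
def IsWeakGradient (U : Set (Space m)) (u : Space m → ℝ) (g : Space m → Space m) : Prop :=
  ∀ φ : Space m → ℝ, ContDiff ℝ ∞ φ → HasCompactSupport φ → tsupport φ ⊆ U →
    ∀ e : Space m, ∫ x in U, u x * fderiv ℝ φ x e = - ∫ x in U, inner ℝ (g x) e * φ x

/-- `v` is the trace on `Γ` (with respect to surface measure) of the function `u ∈ H¹(U)` with weak
gradient `g`: smooth functions converge at once to `u` in `H¹(U)` and to `v` in `L²(Γ)`. -/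
def IsTrace (U Γ : Set (Space m)) (u : Space m → ℝ) (g : Space m → Space m)
    (v : Space m → ℝ) : Prop :=
  MemLp v 2 ((Measure.euclideanHausdorffMeasure m).restrict Γ) ∧
  ∃ φ : ℕ → Space m → ℝ, (∀ k, ContDiff ℝ ∞ (φ k)) ∧
    Tendsto (fun k => eLpNorm (fun x => u x - φ k x) 2 (volume.restrict U)) atTop (𝓝 0) ∧
    Tendsto (fun k => eLpNorm (fun x => g x - gradient (φ k) x) 2 (volume.restrict U))
      atTop (𝓝 0) ∧
    Tendsto (fun k => eLpNorm (fun x => v x - φ k x) 2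
      ((Measure.euclideanHausdorffMeasure m).restrict Γ)) atTop (𝓝 0)

open Classical in
/-- The trace on `Γ` of the function `u ∈ H¹(U)` with weak gradient `g`. -/
def traceFun (U Γ : Set (Space m)) (u : Space m → ℝ) (g : Space m → Space m) : Space m → ℝ :=
  if h : ∃ v, IsTrace U Γ u g v then h.choose else 0

/-- Lebesgue measure on `U` is bounded by a multiple of `μ`. -/
def Dominates (U : Set (Space m)) (μ : Measure (Space m)) : Prop :=
  ∃ c : ℝ≥0∞, c ≠ ⊤ ∧ volume.restrict U ≤ c • μ

theorem Dominates.ac {U : Set (Space m)} {μ : Measure (Space m)} (h : Dominates U μ) :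
    volume.restrict U ≪ μ := by
  obtain ⟨c, -, hc⟩ := h
  exact (Measure.absolutelyContinuous_of_le hc).trans Measure.smul_absolutelyContinuous

theorem Dominates.memLp {F : Type*} [NormedAddCommGroup F] {U : Set (Space m)}
    {μ : Measure (Space m)} (h : Dominates U μ) {f : Space m → F} (hf : MemLp f 2 μ) :
    MemLp f 2 (volume.restrict U) := by
  obtain ⟨c, hc', hc⟩ := h
  exact hf.of_measure_le_smul hc' hc

theorem memLp_fderiv_apply {U : Set (Space m)} {φ : Space m → ℝ} (h : ContDiff ℝ ∞ φ)
    (hc : HasCompactSupport φ) (e : Space m) :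
    MemLp (fun x => fderiv ℝ φ x e) 2 (volume.restrict U) := by
  have h1 : Continuous (fun x => fderiv ℝ φ x e) :=
    (h.continuous_fderiv (by simp)).clm_apply continuous_const
  have h2 : HasCompactSupport (fun x => fderiv ℝ φ x e) := hc.fderiv_apply (𝕜 := ℝ) e
  exact h1.memLp_of_hasCompactSupport h2

theorem memLp_test {U : Set (Space m)} {φ : Space m → ℝ} (h : ContDiff ℝ ∞ φ)
    (hc : HasCompactSupport φ) : MemLp φ 2 (volume.restrict U) :=
  h.continuous.memLp_of_hasCompactSupport hc

theorem IsWeakGradient.congr {U : Set (Space m)} {u u' : Space m → ℝ} {g g' : Space m → Space m}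
    (h : IsWeakGradient U u g) (hu : u' =ᵐ[volume.restrict U] u)
    (hg : g' =ᵐ[volume.restrict U] g) : IsWeakGradient U u' g' := by
  intro φ h1 h2 h3 e
  have e1 : ∫ x in U, u' x * fderiv ℝ φ x e = ∫ x in U, u x * fderiv ℝ φ x e :=
    integral_congr_ae (by filter_upwards [hu] with x hx; rw [hx])
  have e2 : ∫ x in U, inner ℝ (g' x) e * φ x = ∫ x in U, inner ℝ (g x) e * φ x :=
    integral_congr_ae (by filter_upwards [hg] with x hx; rw [hx])
  rw [e1, e2]
  exact h φ h1 h2 h3 e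

theorem IsWeakGradient.add {U : Set (Space m)} {u u' : Space m → ℝ} {g g' : Space m → Space m}
    (h : IsWeakGradient U u g) (h' : IsWeakGradient U u' g')
    (hu : MemLp u 2 (volume.restrict U)) (hu' : MemLp u' 2 (volume.restrict U))
    (hg : MemLp g 2 (volume.restrict U)) (hg' : MemLp g' 2 (volume.restrict U)) :
    IsWeakGradient U (u + u') (g + g') := by
  intro φ h1 h2 h3 e
  have hd := memLp_fderiv_apply (U := U) h1 h2 e
  have hφ := memLp_test (U := U) h1 h2
  have i1 : Integrable (fun x => u x * fderiv ℝ φ x e) (volume.restrict U) := hu.integrable_mul hd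
  have i2 : Integrable (fun x => u' x * fderiv ℝ φ x e) (volume.restrict U) :=
    hu'.integrable_mul hd
  have i3 : Integrable (fun x => inner ℝ (g x) e * φ x) (volume.restrict U) :=
    (hg.inner_const e).integrable_mul hφ
  have i4 : Integrable (fun x => inner ℝ (g' x) e * φ x) (volume.restrict U) :=
    (hg'.inner_const e).integrable_mul hφ
  simp only [Pi.add_apply, add_mul, inner_add_left]
  rw [integral_add i1 i2, integral_add i3 i4, h φ h1 h2 h3 e, h' φ h1 h2 h3 e]
  ring

theorem IsWeakGradient.smul {U : Set (Space m)} {u : Space m → ℝ} {g : Space m → Space m}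
    (c : ℝ) (h : IsWeakGradient U u g) : IsWeakGradient U (c • u) (c • g) := by
  intro φ h1 h2 h3 e
  simp only [Pi.smul_apply, smul_eq_mul, mul_assoc, real_inner_smul_left]
  rw [integral_const_mul, integral_const_mul, h φ h1 h2 h3 e]
  ring

theorem IsWeakGradient.zero (U : Set (Space m)) :
    IsWeakGradient U (0 : Space m → ℝ) (0 : Space m → Space m) := by
  intro φ _ _ _ e
  simp

theorem gradient_add_smooth {φ ψ : Space m → ℝ} (h : ContDiff ℝ ∞ φ) (h' : ContDiff ℝ ∞ ψ)
    (x : Space m) : gradient (φ + ψ) x = gradient φ x + gradient ψ x := by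
  unfold gradient
  rw [fderiv_add (h.differentiable (by simp) x) (h'.differentiable (by simp) x), map_add]

theorem gradient_smul_smooth {φ : Space m → ℝ} (c : ℝ) (h : ContDiff ℝ ∞ φ)
    (x : Space m) : gradient (c • φ) x = c • gradient φ x := by
  unfold gradient
  rw [fderiv_const_smul (h.differentiable (by simp) x)]
  simp


theorem IsTrace.congr {U Γ : Set (Space m)} {u u' : Space m → ℝ} {g g' : Space m → Space m}
    {v : Space m → ℝ} (h : IsTrace U Γ u g v) (hu : u' =ᵐ[volume.restrict U] u)
    (hg : g' =ᵐ[volume.restrict U] g) : IsTrace U Γ u' g' v := by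
  obtain ⟨hv, φ, h0, h1, h2, h3⟩ := h
  refine ⟨hv, φ, h0, ?_, ?_, h3⟩
  · refine h1.congr fun k => eLpNorm_congr_ae ?_
    filter_upwards [hu] with x hx; rw [hx]
  · refine h2.congr fun k => eLpNorm_congr_ae ?_
    filter_upwards [hg] with x hx; rw [hx]

theorem continuous_gradient_smooth {φ : Space m → ℝ} (h : ContDiff ℝ ∞ φ) :
    Continuous (gradient φ) :=
  (InnerProductSpace.toDual ℝ (Space m)).symm.continuous.comp (h.continuous_fderiv (by simp))

theorem tendsto_eLpNorm_add {F : Type*} [NormedAddCommGroup F] {μ : Measure (Space m)}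
    {f f' : ℕ → Space m → F} (hf : ∀ k, AEStronglyMeasurable (f k) μ)
    (hf' : ∀ k, AEStronglyMeasurable (f' k) μ)
    (h : Tendsto (fun k => eLpNorm (f k) 2 μ) atTop (𝓝 0))
    (h' : Tendsto (fun k => eLpNorm (f' k) 2 μ) atTop (𝓝 0)) :
    Tendsto (fun k => eLpNorm (f k + f' k) 2 μ) atTop (𝓝 0) := by
  have hs := h.add h'
  rw [add_zero] at hs
  exact tendsto_of_tendsto_of_tendsto_of_le_of_le tendsto_const_nhds hs (fun _ => zero_le)
    (fun k => eLpNorm_add_le (hf k) (hf' k) (by norm_num))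

theorem tendsto_eLpNorm_smul {F : Type*} [NormedAddCommGroup F] [NormedSpace ℝ F]
    {μ : Measure (Space m)} {f : ℕ → Space m → F} (c : ℝ)
    (h : Tendsto (fun k => eLpNorm (f k) 2 μ) atTop (𝓝 0)) :
    Tendsto (fun k => eLpNorm (c • f k) 2 μ) atTop (𝓝 0) := by
  simp only [eLpNorm_const_smul]
  simpa using ENNReal.Tendsto.const_mul h (Or.inr (by simp : (‖c‖ₑ : ℝ≥0∞) ≠ ⊤))

theorem IsTrace.add {U Γ : Set (Space m)} {u u' : Space m → ℝ} {g g' : Space m → Space m}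
    {v v' : Space m → ℝ} (h : IsTrace U Γ u g v) (h' : IsTrace U Γ u' g' v')
    (hu : MemLp u 2 (volume.restrict U)) (hu' : MemLp u' 2 (volume.restrict U))
    (hg : MemLp g 2 (volume.restrict U)) (hg' : MemLp g' 2 (volume.restrict U)) :
    IsTrace U Γ (u + u') (g + g') (v + v') := by
  obtain ⟨hv, φ, h0, h1, h2, h3⟩ := h
  obtain ⟨hv', φ', h0', h1', h2', h3'⟩ := h'
  refine ⟨hv.add hv', fun k => φ k + φ' k, fun k => (h0 k).add (h0' k), ?_, ?_, ?_⟩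
  · refine (tendsto_eLpNorm_add
      (fun k => hu.1.sub (h0 k).continuous.aestronglyMeasurable)
      (fun k => hu'.1.sub (h0' k).continuous.aestronglyMeasurable) h1 h1').congr fun k => ?_
    congr 1; ext x; simp; ring
  · refine (tendsto_eLpNorm_add
      (fun k => hg.1.sub (continuous_gradient_smooth (h0 k)).aestronglyMeasurable)
      (fun k => hg'.1.sub (continuous_gradient_smooth (h0' k)).aestronglyMeasurable)
      h2 h2').congr fun k => ?_
    congr 1; funext x
    simp only [Pi.add_apply, Pi.sub_apply, gradient_add_smooth (h0 k) (h0' k)]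
    abel
  · refine (tendsto_eLpNorm_add
      (fun k => hv.1.sub (h0 k).continuous.aestronglyMeasurable)
      (fun k => hv'.1.sub (h0' k).continuous.aestronglyMeasurable) h3 h3').congr fun k => ?_
    congr 1; ext x; simp; ring

theorem IsTrace.smul {U Γ : Set (Space m)} {u : Space m → ℝ} {g : Space m → Space m}
    {v : Space m → ℝ} (c : ℝ) (h : IsTrace U Γ u g v) : IsTrace U Γ (c • u) (c • g) (c • v) := by
  obtain ⟨hv, φ, h0, h1, h2, h3⟩ := h
  refine ⟨hv.const_smul c, fun k => c • φ k, fun k => contDiff_const.smul (h0 k), ?_, ?_, ?_⟩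
  · refine (tendsto_eLpNorm_smul c h1).congr fun k => ?_
    congr 1; ext x; simp; ring
  · refine (tendsto_eLpNorm_smul c h2).congr fun k => ?_
    congr 1; funext x
    simp only [Pi.smul_apply, gradient_smul_smooth c (h0 k), smul_sub]
  · refine (tendsto_eLpNorm_smul c h3).congr fun k => ?_
    congr 1; ext x; simp; ring

theorem IsTrace.zero (U Γ : Set (Space m)) :
    IsTrace U Γ (0 : Space m → ℝ) (0 : Space m → Space m) 0 := by
  refine ⟨MemLp.zero, fun _ => 0, fun _ => contDiff_const, ?_, ?_, ?_⟩
  · simp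
  · have : ∀ x : Space m, gradient (0 : Space m → ℝ) x = 0 := fun x => by simp [gradient]
    simp [this]
  · simp

/-- `H¹(U)`: pairs of a function and its weak gradient on `U`, both square integrable, with the inner
product `∫ w v dμ + ∫ ∇w · ∇v dν`. -/
def sobolev (U : Set (Space m)) (μ ν : Measure (Space m)) (hμ : Dominates U μ)
    (hν : Dominates U ν) : Submodule ℝ (WithLp 2 (Lp ℝ 2 μ × Lp (Space m) 2 ν)) where
  carrier := {p | IsWeakGradient U p.fst p.snd}
  zero_mem' := (IsWeakGradient.zero U).congr (hμ.ac.ae_eq (Lp.coeFn_zero ℝ 2 μ))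
    (hν.ac.ae_eq (Lp.coeFn_zero (Space m) 2 ν))
  add_mem' {p q} hp hq :=
    (hp.add hq (hμ.memLp (Lp.memLp p.fst)) (hμ.memLp (Lp.memLp q.fst))
      (hν.memLp (Lp.memLp p.snd)) (hν.memLp (Lp.memLp q.snd))).congr
      (hμ.ac.ae_eq (Lp.coeFn_add p.fst q.fst)) (hν.ac.ae_eq (Lp.coeFn_add p.snd q.snd))
  smul_mem' c p hp := (hp.smul c).congr (hμ.ac.ae_eq (Lp.coeFn_smul c p.fst))
    (hν.ac.ae_eq (Lp.coeFn_smul c p.snd))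

/-- The functions of `H¹(U)` with zero trace on `Γ`. -/
def sobolevZero (U Γ : Set (Space m)) (μ ν : Measure (Space m)) (hμ : Dominates U μ)
    (hν : Dominates U ν) : Submodule ℝ (WithLp 2 (Lp ℝ 2 μ × Lp (Space m) 2 ν)) where
  carrier := {p | p ∈ sobolev U μ ν hμ hν ∧ IsTrace U Γ p.fst p.snd 0}
  zero_mem' := ⟨Submodule.zero_mem _,
    (IsTrace.zero U Γ).congr (hμ.ac.ae_eq (Lp.coeFn_zero ℝ 2 μ))
      (hν.ac.ae_eq (Lp.coeFn_zero (Space m) 2 ν))⟩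
  add_mem' {p q} hp hq := ⟨Submodule.add_mem _ hp.1 hq.1, by
    have h := (hp.2.add hq.2 (hμ.memLp (Lp.memLp p.fst)) (hμ.memLp (Lp.memLp q.fst))
      (hν.memLp (Lp.memLp p.snd)) (hν.memLp (Lp.memLp q.snd))).congr
      (hμ.ac.ae_eq (Lp.coeFn_add p.fst q.fst)) (hν.ac.ae_eq (Lp.coeFn_add p.snd q.snd))
    rw [add_zero] at h
    exact h⟩
  smul_mem' c p hp := ⟨Submodule.smul_mem _ c hp.1, by
    have h := (hp.2.smul c).congr (hμ.ac.ae_eq (Lp.coeFn_smul c p.fst))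
      (hν.ac.ae_eq (Lp.coeFn_smul c p.snd))
    rw [smul_zero] at h
    exact h⟩

namespace ChannelGeometry

variable (G : ChannelGeometry m)

theorem volume_lastCoord_eq (s : ℝ) : volume {x : Space m | lastCoord x = s} = 0 := by
  have h := (EuclideanSpace.volume_preserving_symm_measurableEquiv_toLp
    (Fin (m + 1))).symm.measure_preimage_equiv {x : Space m | lastCoord x = s}
  rw [← h]
  exact Measure.pi_hyperplane (α := fun _ : Fin (m + 1) => ℝ) (fun _ => volume) (Fin.last m) s

theorem mouths_subset (ε s : ℝ) : G.mouths ε s ⊆ {x | lastCoord x = ε * s} := by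
  intro x hx
  obtain ⟨k, -, y, hy, rfl⟩ := by simpa only [mouths, mem_iUnion, exists_prop] using hx
  have : lastCoord y = s := hy.2
  have h0 : lastCoord (latticeVec k) = 0 := by simp [lastCoord, latticeVec, joinLast]
  have h1 : lastCoord (ε • (y + latticeVec k)) = ε * (lastCoord y + lastCoord (latticeVec k)) :=
    rfl
  simp only [mem_ofPred_eq, h1, h0, this, add_zero]

theorem dominates_weighted (ε : ℝ) {w : ℝ≥0∞} (hw : w ≠ 0) (hw' : w ≠ ⊤) :
    Dominates (G.microDomain ε) (G.weighted ε w) := by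
  refine ⟨1 + w⁻¹, by simpa using hw, ?_⟩
  have hz : ∀ s, volume.restrict (G.mouths ε s) = 0 := fun s =>
    Measure.restrict_eq_zero.2 (measure_mono_null (G.mouths_subset ε s) (volume_lastCoord_eq _))
  have h1 : volume.restrict (G.microDomain ε) ≤ volume.restrict (G.bulkPlus ε)
      + volume.restrict (G.bulkMinus ε) + volume.restrict (G.channels ε) := by
    refine (Measure.restrict_mono_set volume interior_subset).trans ?_
    refine (Measure.restrict_union_le _ _).trans ?_
    rw [hz, add_zero]
    refine (Measure.restrict_union_le _ _).trans ?_
    rw [hz, add_zero]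
    refine (Measure.restrict_union_le _ _).trans ?_
    gcongr
    exact Measure.restrict_union_le _ _
  refine h1.trans ?_
  intro s
  simp only [weighted, Measure.add_apply, Measure.smul_apply, smul_eq_mul]
  set a := (volume.restrict (G.bulkPlus ε)) s
  set b := (volume.restrict (G.bulkMinus ε)) s
  set c := (volume.restrict (G.channels ε)) s
  have hc : w⁻¹ * (w * c) = c := by rw [← mul_assoc, ENNReal.inv_mul_cancel hw hw', one_mul]
  calc a + b + c = 1 * (a + b) + w⁻¹ * (w * c) := by rw [hc, one_mul]
    _ ≤ (1 + w⁻¹) * (a + b) + (1 + w⁻¹) * (w * c) := by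
        gcongr
        · exact le_self_add
        · exact le_add_self
    _ = (1 + w⁻¹) * (a + b + w * c) := by rw [← mul_add]

theorem dominates_channels (ε : ℝ) {w : ℝ≥0∞} (hw : w ≠ 0) (hw' : w ≠ ⊤) :
    Dominates (G.channels ε) (w • volume.restrict (G.channels ε)) :=
  ⟨w⁻¹, by simpa using hw, by rw [smul_smul, ENNReal.inv_mul_cancel hw hw', one_smul]⟩

/-- The space `𝓛_ε = L²(Ω_ε)` with the inner product
`(w, v)_{Ω_ε⁺} + (w, v)_{Ω_ε⁻} + ε⁻¹ (w, v)_{Ω_{*,ε}^M}`. -/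
abbrev LSpace (ε : ℝ) : Type := Lp ℝ 2 (G.weighted ε (ENNReal.ofReal ε⁻¹))

/-- The space `𝓗_ε = H¹(Ω_ε)` with the inner product
`(w, v)_{𝓛_ε} + (∇w, ∇v)_{Ω_ε⁺} + (∇w, ∇v)_{Ω_ε⁻} + ε (∇w, ∇v)_{Ω_{*,ε}^M}`. -/
abbrev HSpace (ε : ℝ) (hε : 0 < ε) : Type :=
  sobolev (G.microDomain ε) (G.weighted ε (ENNReal.ofReal ε⁻¹)) (G.weighted ε (ENNReal.ofReal ε))
    (G.dominates_weighted ε (by simpa using hε) ENNReal.ofReal_ne_top)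
    (G.dominates_weighted ε (by simpa using hε) ENNReal.ofReal_ne_top)

/-- The space `𝓗_{ε,0}^M` of the functions in `H¹(Ω_{*,ε}^M)` with zero traces on `S_{*,ε}^±`, with
the inner product `ε⁻¹ (w, v)_{Ω_{*,ε}^M} + ε (∇w, ∇v)_{Ω_{*,ε}^M}`. -/
abbrev HSpaceM0 (ε : ℝ) (hε : 0 < ε) : Type :=
  sobolevZero (G.channels ε) (G.mouths ε 1 ∪ G.mouths ε (-1))
    (ENNReal.ofReal ε⁻¹ • volume.restrict (G.channels ε))
    (ENNReal.ofReal ε • volume.restrict (G.channels ε))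
    (G.dominates_channels ε (by simpa using hε) ENNReal.ofReal_ne_top)
    (G.dominates_channels ε (by simpa using hε) ENNReal.ofReal_ne_top)

variable {G} {ε : ℝ} {hε : 0 < ε}

/-- The embedding of `𝓗_ε` into `𝓛_ε`. -/
def HSpace.toL (v : G.HSpace ε hε) : G.LSpace ε := v.1.fst

/-- An element of `𝓗_ε` as a function. -/
def HSpace.val (v : G.HSpace ε hε) : Space m → ℝ := v.1.fst

/-- The gradient of an element of `𝓗_ε`. -/
def HSpace.grad (v : G.HSpace ε hε) : Space m → Space m := v.1.snd

/-- The trace on `N_ε` of (the restriction to the channels of) an element of `𝓗_ε`. -/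
def HSpace.trace (v : G.HSpace ε hε) : Space m → ℝ :=
  traceFun (G.channels ε) (G.lateral ε) v.val v.grad

/-- An element of `𝓗_{ε,0}^M` as a function. -/
def HSpaceM0.val (v : G.HSpaceM0 ε hε) : Space m → ℝ := v.1.fst

end ChannelGeometry

/-! ### The microscopic problem -/

/-- The bilinear form `A ξ · η` of a matrix. -/
def matForm (A : Matrix (Fin (m + 1)) (Fin (m + 1)) ℝ) (ξ η : Space m) : ℝ :=
  ∑ i, (∑ j, A i j * ξ j) * η i

/-- The data of the microscopic problem on the time interval `(0, T)`, with their assumptions. -/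
structure ProblemData (G : ChannelGeometry m) (T : ℝ) where
  /-- the diffusion coefficient `D⁺` -/
  Dp : ℝ
  /-- the diffusion coefficient `D⁻` -/
  Dm : ℝ
  Dp_pos : 0 < Dp
  Dm_pos : 0 < Dm
  /-- the diffusion matrix `D^M` on `Z*` -/
  DM : Space m → Matrix (Fin (m + 1)) (Fin (m + 1)) ℝ
  DM_bounded : ∀ i j, MemLp (fun y => DM y i j) ⊤ (volume.restrict G.Zs)
  DM_coercive : ∃ c₀ : ℝ, 0 < c₀ ∧ ∀ᵐ y ∂(volume.restrict G.Zs), ∀ ξ : Space m,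
    c₀ * ‖ξ‖ ^ 2 ≤ matForm (DM y) ξ ξ
  /-- the reaction rate `f⁺` -/
  fp : ℝ → Space m → ℝ → ℝ
  /-- the reaction rate `f⁻` -/
  fm : ℝ → Space m → ℝ → ℝ
  fp_continuous : ContinuousOn (fun p : ℝ × Space m × ℝ => fp p.1 p.2.1 p.2.2)
    (Icc 0 T ×ˢ closure G.Omega ×ˢ univ)
  fm_continuous : ContinuousOn (fun p : ℝ × Space m × ℝ => fm p.1 p.2.1 p.2.2)
    (Icc 0 T ×ˢ closure G.Omega ×ˢ univ)
  fp_lipschitz : ∃ L : ℝ≥0, ∀ t ∈ Icc 0 T, ∀ x ∈ closure G.Omega, LipschitzWith L (fp t x)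
  fm_lipschitz : ∃ L : ℝ≥0, ∀ t ∈ Icc 0 T, ∀ x ∈ closure G.Omega, LipschitzWith L (fm t x)
  /-- the reaction rate `g` in the standard channel -/
  g : ℝ → Space m → ℝ → ℝ
  g_continuous : ContinuousOn (fun p : ℝ × Space m × ℝ => g p.1 p.2.1 p.2.2)
    (Icc 0 T ×ˢ closure G.Zs ×ˢ univ)
  g_lipschitz : ∃ L : ℝ≥0, ∀ t ∈ Icc 0 T, ∀ y ∈ closure G.Zs, LipschitzWith L (g t y)
  /-- the reaction rate `h` on the lateral boundary of the standard channel -/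
  h : ℝ → Space m → ℝ → ℝ
  h_continuous : ContinuousOn (fun p : ℝ × Space m × ℝ => h p.1 p.2.1 p.2.2)
    (Icc 0 T ×ˢ closure (cellLateral G.Zs) ×ˢ univ)
  h_lipschitz : ∃ L : ℝ≥0, ∀ t ∈ Icc 0 T, ∀ y ∈ closure (cellLateral G.Zs), LipschitzWith L (h t y)
  /-- the initial value `u_i⁺` -/
  uip : Space m → ℝ
  /-- the initial value `u_i⁻` -/
  uim : Space m → ℝ
  /-- the initial value `u_i^M ∈ L²(Σ, C⁰(closure Z*))` -/
  uiM : Base m → BoundedContinuousFunction (closure G.Zs) ℝ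
  uip_memLp : MemLp uip 2 (volume.restrict G.OmegaPlus)
  uim_memLp : MemLp uim 2 (volume.restrict G.OmegaMinus)
  uiM_memLp : MemLp uiM 2 (volume.restrict G.Sig)

section Problem

variable {G : ChannelGeometry m} {T : ℝ}

open Classical in
/-- The initial value `u_{ε,i}`, equal to `u_i^±` in `Ω_ε^±` and to `u_i^M(x̄, x/ε)` in the
channels (periodically extended in the second variable). -/
def ProblemData.initial (P : ProblemData G T) (ε : ℝ) (x : Space m) : ℝ :=
  if x ∈ G.bulkPlus ε then P.uip x
  else if x ∈ G.bulkMinus ε then P.uim x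
  else if hy : cellArg (ε⁻¹ • x) ∈ closure G.Zs then P.uiM (bar x) ⟨cellArg (ε⁻¹ • x), hy⟩
  else 0

/-- Lebesgue measure on the time interval `(0, T)`. -/
def timeMeasure (T : ℝ) : Measure ℝ := volume.restrict (Ioo 0 T)

variable {ε : ℝ} {hε : 0 < ε}

/-- The function `d ∈ L²((0,T), 𝓗_ε')` is the time derivative `∂_t u` of `u ∈ L²((0,T), 𝓗_ε)`, in
the sense of the Gelfand triple `𝓗_ε ⊂ 𝓛_ε ⊂ 𝓗_ε'`. -/
def IsTimeDerivative (T : ℝ) (u : ℝ → G.HSpace ε hε) (d : ℝ → StrongDual ℝ (G.HSpace ε hε)) :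
    Prop :=
  MemLp d 2 (timeMeasure T) ∧
  ∀ ψ : ℝ → ℝ, ContDiff ℝ ∞ ψ → HasCompactSupport ψ → tsupport ψ ⊆ Ioo 0 T →
    ∀ φ : G.HSpace ε hε,
      ∫ t, deriv ψ t * inner ℝ (u t).toL φ.toL ∂(timeMeasure T)
        = - ∫ t, ψ t * d t φ ∂(timeMeasure T)

/-- The function `d ∈ L²((0,T), (𝓗_{ε,0}^M)')` is the time derivative of the restriction of `u` to
the channels, in the sense of the Gelfand triple `𝓗_{ε,0}^M ⊂ L²(Ω_{*,ε}^M) ⊂ (𝓗_{ε,0}^M)'`, where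
`L²(Ω_{*,ε}^M)` has its usual inner product. -/
def IsChannelTimeDerivative (T : ℝ) (u : ℝ → G.HSpace ε hε)
    (d : ℝ → StrongDual ℝ (G.HSpaceM0 ε hε)) : Prop :=
  MemLp d 2 (timeMeasure T) ∧
  ∀ ψ : ℝ → ℝ, ContDiff ℝ ∞ ψ → HasCompactSupport ψ → tsupport ψ ⊆ Ioo 0 T →
    ∀ φ : G.HSpaceM0 ε hε,
      ∫ t, deriv ψ t * (∫ x in G.channels ε, (u t).val x * φ.val x) ∂(timeMeasure T)
        = - ∫ t, ψ t * d t φ ∂(timeMeasure T)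

/-- The function `u` is a weak solution of the microscopic problem, and `du` is its time
derivative. -/
structure IsWeakSolution (P : ProblemData G T) (u : ℝ → G.HSpace ε hε)
    (du : ℝ → StrongDual ℝ (G.HSpace ε hε)) : Prop where
  memLp : MemLp u 2 (timeMeasure T)
  timeDerivative : IsTimeDerivative T u du
  equation : ∀ᵐ t ∂(timeMeasure T), ∀ φ : G.HSpace ε hε,
    du t φ
      + P.Dp * (∫ x in G.bulkPlus ε, inner ℝ ((u t).grad x) (φ.grad x))
      + P.Dm * (∫ x in G.bulkMinus ε, inner ℝ ((u t).grad x) (φ.grad x))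
      + ε * (∫ x in G.channels ε, matForm (P.DM (cellArg (ε⁻¹ • x))) ((u t).grad x) (φ.grad x))
    = (∫ x in G.bulkPlus ε, P.fp t x ((u t).val x) * φ.val x)
      + (∫ x in G.bulkMinus ε, P.fm t x ((u t).val x) * φ.val x)
      + ε⁻¹ * (∫ x in G.channels ε, P.g t (cellArg (ε⁻¹ • x)) ((u t).val x) * φ.val x)
      - ∫ x in G.lateral ε, P.h t (cellArg (ε⁻¹ • x)) ((u t).trace x) * φ.trace x
          ∂(Measure.euclideanHausdorffMeasure m)
  /-- `u(0) = u_{ε,i}` for the representative of `u` in `C⁰([0,T], 𝓛_ε)` -/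
  initial : ∃ v : ℝ → G.LSpace ε, ContinuousOn v (Icc 0 T) ∧
    (∀ᵐ t ∂(timeMeasure T), v t = (u t).toL) ∧
    v 0 =ᵐ[G.weighted ε (ENNReal.ofReal ε⁻¹)] P.initial ε

end Problem

end ThinChannels

end

/-!
The estimates rest on an energy argument with constants that do not depend on `ε`.

At a fixed time, the weak formulation says that `∂ₜu` is the difference of a reaction form and a
diffusion form. The weights `ε⁻¹` and `ε` in the norms of `𝓛_ε` and `𝓗_ε` are those that scaling
of the standard channel produces, so that all forms are bounded uniformly in `ε`
(`ProblemData.exists_diffusion_le`, `ProblemData.exists_reaction_le`), and the diffusion is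
coercive in the gradient (`ProblemData.exists_diffusion_ge`). The only term without an evident
bound is the integral over the lateral boundary `N_ε`. For it, the trace inequality `‖v‖²_{∂Z*} ≤
C ‖v‖²_{Z*} + θ ‖∇v‖²_{Z*}` with an arbitrarily small factor `θ` (`trace_inequality`) is scaled to
the cells and summed up (`ChannelGeometry.trace_inequality_channels`,
`ChannelGeometry.exists_trace_bound`). With `θ` small, the boundary term is absorbed by the
diffusion, and one obtains `‖∂ₜu‖ ≤ C (1 + ‖u‖)` and `⟨∂ₜu, u⟩ + c ‖u‖² ≤ C (1 + ‖u‖²_𝓛)` at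
almost every time (`ProblemData.exists_structure_constants`). The initial values are bounded in
`𝓛_ε` since the thickness of the layer compensates for the weight `ε⁻¹`
(`ProblemData.exists_initial_bound`).

In an abstract Gelfand triple, these inequalities bound `u` and `∂ₜu` (`eLpNorm_add_eLpNorm_le`):
the energy identity `‖v(τ)‖² - ‖v(0)‖² = 2 ∫₀^τ ⟨∂ₜu, u⟩` for the continuous representative `v`
(`energy_identity`) is combined with Grönwall's inequality. The energy identity is proved without
regularization in time. The correlation `r ↦ ∫ ⟨∂ₜu(t + r), u(t)⟩ dt` is continuous, and its
average over `(-h, h)` is an average of increments of `t ↦ ⟪v(t + h), v(t)⟫`, which is a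
telescoping expression; then `h → 0`.

For the channels, a function with zero trace on the mouths `S_{*,ε}^±` can be extended by zero to
an element of `𝓗_ε` (`ChannelGeometry.HSpaceM0.zeroExtend`): the channels are the part of `Ω_ε` in
the layer `|xₙ| < ε`, and integration by parts in this layer produces boundary terms on the mouths
only (`ChannelGeometry.integral_channels_of_trace_zero`). The time derivative of the restriction
to the channels is `∂ₜu`, tested with such extensions. Since the usual inner product of
`L²(Ω_{*,ε}^M)` is `ε` times the one that `𝓛_ε` uses on the channels, this derivative carries a
factor `ε` (`exists_channelTimeDerivative`).
-/

namespace ThinChannels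

section

/-! ### Weak derivatives in time -/

theorem deriv_smoothTransition_eq_zero {r : ℝ} (hr : r ∉ Ioc (0 : ℝ) 1) :
    deriv Real.smoothTransition r = 0 := by
  rcases le_or_gt r 0 with h | h
  · refine IsLocalMin.deriv_eq_zero (Eventually.of_forall fun x => ?_)
    rw [Real.smoothTransition.zero_of_nonpos h]
    exact Real.smoothTransition.nonneg x
  · have h1 : 1 ≤ r := by
      by_contra! h1
      exact hr ⟨h, h1.le⟩
    refine IsLocalMax.deriv_eq_zero (Eventually.of_forall fun x => ?_)
    rw [Real.smoothTransition.one_of_one_le h1]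
    exact Real.smoothTransition.le_one x

theorem continuous_deriv_smoothTransition : Continuous (deriv Real.smoothTransition) :=
  (Real.smoothTransition.contDiff (n := 1)).continuous_deriv (by simp)

theorem hasDerivAt_smoothTransition_comp (a δ t : ℝ) :
    HasDerivAt (fun t => Real.smoothTransition ((t - a) / δ))
      (deriv Real.smoothTransition ((t - a) / δ) / δ) t := by
  have h1 : HasDerivAt (fun t : ℝ => (t - a) / δ) (1 / δ) t :=
    ((hasDerivAt_id t).sub_const a).div_const δ
  have h2 := ((Real.smoothTransition.contDiff (n := 1)).differentiable (by simp)
    ((t - a) / δ)).hasDerivAt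
  have := h2.comp t h1
  rwa [mul_one_div] at this

theorem integral_deriv_smoothTransition_mul {w : ℝ → ℝ} {a δ : ℝ} (hδ : 0 < δ) :
    ∫ t, deriv Real.smoothTransition ((t - a) / δ) / δ * w t
      = ∫ r in (0 : ℝ)..1, deriv Real.smoothTransition r * w (a + δ * r) := by
  have h1 : ∀ t, deriv Real.smoothTransition ((t - a) / δ) / δ * w t
      = δ⁻¹ * (fun r => deriv Real.smoothTransition r * w (a + δ * r)) ((t - a) / δ) := by
    intro t
    have : a + δ * ((t - a) / δ) = t := by field_simp; ring
    simp only [this]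
    ring
  simp only [h1]
  rw [integral_const_mul]
  rw [integral_sub_right_eq_self
    (fun t => (fun r => deriv Real.smoothTransition r * w (a + δ * r)) (t / δ)) a]
  rw [Measure.integral_comp_div (fun r => deriv Real.smoothTransition r * w (a + δ * r)) δ,
    abs_of_pos hδ, smul_eq_mul, ← mul_assoc,
    inv_mul_cancel₀ hδ.ne', one_mul]
  rw [intervalIntegral.integral_eq_integral_of_support_subset]
  intro r hr
  by_contra h
  exact hr (by simp [deriv_smoothTransition_eq_zero h])

/-- The derivatives of the smoothed jumps at `a` tend to the Dirac measure at `a` (and the jumps to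
the indicator function of `(a, ∞)`, see `tendsto_smoothTransition_indicator`). -/
theorem tendsto_integral_deriv_smoothTransition {w : ℝ → ℝ} (hw : Continuous w) (a : ℝ) :
    Tendsto (fun δ => ∫ t, deriv Real.smoothTransition ((t - a) / δ) / δ * w t) (𝓝[>] 0)
      (𝓝 (w a)) := by
  have hc : Continuous (fun δ : ℝ =>
      ∫ r in (0 : ℝ)..1, deriv Real.smoothTransition r * w (a + δ * r)) := by
    refine intervalIntegral.continuous_parametric_intervalIntegral_of_continuous' ?_ _ _
    have := continuous_deriv_smoothTransition
    simp only [Function.uncurry_def]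
    fun_prop
  have h0 := hc.tendsto 0
  have e0 : ∫ r in (0 : ℝ)..1, deriv Real.smoothTransition r * w (a + 0 * r) = w a := by
    simp only [zero_mul, add_zero]
    rw [intervalIntegral.integral_mul_const, intervalIntegral.integral_deriv_eq_sub
      (fun x _ => (Real.smoothTransition.contDiff (n := 1)).differentiable (by simp) x)
      (continuous_deriv_smoothTransition.intervalIntegrable _ _)]
    simp
  rw [e0] at h0
  refine (h0.mono_left nhdsWithin_le_nhds).congr' ?_
  filter_upwards [self_mem_nhdsWithin] with δ hδ
  rw [integral_deriv_smoothTransition_mul hδ]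

theorem tendsto_smoothTransition_indicator (a t : ℝ) :
    Tendsto (fun δ => Real.smoothTransition ((t - a) / δ)) (𝓝[>] 0)
      (𝓝 ((Ioi a).indicator 1 t)) := by
  refine tendsto_const_nhds.congr' ?_
  by_cases h : a < t
  · have : Ioo 0 (t - a) ∈ 𝓝[>] (0 : ℝ) := Ioo_mem_nhdsGT (by linarith)
    filter_upwards [this] with δ hδ
    rw [Real.smoothTransition.one_of_one_le, indicator_of_mem (by exact h)]
    · rfl
    · rw [le_div_iff₀ hδ.1]; linarith [hδ.2]
  · filter_upwards [self_mem_nhdsWithin] with δ hδ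
    rw [Real.smoothTransition.zero_of_nonpos, indicator_of_notMem (by exact h)]
    exact div_nonpos_of_nonpos_of_nonneg (by linarith) (le_of_lt hδ)

/-- A continuous function whose weak derivative on `(0, T)` is the integrable function `k` is a
primitive of `k`: test the weak derivative with smoothed indicator functions of `(a, b)`. -/
theorem sub_eq_integral_of_weak_deriv {T : ℝ} {w k : ℝ → ℝ} (hw : Continuous w)
    (hk : Integrable k)
    (h : ∀ ψ : ℝ → ℝ, ContDiff ℝ ∞ ψ → HasCompactSupport ψ → tsupport ψ ⊆ Ioo 0 T →
      ∫ t, deriv ψ t * w t = - ∫ t, ψ t * k t)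
    {a b : ℝ} (ha : 0 < a) (hab : a ≤ b) (hb : b < T) : w b - w a = ∫ t in a..b, k t := by
  set ψ : ℝ → ℝ → ℝ := fun δ t =>
    Real.smoothTransition ((t - a) / δ) - Real.smoothTransition ((t - b) / δ) with hψ
  have hder : ∀ δ t, deriv (ψ δ) t = deriv Real.smoothTransition ((t - a) / δ) / δ
      - deriv Real.smoothTransition ((t - b) / δ) / δ := fun δ t =>
    ((hasDerivAt_smoothTransition_comp a δ t).sub (hasDerivAt_smoothTransition_comp b δ t)).deriv
  have hsupp : ∀ δ, 0 < δ → tsupport (ψ δ) ⊆ Icc a (b + δ) := by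
    intro δ hδ
    refine closure_minimal ?_ isClosed_Icc
    intro t ht
    by_contra hn
    apply ht
    rw [mem_Icc, not_and_or, not_le, not_le] at hn
    rcases hn with hn | hn
    · simp only [hψ]
      rw [Real.smoothTransition.zero_of_nonpos, Real.smoothTransition.zero_of_nonpos, sub_zero]
      · exact div_nonpos_of_nonpos_of_nonneg (by linarith) hδ.le
      · exact div_nonpos_of_nonpos_of_nonneg (by linarith) hδ.le
    · simp only [hψ]
      rw [Real.smoothTransition.one_of_one_le, Real.smoothTransition.one_of_one_le, sub_self]
      · rw [le_div_iff₀ hδ]; linarith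
      · rw [le_div_iff₀ hδ]; linarith
  have hint : ∀ δ, 0 < δ → ∀ c, Integrable
      (fun t => deriv Real.smoothTransition ((t - c) / δ) / δ * w t) := by
    intro δ hδ c
    refine Continuous.integrable_of_hasCompactSupport ?_ ?_
    · have := continuous_deriv_smoothTransition
      fun_prop
    · refine HasCompactSupport.intro (K := Icc c (c + δ)) isCompact_Icc fun t ht => ?_
      rw [deriv_smoothTransition_eq_zero, zero_div, zero_mul]
      intro hh
      apply ht
      have h1 := hh.1
      have h2 := hh.2
      rw [div_le_iff₀ hδ] at h2
      have h3 : 0 < t - c := by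
        by_contra! h4
        exact absurd h1 (not_lt.2 (div_nonpos_of_nonpos_of_nonneg h4 hδ.le))
      exact ⟨by linarith, by linarith⟩
  have hlim1 := (tendsto_integral_deriv_smoothTransition hw a).sub
    (tendsto_integral_deriv_smoothTransition hw b)
  have hlim2 : Tendsto (fun δ => - ∫ t, ψ δ t * k t) (𝓝[>] 0)
      (𝓝 (- ∫ t, (Ioc a b).indicator 1 t * k t)) := by
    refine Tendsto.neg (tendsto_integral_filter_of_dominated_convergence (fun t => 1 * ‖k t‖)
      ?_ ?_ (hk.norm.const_mul 1) ?_)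
    · refine Eventually.of_forall fun δ => AEStronglyMeasurable.mul ?_ hk.1
      refine Continuous.aestronglyMeasurable ?_
      have := Real.smoothTransition.continuous
      simp only [hψ]
      fun_prop
    · refine Eventually.of_forall fun δ => Eventually.of_forall fun t => ?_
      rw [norm_mul]
      refine mul_le_mul_of_nonneg_right ?_ (norm_nonneg _)
      simp only [hψ]
      rw [Real.norm_eq_abs, abs_le]
      have h1 := Real.smoothTransition.nonneg ((t - a) / δ)
      have h2 := Real.smoothTransition.nonneg ((t - b) / δ)
      have h3 := Real.smoothTransition.le_one ((t - a) / δ)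
      have h4 := Real.smoothTransition.le_one ((t - b) / δ)
      exact ⟨by linarith, by linarith⟩
    · refine Eventually.of_forall fun t => Tendsto.mul_const _ ?_
      have := (tendsto_smoothTransition_indicator a t).sub (tendsto_smoothTransition_indicator b t)
      convert this using 2
      by_cases h1 : a < t <;> by_cases h2 : b < t <;>
        simp [indicator, h1, h2, not_le.2, not_lt.1]
      linarith
  have heq : (fun δ => (∫ t, deriv Real.smoothTransition ((t - a) / δ) / δ * w t)
      - ∫ t, deriv Real.smoothTransition ((t - b) / δ) / δ * w t)
      =ᶠ[𝓝[>] 0] fun δ => - ∫ t, ψ δ t * k t := by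
    have : Ioo 0 (T - b) ∈ 𝓝[>] (0 : ℝ) := Ioo_mem_nhdsGT (by linarith)
    filter_upwards [this] with δ hδ
    have hs := hsupp δ hδ.1
    rw [← h (ψ δ) ?_ ?_ ?_, ← integral_sub (hint δ hδ.1 a) (hint δ hδ.1 b)]
    · refine integral_congr_ae (Eventually.of_forall fun t => ?_)
      simp only [hder]
      ring
    · have h1 : ContDiff ℝ ∞ Real.smoothTransition := Real.smoothTransition.contDiff
      exact (h1.comp (by fun_prop)).sub (h1.comp (by fun_prop))
    · exact HasCompactSupport.of_support_subset_isCompact isCompact_Icc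
        ((subset_tsupport _).trans hs)
    · exact hs.trans fun t ht => ⟨by linarith [ht.1], by linarith [ht.2, hδ.2]⟩
  have hfin := tendsto_nhds_unique (hlim1.congr' heq) hlim2
  have e1 : ∫ t, (Ioc a b).indicator 1 t * k t = ∫ t in a..b, k t := by
    rw [intervalIntegral.integral_of_le hab, ← integral_indicator measurableSet_Ioc]
    refine integral_congr_ae (Eventually.of_forall fun t => ?_)
    by_cases h1 : t ∈ Ioc a b <;> simp [h1]
  rw [e1] at hfin
  linarith

end

section

/-! ### The energy identity of a Gelfand triple -/

/-- The extension of `v : [0, T] → L` to the real line by its boundary values. -/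
def clampExtend {L : Type*} (T : ℝ) (v : ℝ → L) (t : ℝ) : L := v (max 0 (min T t))

theorem continuous_clampExtend {L : Type*} [TopologicalSpace L] {T : ℝ} (hT : 0 ≤ T) {v : ℝ → L}
    (hv : ContinuousOn v (Icc 0 T)) :
    Continuous (clampExtend T v) :=
  hv.comp_continuous (by fun_prop) fun t => ⟨le_max_left _ _, max_le hT (min_le_left _ _)⟩

theorem clampExtend_of_mem {L : Type*} {T : ℝ} {v : ℝ → L} {t : ℝ} (ht : t ∈ Icc 0 T) :
    clampExtend T v t = v t := by
  simp [clampExtend, ht.1, ht.2]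

theorem clampExtend_of_nonpos {L : Type*} {T : ℝ} (hT : 0 ≤ T) {v : ℝ → L} {t : ℝ} (ht : t ≤ 0) :
    clampExtend T v t = v 0 := by
  simp [clampExtend, ht, ht.trans hT]

theorem clampExtend_of_ge {L : Type*} {T : ℝ} (hT : 0 ≤ T) {v : ℝ → L} {t : ℝ} (ht : T ≤ t) :
    clampExtend T v t = v T := by
  simp [clampExtend, hT, ht]

variable {E L : Type*} [NormedAddCommGroup E] [NormedSpace ℝ E] [NormedAddCommGroup L]
  [InnerProductSpace ℝ L]

theorem integrable_dual_apply {d : ℝ → StrongDual ℝ E} {s : Set ℝ} (hs : volume s ≠ ⊤)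
    (hd : MemLp d 2 (volume.restrict s)) (φ : E) :
    Integrable (fun t => d t φ) (volume.restrict s) := by
  have : IsFiniteMeasure (volume.restrict s) := ⟨by simpa using hs.lt_top⟩
  exact (ContinuousLinearMap.apply ℝ ℝ φ).integrable_comp (hd.integrable (by norm_num))

/-- The increments of the continuous representative of `u` are the integrals of the weak time
derivative `d`, extended by zero. -/
theorem inner_increment_eq_integral {T : ℝ} (hT : 0 < T) (ι : E →L[ℝ] L) {u : ℝ → E}
    {d : ℝ → StrongDual ℝ E} {v : ℝ → L}
    (hd : MemLp d 2 (volume.restrict (Ioo 0 T)))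
    (hweak : ∀ ψ : ℝ → ℝ, ContDiff ℝ ∞ ψ → HasCompactSupport ψ → tsupport ψ ⊆ Ioo 0 T →
      ∀ φ : E, ∫ t in Ioo 0 T, deriv ψ t * inner ℝ (ι (u t)) (ι φ)
        = - ∫ t in Ioo 0 T, ψ t * d t φ)
    (hv : ContinuousOn v (Icc 0 T)) (hvu : ∀ᵐ t ∂(volume.restrict (Ioo 0 T)), v t = ι (u t))
    (φ : E) (a b : ℝ) :
    ∫ t in a..b, (Ioo 0 T).indicator (fun t => d t φ) t
      = inner ℝ (clampExtend T v b - clampExtend T v a) (ι φ) := by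
  set k : ℝ → ℝ := (Ioo 0 T).indicator (fun t => d t φ) with hk
  set w : ℝ → ℝ := fun t => inner ℝ (clampExtend T v t) (ι φ) with hw
  have hvc := continuous_clampExtend hT.le hv
  have hwc : Continuous w := by fun_prop
  have hki : Integrable k :=
    (integrable_indicator_iff measurableSet_Ioo).2 (integrable_dual_apply (by simp) hd φ)
  have hweak' : ∀ ψ : ℝ → ℝ, ContDiff ℝ ∞ ψ → HasCompactSupport ψ → tsupport ψ ⊆ Ioo 0 T →
      ∫ t, deriv ψ t * w t = - ∫ t, ψ t * k t := by
    intro ψ h1 h2 h3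
    have e1 : ∫ t, deriv ψ t * w t = ∫ t in Ioo 0 T, deriv ψ t * inner ℝ (ι (u t)) (ι φ) := by
      rw [← setIntegral_eq_integral_of_forall_compl_eq_zero (s := Ioo 0 T)]
      · refine setIntegral_congr_ae measurableSet_Ioo ?_
        filter_upwards [(ae_restrict_iff' measurableSet_Ioo).1 hvu] with t ht hm
        simp only [hw]
        rw [clampExtend_of_mem (Ioo_subset_Icc_self hm), ht hm]
      · intro t ht
        have : deriv ψ t = 0 := by
          by_contra hne
          exact ht (h3 (support_deriv_subset hne))
        rw [this, zero_mul]
    have e2 : ∫ t, ψ t * k t = ∫ t in Ioo 0 T, ψ t * d t φ := by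
      rw [← integral_indicator measurableSet_Ioo]
      refine integral_congr_ae (Eventually.of_forall fun t => ?_)
      by_cases ht : t ∈ Ioo 0 T <;> simp [hk, ht]
    rw [e1, e2]
    exact hweak ψ h1 h2 h3 φ
  -- the difference of the two sides, as a function of the end point, is constant
  set W : ℝ → ℝ := fun t => w t - ∫ s in (0 : ℝ)..t, k s with hW
  have hWc : Continuous W := hwc.sub (intervalIntegral.continuous_primitive
    (fun a b => hki.intervalIntegrable) 0)
  have hsub : ∀ x y, W y - W x = w y - w x - ∫ s in x..y, k s := by
    intro x y
    simp only [hW]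
    rw [← intervalIntegral.integral_add_adjacent_intervals (a := 0) (b := x) (c := y)
      hki.intervalIntegrable hki.intervalIntegrable]
    ring
  have hmid : ∀ t ∈ Icc 0 T, W t = W (T / 2) := by
    have hcl : IsClosed {t | W t = W (T / 2)} := isClosed_eq hWc continuous_const
    have hsubset : Ioo 0 T ⊆ {t | W t = W (T / 2)} := by
      intro t ht
      rcases le_total t (T / 2) with h | h
      · have := hsub t (T / 2)
        rw [sub_eq_integral_of_weak_deriv hwc hki hweak' ht.1 h (by linarith)] at this
        simp only [mem_ofPred_eq]
        linarith
      · have := hsub (T / 2) t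
        rw [sub_eq_integral_of_weak_deriv hwc hki hweak' (by linarith) h ht.2] at this
        simp only [mem_ofPred_eq]
        linarith
    intro t ht
    have := closure_minimal hsubset hcl
    rw [closure_Ioo hT.ne] at this
    exact this ht
  have hconst : ∀ t, W t = W (T / 2) := by
    intro t
    rcases le_or_gt t 0 with h | h
    · rw [← hmid 0 ⟨le_rfl, hT.le⟩]
      have h1 := hsub t 0
      have h2 : ∫ s in t..0, k s = 0 := by
        rw [intervalIntegral.integral_of_le h]
        refine setIntegral_eq_zero_of_forall_eq_zero fun s hs => ?_
        simp only [hk]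
        exact indicator_of_notMem (fun hh => absurd hh.1 (not_lt.2 hs.2)) _
      have h3 : w t = w 0 := by
        simp only [hw]
        rw [clampExtend_of_nonpos hT.le h, clampExtend_of_nonpos hT.le le_rfl]
      rw [h2, h3] at h1
      linarith
    · rcases le_or_gt t T with h' | h'
      · exact hmid t ⟨h.le, h'⟩
      · rw [← hmid T ⟨hT.le, le_rfl⟩]
        have h1 := hsub T t
        have h2 : ∫ s in T..t, k s = 0 := by
          rw [intervalIntegral.integral_of_le h'.le]
          refine setIntegral_eq_zero_of_forall_eq_zero fun s hs => ?_
          simp only [hk]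
          exact indicator_of_notMem (fun hh => absurd hh.2 (not_lt.2 hs.1.le)) _
        have h3 : w t = w T := by
          simp only [hw]
          rw [clampExtend_of_ge hT.le h'.le, clampExtend_of_ge hT.le le_rfl]
        rw [h2, h3] at h1
        linarith
  have := hsub a b
  rw [hconst a, hconst b] at this
  rw [inner_sub_left]
  simp only [hw] at this
  linarith

/-- The correlation `r ↦ ∫ D(t + r) (U t) dt` of two square integrable functions is continuous,
because translation is continuous in `L²`. -/
theorem continuous_correlation {D : ℝ → StrongDual ℝ E} {U : ℝ → E} (hD : MemLp D 2)
    (hU : MemLp U 2) : Continuous fun r : ℝ => ∫ t, D (t + r) (U t) := by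
  have hmp : ∀ r : ℝ, MeasurePreserving (fun t : ℝ => t + r) :=
    fun r => measurePreserving_add_right volume r
  let g : ℝ → C(ℝ, ℝ) := fun r => ⟨fun t => t + r, by fun_prop⟩
  have hg : Continuous g :=
    (ContinuousMap.mk (fun p : ℝ × ℝ => p.2 + p.1) (by fun_prop)).curry.continuous
  have h1 : Continuous fun r => Lp.compMeasurePreserving (g r) (hmp r) (hD.toLp D) :=
    Continuous.compMeasurePreservingLp (f := fun _ => hD.toLp D) continuous_const hg hmp
      (by norm_num)
  have h2 := (((ContinuousLinearMap.id ℝ (StrongDual ℝ E)).lpPairing volume 2 2).flip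
    (hU.toLp U)).continuous.comp h1
  refine h2.congr fun r => ?_
  simp only [Function.comp_apply, ContinuousLinearMap.flip_apply,
    ContinuousLinearMap.lpPairing_eq_integral]
  refine integral_congr_ae ?_
  filter_upwards [Lp.coeFn_compMeasurePreserving (hD.toLp D) (hmp r), hU.coeFn_toLp,
    (hmp r).quasiMeasurePreserving.ae_eq_comp hD.coeFn_toLp] with t ht1 ht2 ht3
  have ht3' : (hD.toLp D) (t + r) = D (t + r) := ht3
  have ht1' : (Lp.compMeasurePreserving (g r) (hmp r) (hD.toLp D)) t = (hD.toLp D) (t + r) := ht1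
  simp only [ContinuousLinearMap.id_apply]
  rw [ht1', ht2, ht3']

theorem integrable_correlation {D : ℝ → StrongDual ℝ E} {U : ℝ → E} (hD : MemLp D 2)
    (hU : MemLp U 2) (h : ℝ) :
    Integrable (fun p : ℝ × ℝ => D (p.2 + p.1) (U p.2))
      ((volume.restrict (Ioc (-h) h)).prod volume) := by
  have hqmp : Measure.QuasiMeasurePreserving (fun p : ℝ × ℝ => p.2 + p.1)
      ((volume.restrict (Ioc (-h) h)).prod volume) volume := by
    have h1 : Measure.QuasiMeasurePreserving (fun p : ℝ × ℝ => p.2 + p.1)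
        ((volume : Measure ℝ).prod volume) volume := by
      have := (quasiMeasurePreserving_add (volume : Measure ℝ) volume)
      simpa [add_comm] using this
    refine h1.mono_left ?_
    exact (Measure.prod_mono Measure.restrict_le_self le_rfl).absolutelyContinuous
  have hDm : AEStronglyMeasurable (fun p : ℝ × ℝ => D (p.2 + p.1))
      ((volume.restrict (Ioc (-h) h)).prod volume) := hD.1.comp_quasiMeasurePreserving hqmp
  have hUm : AEStronglyMeasurable (fun p : ℝ × ℝ => U p.2)
      ((volume.restrict (Ioc (-h) h)).prod volume) := hU.1.comp_snd
  have hm : AEStronglyMeasurable (fun p : ℝ × ℝ => D (p.2 + p.1) (U p.2))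
      ((volume.restrict (Ioc (-h) h)).prod volume) :=
    (ContinuousLinearMap.id ℝ (StrongDual ℝ E)).aestronglyMeasurable_comp₂ hDm hUm
  have hmp : ∀ r : ℝ, MeasurePreserving (fun t : ℝ => t + r) :=
    fun r => measurePreserving_add_right volume r
  have hDr : ∀ r, MemLp (fun t => D (t + r)) 2 := fun r => hD.comp_measurePreserving (hmp r)
  have hD2 : Integrable (fun t => ‖D t‖ ^ 2) := (memLp_two_iff_integrable_sq_norm hD.1).1 hD
  have hU2 : Integrable (fun t => ‖U t‖ ^ 2) := (memLp_two_iff_integrable_sq_norm hU.1).1 hU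
  have hb : ∀ r t, ‖D (t + r) (U t)‖ ≤ ‖D (t + r)‖ ^ 2 + ‖U t‖ ^ 2 := by
    intro r t
    refine ((D (t + r)).le_opNorm _).trans ?_
    nlinarith [sq_nonneg (‖D (t + r)‖ - ‖U t‖), sq_nonneg (‖D (t + r)‖), sq_nonneg ‖U t‖]
  have hDr2 : ∀ r, Integrable (fun t => ‖D (t + r)‖ ^ 2) := fun r => hD2.comp_add_right r
  have hi : ∀ r, Integrable (fun t => D (t + r) (U t)) := by
    intro r
    refine ((hDr2 r).add hU2).mono' ?_ (Eventually.of_forall (hb r))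
    exact (ContinuousLinearMap.id ℝ (StrongDual ℝ E)).aestronglyMeasurable_comp₂ (hDr r).1 hU.1
  rw [integrable_prod_iff hm]
  refine ⟨Eventually.of_forall hi, ?_⟩
  refine (integrable_const (∫ t, ‖D t‖ ^ 2 + ‖U t‖ ^ 2)).mono' hm.norm.integral_prod_right' ?_
  refine Eventually.of_forall fun r => ?_
  rw [Real.norm_of_nonneg (integral_nonneg fun _ => norm_nonneg _)]
  calc ∫ t, ‖D (t + r) (U t)‖ ≤ ∫ t, ‖D (t + r)‖ ^ 2 + ‖U t‖ ^ 2 :=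
        integral_mono (hi r).norm ((hDr2 r).add hU2) (hb r)
    _ = ∫ t, ‖D t‖ ^ 2 + ‖U t‖ ^ 2 := by
        rw [integral_add (hDr2 r) hU2, integral_add hD2 hU2,
          integral_add_right_eq_self (fun t => ‖D t‖ ^ 2) r]

end

section

variable {E L : Type*} [NormedAddCommGroup E] [NormedSpace ℝ E] [NormedAddCommGroup L]
  [InnerProductSpace ℝ L]

theorem exists_memLp_zero_extension {F : Type*} [NormedAddCommGroup F] {s : Set ℝ}
    (hs : MeasurableSet s) {f : ℝ → F} (hf : MemLp f 2 (volume.restrict s)) :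
    ∃ g : ℝ → F, MemLp g 2 ∧ (∀ t ∈ s, g t = f t) ∧ ∀ t ∉ s, g t = 0 :=
  ⟨s.indicator f, (memLp_indicator_iff_restrict hs).2 hf, fun _ ht => indicator_of_mem ht _,
    fun _ ht => indicator_of_notMem ht _⟩

/-- The averages over `(-h, h)` of the correlation of `d` and `u` (extended by zero to `D` and `U`)
are averages of increments of `t ↦ ⟪v (t + h), v t⟫`. As `h → 0`, the two sides become the two sides
of the energy identity; no regularization of `u` in time is needed. -/
theorem integral_correlation_eq {T : ℝ} (hT : 0 < T) (ι : E →L[ℝ] L) {u : ℝ → E}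
    {d : ℝ → StrongDual ℝ E} {v : ℝ → L}
    (hd : MemLp d 2 (volume.restrict (Ioo 0 T)))
    (hweak : ∀ ψ : ℝ → ℝ, ContDiff ℝ ∞ ψ → HasCompactSupport ψ → tsupport ψ ⊆ Ioo 0 T →
      ∀ φ : E, ∫ t in Ioo 0 T, deriv ψ t * inner ℝ (ι (u t)) (ι φ)
        = - ∫ t in Ioo 0 T, ψ t * d t φ)
    (hv : ContinuousOn v (Icc 0 T)) (hvu : ∀ᵐ t ∂(volume.restrict (Ioo 0 T)), v t = ι (u t))
    {D : ℝ → StrongDual ℝ E} {U : ℝ → E} (hD : MemLp D 2)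
    (hD1 : ∀ t ∈ Ioo 0 T, D t = d t) (hD0 : ∀ t ∉ Ioo 0 T, D t = 0) (hU : MemLp U 2)
    (hU1 : ∀ t ∈ Ioo 0 T, U t = u t) (hU0 : ∀ t ∉ Ioo 0 T, U t = 0) {h : ℝ} (hh : 0 < h) :
    ∫ s in (-1 : ℝ)..1, (∫ t, D (t + h * s) (U t))
      = ∫ s in (0 : ℝ)..1, (inner ℝ (clampExtend T v (T - h * s + h)) (clampExtend T v (T - h * s))
          - inner ℝ (clampExtend T v (0 - h * s + h)) (clampExtend T v (0 - h * s))) := by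
  set vb := clampExtend T v with hvb
  have hvc : Continuous vb := continuous_clampExtend hT.le hv
  set p : ℝ → ℝ := fun t => inner ℝ (vb (t + h)) (vb t) with hp
  have hpc : Continuous p := by fun_prop
  have hpi : ∀ a b, IntervalIntegrable p volume a b := fun a b => hpc.intervalIntegrable a b
  have hL : ∫ s in (-1 : ℝ)..1, (∫ t, D (t + h * s) (U t))
      = h⁻¹ * ∫ r in (-h)..h, ∫ t, D (t + r) (U t) := by
    rw [intervalIntegral.integral_comp_mul_left (fun r => ∫ t, D (t + r) (U t)) hh.ne']
    simp
  have hR : ∫ s in (0 : ℝ)..1, (p (T - h * s) - p (0 - h * s))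
      = h⁻¹ * ((∫ t in (T - h)..T, p t) - ∫ t in (-h)..0, p t) := by
    rw [intervalIntegral.integral_sub
      ((by fun_prop : Continuous fun s => p (T - h * s)).intervalIntegrable _ _)
      ((by fun_prop : Continuous fun s => p (0 - h * s)).intervalIntegrable _ _)]
    rw [intervalIntegral.integral_comp_sub_mul p hh.ne' T,
      intervalIntegral.integral_comp_sub_mul p hh.ne' 0]
    simp
    ring
  -- integrating the correlation in `r` first turns `d` into an increment of `v`
  have hmid : ∀ᵐ t, ∫ r in Ioc (-h) h, D (t + r) (U t)
      = (Ioo 0 T).indicator (fun t => p t - p (t - h)) t := by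
    filter_upwards [(ae_restrict_iff' measurableSet_Ioo).1 hvu] with t ht
    by_cases hm : t ∈ Ioo 0 T
    · have e1 : ∫ r in Ioc (-h) h, D (t + r) (U t) = ∫ s in (t + -h)..(t + h), D s (U t) := by
        rw [← intervalIntegral.integral_of_le (by linarith),
          intervalIntegral.integral_comp_add_left (fun s => D s (U t))]
      have e2 : ∀ s, D s (U t) = (Ioo 0 T).indicator (fun t' => d t' (U t)) s := by
        intro s
        by_cases hs : s ∈ Ioo 0 T
        · rw [hD1 s hs, indicator_of_mem hs]
        · rw [hD0 s hs, indicator_of_notMem hs]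
          rfl
      rw [e1]
      simp only [e2]
      rw [inner_increment_eq_integral hT ι hd hweak hv hvu (U t), indicator_of_mem hm]
      have e3 : ι (U t) = vb t := by
        rw [hU1 t hm, ← ht hm, hvb,
          clampExtend_of_mem (Ioo_subset_Icc_self hm)]
      have e4 : t - h + h = t := by ring
      rw [e3, inner_sub_left]
      simp only [hp, e4]
      rw [real_inner_comm (vb (t - h)), ← sub_eq_add_neg]
    · simp [hU0 t hm, hm]
  -- the two integrals of `p` over `(0, T)` cancel up to boundary layers of width `h`
  have hswap : ∫ r in (-h)..h, ∫ t, D (t + r) (U t)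
      = (∫ t in (T - h)..T, p t) - ∫ t in (-h)..0, p t := by
    rw [intervalIntegral.integral_of_le (by linarith),
      integral_integral_swap (integrable_correlation hD hU h), integral_congr_ae hmid,
      integral_indicator measurableSet_Ioo, ← integral_Ioc_eq_integral_Ioo,
      ← intervalIntegral.integral_of_le hT.le,
      intervalIntegral.integral_sub (hpi 0 T)
        ((by fun_prop : Continuous fun t => p (t - h)).intervalIntegrable _ _),
      intervalIntegral.integral_comp_sub_right p h]
    have a1 := intervalIntegral.integral_add_adjacent_intervals (hpi (-h) (0)) (hpi 0 T)
    have a2 := intervalIntegral.integral_add_adjacent_intervals (hpi (-h) (T - h)) (hpi (T - h) T)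
    simp only [zero_sub]
    linarith
  calc _ = h⁻¹ * ∫ r in (-h)..h, ∫ t, D (t + r) (U t) := hL
    _ = _ := by rw [hswap, ← hR]

/-- The energy identity at the final time, by letting `h → 0` in `integral_correlation_eq`. -/
theorem energy_identity_end {T : ℝ} (hT : 0 < T) (ι : E →L[ℝ] L) {u : ℝ → E}
    {d : ℝ → StrongDual ℝ E} {v : ℝ → L} (hu : MemLp u 2 (volume.restrict (Ioo 0 T)))
    (hd : MemLp d 2 (volume.restrict (Ioo 0 T)))
    (hweak : ∀ ψ : ℝ → ℝ, ContDiff ℝ ∞ ψ → HasCompactSupport ψ → tsupport ψ ⊆ Ioo 0 T →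
      ∀ φ : E, ∫ t in Ioo 0 T, deriv ψ t * inner ℝ (ι (u t)) (ι φ)
        = - ∫ t in Ioo 0 T, ψ t * d t φ)
    (hv : ContinuousOn v (Icc 0 T)) (hvu : ∀ᵐ t ∂(volume.restrict (Ioo 0 T)), v t = ι (u t)) :
    2 * ∫ t in Ioo 0 T, d t (u t) = ‖v T‖ ^ 2 - ‖v 0‖ ^ 2 := by
  obtain ⟨D, hD, hD1, hD0⟩ := exists_memLp_zero_extension measurableSet_Ioo hd
  obtain ⟨U, hU, hU1, hU0⟩ := exists_memLp_zero_extension measurableSet_Ioo hu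
  have hvc : Continuous (clampExtend T v) := continuous_clampExtend hT.le hv
  have hΦ := continuous_correlation hD hU
  have hc1 : Continuous fun h : ℝ => ∫ s in (-1 : ℝ)..1, (∫ t, D (t + h * s) (U t)) := by
    refine intervalIntegral.continuous_parametric_intervalIntegral_of_continuous' ?_ _ _
    exact hΦ.comp (by fun_prop : Continuous fun q : ℝ × ℝ => q.1 * q.2)
  have hc2 : Continuous fun h : ℝ => ∫ s in (0 : ℝ)..1,
      (inner ℝ (clampExtend T v (T - h * s + h)) (clampExtend T v (T - h * s))
        - inner ℝ (clampExtend T v (0 - h * s + h)) (clampExtend T v (0 - h * s))) := by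
    refine intervalIntegral.continuous_parametric_intervalIntegral_of_continuous' ?_ _ _
    simp only [Function.uncurry_def]
    fun_prop
  have l1 := (hc1.tendsto 0).mono_left (nhdsWithin_le_nhds (s := Ioi 0))
  have l2 := (hc2.tendsto 0).mono_left (nhdsWithin_le_nhds (s := Ioi 0))
  have heq := tendsto_nhds_unique (l1.congr' (by
    filter_upwards [self_mem_nhdsWithin] with h hh
    exact integral_correlation_eq hT ι hd hweak hv hvu hD hD1 hD0 hU hU1 hU0 hh)) l2
  have e0 : ∫ t, D t (U t) = ∫ t in Ioo 0 T, d t (u t) := by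
    rw [← integral_indicator measurableSet_Ioo]
    refine integral_congr_ae (Eventually.of_forall fun t => ?_)
    beta_reduce
    by_cases ht : t ∈ Ioo 0 T
    · rw [hD1 t ht, hU1 t ht, indicator_of_mem ht]
    · rw [hU0 t ht, indicator_of_notMem ht, map_zero]
  simp only [zero_mul, add_zero, sub_zero, intervalIntegral.integral_const, e0,
    real_inner_self_eq_norm_sq, clampExtend_of_ge hT.le le_rfl,
    clampExtend_of_nonpos hT.le le_rfl, smul_eq_mul] at heq
  linarith

/-- The energy identity `‖v(τ)‖² - ‖v(0)‖² = 2 ∫₀^τ ⟨d, u⟩` of the Gelfand triple. -/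
theorem energy_identity {T : ℝ} (ι : E →L[ℝ] L) {u : ℝ → E}
    {d : ℝ → StrongDual ℝ E} {v : ℝ → L} (hu : MemLp u 2 (volume.restrict (Ioo 0 T)))
    (hd : MemLp d 2 (volume.restrict (Ioo 0 T)))
    (hweak : ∀ ψ : ℝ → ℝ, ContDiff ℝ ∞ ψ → HasCompactSupport ψ → tsupport ψ ⊆ Ioo 0 T →
      ∀ φ : E, ∫ t in Ioo 0 T, deriv ψ t * inner ℝ (ι (u t)) (ι φ)
        = - ∫ t in Ioo 0 T, ψ t * d t φ)
    (hv : ContinuousOn v (Icc 0 T)) (hvu : ∀ᵐ t ∂(volume.restrict (Ioo 0 T)), v t = ι (u t))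
    {τ : ℝ} (hτ : τ ∈ Icc 0 T) :
    2 * ∫ t in Ioo 0 τ, d t (u t) = ‖v τ‖ ^ 2 - ‖v 0‖ ^ 2 := by
  rcases hτ.1.eq_or_lt with rfl | hτ0
  · simp
  have hsub : Ioo 0 τ ⊆ Ioo 0 T := Ioo_subset_Ioo_right hτ.2
  have hle := Measure.restrict_mono_set (volume : Measure ℝ) hsub
  refine energy_identity_end hτ0 ι (hu.mono_measure hle) (hd.mono_measure hle) ?_
    (hv.mono (Icc_subset_Icc_right hτ.2)) (ae_mono hle hvu)
  intro ψ h1 h2 h3 φ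
  have key := hweak ψ h1 h2 (h3.trans hsub) φ
  rw [setIntegral_eq_of_subset_of_forall_sdiff_eq_zero measurableSet_Ioo hsub,
    setIntegral_eq_of_subset_of_forall_sdiff_eq_zero measurableSet_Ioo hsub] at key
  · exact key
  · intro t ht
    rw [image_eq_zero_of_notMem_tsupport fun hh => ht.2 (h3 hh), zero_mul]
  · intro t ht
    have : deriv ψ t = 0 := by
      by_contra hne
      exact ht.2 (h3 (support_deriv_subset hne))
    rw [this, zero_mul]

/-! ### The abstract a priori estimate -/

/-- The bound on `‖v(t)‖²` that Grönwall's inequality gives for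
`‖v(t)‖² ≤ M + 2 C ∫₀^t (1 + ‖v‖²)`. -/
noncomputable def energyBound (T C M : ℝ) : ℝ :=
  (M + 2 * C * T) + 2 * C * gronwallBound 0 (2 * C) (M + 2 * C * T) T

theorem le_energyBound {T C M : ℝ} (hC : 0 ≤ C) {f : ℝ → ℝ} (hM : 0 ≤ M)
    (hf : Continuous f) (hf0 : ∀ t, 0 ≤ f t)
    (h : ∀ t ∈ Icc 0 T, f t ≤ M + 2 * C * ∫ s in (0 : ℝ)..t, (1 + f s)) :
    ∀ t ∈ Icc 0 T, f t ≤ energyBound T C M := by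
  set F : ℝ → ℝ := fun t => ∫ s in (0 : ℝ)..t, f s with hF
  have hder : ∀ t, HasDerivAt F (f t) t := fun t =>
    intervalIntegral.integral_hasDerivAt_right (hf.intervalIntegrable _ _)
      hf.stronglyMeasurable.stronglyMeasurableAtFilter hf.continuousAt
  have hF0 : ∀ t, 0 ≤ t → 0 ≤ F t := fun t ht =>
    intervalIntegral.integral_nonneg ht fun s _ => hf0 s
  have h' : ∀ t ∈ Icc 0 T, f t ≤ 2 * C * F t + (M + 2 * C * T) := by
    intro t ht
    have := h t ht
    rw [intervalIntegral.integral_add (by simp) (hf.intervalIntegrable _ _),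
      intervalIntegral.integral_const] at this
    simp only [sub_zero, smul_eq_mul, mul_one] at this
    have h2 : C * t ≤ C * T := mul_le_mul_of_nonneg_left ht.2 hC
    linarith
  intro t ht
  have hT : 0 ≤ T := ht.1.trans ht.2
  have hg := norm_le_gronwallBound_of_norm_deriv_right_le (f := F) (f' := f) (δ := 0) (K := 2 * C)
    (ε := M + 2 * C * T) (a := 0) (b := T)
    (continuous_iff_continuousAt.2 fun t => (hder t).continuousAt).continuousOn
    (fun x _ => (hder x).hasDerivWithinAt) (by simp [hF])
    (fun x hx => by
      rw [Real.norm_of_nonneg (hf0 x), Real.norm_of_nonneg (hF0 x hx.1)]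
      exact h' x ⟨hx.1, hx.2.le⟩) t ht
  rw [Real.norm_of_nonneg (hF0 t ht.1), sub_zero] at hg
  have hmono := gronwallBound_mono (δ := 0) (K := 2 * C) (ε := M + 2 * C * T) le_rfl
    (by positivity) (by positivity) ht.2
  have h3 := h' t ht
  have h4 : 2 * C * F t ≤ 2 * C * gronwallBound 0 (2 * C) (M + 2 * C * T) T :=
    mul_le_mul_of_nonneg_left (hg.trans hmono) (by positivity)
  unfold energyBound
  linarith

/-- The energy estimate for an evolution equation that is coercive up to a multiple of the norm of
`L`: the energy identity, followed by Grönwall's inequality. -/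
theorem integral_sq_norm_le {T : ℝ} (hT : 0 < T) (ι : E →L[ℝ] L) {u : ℝ → E}
    {d : ℝ → StrongDual ℝ E} {v : ℝ → L} (hu : MemLp u 2 (volume.restrict (Ioo 0 T)))
    (hd : MemLp d 2 (volume.restrict (Ioo 0 T)))
    (hweak : ∀ ψ : ℝ → ℝ, ContDiff ℝ ∞ ψ → HasCompactSupport ψ → tsupport ψ ⊆ Ioo 0 T →
      ∀ φ : E, ∫ t in Ioo 0 T, deriv ψ t * inner ℝ (ι (u t)) (ι φ)
        = - ∫ t in Ioo 0 T, ψ t * d t φ)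
    (hv : ContinuousOn v (Icc 0 T)) (hvu : ∀ᵐ t ∂(volume.restrict (Ioo 0 T)), v t = ι (u t))
    {c C M : ℝ} (hc : 0 < c) (hC : 0 ≤ C) (hM : ‖v 0‖ ^ 2 ≤ M)
    (hcoer : ∀ᵐ t ∂(volume.restrict (Ioo 0 T)),
      d t (u t) + c * ‖u t‖ ^ 2 ≤ C * (1 + ‖ι (u t)‖ ^ 2)) :
    ∫ t in Ioo 0 T, ‖u t‖ ^ 2 ≤ (M + 2 * C * (T * (1 + energyBound T C M))) / (2 * c) := by
  have hM0 : 0 ≤ M := (sq_nonneg _).trans hM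
  set f : ℝ → ℝ := fun t => ‖clampExtend T v t‖ ^ 2 with hf
  have hfc : Continuous f := (continuous_clampExtend hT.le hv).norm.pow 2
  have hfi : ∀ t ∈ Icc 0 T, f t = ‖v t‖ ^ 2 := fun t ht => by simp only [hf, clampExtend_of_mem ht]
  have hdu : Integrable (fun t => d t (u t)) (volume.restrict (Ioo 0 T)) :=
    memLp_one_iff_integrable.1
      ((ContinuousLinearMap.id ℝ (StrongDual ℝ E)).memLp_of_bilin 1 hd hu)
  have hu2 : Integrable (fun t => ‖u t‖ ^ 2) (volume.restrict (Ioo 0 T)) :=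
    (memLp_two_iff_integrable_sq_norm hu.1).1 hu
  have hstep : ∀ τ ∈ Icc 0 T,
      f τ + 2 * c * ∫ t in Ioo 0 τ, ‖u t‖ ^ 2 ≤ M + 2 * C * ∫ s in (0 : ℝ)..τ, (1 + f s) := by
    intro τ hτ
    have hsub : Ioo 0 τ ⊆ Ioo 0 T := Ioo_subset_Ioo_right hτ.2
    have hle := Measure.restrict_mono_set (volume : Measure ℝ) hsub
    have hid := energy_identity ι hu hd hweak hv hvu hτ
    have i1 : Integrable (fun t => d t (u t)) (volume.restrict (Ioo 0 τ)) := hdu.mono_measure hle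
    have i2 : Integrable (fun t => ‖u t‖ ^ 2) (volume.restrict (Ioo 0 τ)) := hu2.mono_measure hle
    have i3 : Integrable (fun t => C * (1 + f t)) (volume.restrict (Ioo 0 τ)) :=
      ((by fun_prop : Continuous fun t => C * (1 + f t)).integrableOn_Icc (a := 0) (b := τ)).mono_set
        Ioo_subset_Icc_self
    have hmono : ∫ t in Ioo 0 τ, (d t (u t) + c * ‖u t‖ ^ 2) ≤ ∫ t in Ioo 0 τ, C * (1 + f t) := by
      refine integral_mono_ae (i1.add (i2.const_mul c)) i3 ?_
      filter_upwards [ae_mono hle hcoer, ae_mono hle hvu,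
        ae_restrict_mem measurableSet_Ioo] with t h1 h2 h3
      rw [hfi t (Ioo_subset_Icc_self (hsub h3)), h2]
      exact h1
    rw [integral_add i1 (i2.const_mul c), integral_const_mul, integral_const_mul,
      ← integral_Ioc_eq_integral_Ioo (f := fun t => 1 + f t),
      ← intervalIntegral.integral_of_le hτ.1] at hmono
    rw [hfi τ hτ]
    linarith
  have hbound := le_energyBound (T := T) hC hM0 hfc (fun t => sq_nonneg _) (fun t ht => by
    have h1 := hstep t ht
    have h2 : 0 ≤ ∫ s in Ioo 0 t, ‖u s‖ ^ 2 := integral_nonneg fun _ => sq_nonneg _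
    have h3 : 0 ≤ 2 * c * ∫ s in Ioo 0 t, ‖u s‖ ^ 2 := by positivity
    linarith)
  have hend := hstep T ⟨hT.le, le_rfl⟩
  have hint : ∫ s in (0 : ℝ)..T, (1 + f s) ≤ T * (1 + energyBound T C M) := by
    have := intervalIntegral.integral_mono_on hT.le
      ((by fun_prop : Continuous fun t => 1 + f t).intervalIntegrable 0 T)
      (intervalIntegrable_const (μ := volume) (c := 1 + energyBound T C M))
      (fun t ht => by linarith [hbound t ht])
    rw [intervalIntegral.integral_const, sub_zero, smul_eq_mul] at this
    exact this
  have hf0 : 0 ≤ f T := sq_nonneg _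
  rw [le_div_iff₀ (by positivity)]
  have h5 := mul_le_mul_of_nonneg_left hint (by positivity : 0 ≤ 2 * C)
  linarith

/-- The bounds for a solution and its time derivative, with a constant that depends on `T`, on the
constants of the growth and coercivity conditions and on the bound of the initial value only. -/
theorem eLpNorm_add_eLpNorm_le {T : ℝ} (hT : 0 < T) (ι : E →L[ℝ] L) {u : ℝ → E}
    {d : ℝ → StrongDual ℝ E} {v : ℝ → L} (hu : MemLp u 2 (volume.restrict (Ioo 0 T)))
    (hd : MemLp d 2 (volume.restrict (Ioo 0 T)))
    (hweak : ∀ ψ : ℝ → ℝ, ContDiff ℝ ∞ ψ → HasCompactSupport ψ → tsupport ψ ⊆ Ioo 0 T →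
      ∀ φ : E, ∫ t in Ioo 0 T, deriv ψ t * inner ℝ (ι (u t)) (ι φ)
        = - ∫ t in Ioo 0 T, ψ t * d t φ)
    (hv : ContinuousOn v (Icc 0 T)) (hvu : ∀ᵐ t ∂(volume.restrict (Ioo 0 T)), v t = ι (u t))
    {c C M : ℝ} (hc : 0 < c) (hC : 0 ≤ C) (hM : ‖v 0‖ ^ 2 ≤ M)
    (hcoer : ∀ᵐ t ∂(volume.restrict (Ioo 0 T)),
      d t (u t) + c * ‖u t‖ ^ 2 ≤ C * (1 + ‖ι (u t)‖ ^ 2))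
    (hdb : ∀ᵐ t ∂(volume.restrict (Ioo 0 T)), ‖d t‖ ≤ C * (1 + ‖u t‖)) :
    eLpNorm d 2 (volume.restrict (Ioo 0 T)) + eLpNorm u 2 (volume.restrict (Ioo 0 T))
      ≤ ENNReal.ofReal (C * √T
        + (C + 1) * √((M + 2 * C * (T * (1 + energyBound T C M))) / (2 * c))) := by
  set B := (M + 2 * C * (T * (1 + energyBound T C M))) / (2 * c) with hB
  have hint := integral_sq_norm_le hT ι hu hd hweak hv hvu hc hC hM hcoer
  have h1 : eLpNorm u 2 (volume.restrict (Ioo 0 T)) ≤ ENNReal.ofReal √B := by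
    rw [hu.eLpNorm_eq_integral_rpow_norm (by norm_num) (by norm_num)]
    refine ENNReal.ofReal_le_ofReal ?_
    simp only [ENNReal.toReal_ofNat, Real.rpow_ofNat, ← one_div, ← Real.sqrt_eq_rpow]
    exact Real.sqrt_le_sqrt hint
  have h2 : eLpNorm d 2 (volume.restrict (Ioo 0 T))
      ≤ ENNReal.ofReal (C * √T) + ENNReal.ofReal (C * √B) := by
    calc eLpNorm d 2 (volume.restrict (Ioo 0 T))
        ≤ eLpNorm (fun t => C • (1 + ‖u t‖)) 2 (volume.restrict (Ioo 0 T)) :=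
          eLpNorm_mono_ae_real hdb
      _ ≤ ENNReal.ofReal C * (ENNReal.ofReal √T + ENNReal.ofReal √B) := by
          have : (fun t => C • (1 + ‖u t‖)) = C • ((fun _ => (1 : ℝ)) + fun t => ‖u t‖) := rfl
          rw [this, eLpNorm_const_smul, Real.enorm_of_nonneg hC]
          refine mul_le_mul_right ((eLpNorm_add_le aestronglyMeasurable_const hu.1.norm
            (by norm_num)).trans (add_le_add ?_ ?_)) _
          · rw [eLpNorm_const _ (by norm_num)
              (by simpa [Measure.restrict_eq_zero] using hT)]
            simp [Real.sqrt_eq_rpow, ENNReal.ofReal_rpow_of_pos hT]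
          · rw [eLpNorm_norm]
            exact h1
      _ = _ := by rw [mul_add, ENNReal.ofReal_mul hC, ENNReal.ofReal_mul hC]
  refine (add_le_add h2 h1).trans (le_of_eq ?_)
  rw [← ENNReal.ofReal_add (by positivity) (by positivity),
    ← ENNReal.ofReal_add (by positivity) (by positivity)]
  congr 1
  ring

end

section

variable {m : ℕ}

/-! ### Tangential and transversal coordinates -/

@[simp]
theorem bar_joinLast (a : Fin m → ℝ) (s : ℝ) : bar (joinLast a s) = WithLp.toLp 2 a := by
  ext i
  simp [bar, joinLast]

@[simp]
theorem lastCoord_joinLast (a : Fin m → ℝ) (s : ℝ) : lastCoord (joinLast a s) = s := by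
  simp [lastCoord, joinLast]

theorem joinLast_bar_lastCoord (x : Space m) : joinLast (bar x).ofLp (lastCoord x) = x := by
  ext i
  refine Fin.lastCases ?_ (fun i => ?_) i <;> simp [bar, joinLast, lastCoord]

theorem joinLast_castSucc (a : Fin m → ℝ) (s : ℝ) (i : Fin m) :
    joinLast a s i.castSucc = a i := by simp [joinLast]

theorem joinLast_last (a : Fin m → ℝ) (s : ℝ) : joinLast a s (Fin.last m) = s := by
  simp [joinLast]

theorem joinLast_add (a b : Fin m → ℝ) (s t : ℝ) :
    joinLast (a + b) (s + t) = joinLast a s + joinLast b t := by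
  ext i
  refine Fin.lastCases ?_ (fun i => ?_) i <;> simp [joinLast_castSucc, joinLast_last]

theorem joinLast_smul (c : ℝ) (a : Fin m → ℝ) (s : ℝ) :
    joinLast (c • a) (c * s) = c • joinLast a s := by
  ext i
  refine Fin.lastCases ?_ (fun i => ?_) i <;> simp [joinLast_castSucc, joinLast_last]

theorem norm_sq_joinLast (a : Base m) (s : ℝ) :
    ‖joinLast a.ofLp s‖ ^ 2 = ‖a‖ ^ 2 + s ^ 2 := by
  simp [EuclideanSpace.norm_sq_eq, Fin.sum_univ_castSucc, joinLast_castSucc, joinLast_last]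

/-- The embedding `a ↦ (a, 0)` of the tangential space. -/
noncomputable def baseEmbedding (m : ℕ) : Base m →ₗᵢ[ℝ] Space m where
  toFun a := joinLast a.ofLp 0
  map_add' a b := by simpa using joinLast_add a.ofLp b.ofLp 0 0
  map_smul' c a := by simpa using joinLast_smul c a.ofLp 0
  norm_map' a := by
    have := norm_sq_joinLast a 0
    have h2 : ‖joinLast a.ofLp 0‖ ^ 2 = ‖a‖ ^ 2 := by rw [this]; ring
    exact (sq_eq_sq₀ (norm_nonneg _) (norm_nonneg _)).1 h2

/-- The unit vector of the transversal direction. -/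
noncomputable def lastVec (m : ℕ) : Space m := joinLast 0 1

theorem joinLast_eq (a : Base m) (s : ℝ) :
    joinLast a.ofLp s = baseEmbedding m a + s • lastVec m := by
  ext i
  refine Fin.lastCases ?_ (fun i => ?_) i <;>
    simp [baseEmbedding, lastVec, joinLast_castSucc, joinLast_last]

theorem measurePreserving_joinLast (m : ℕ) :
    MeasurePreserving (fun p : Base m × ℝ => joinLast p.1.ofLp p.2) := by
  have h1 : MeasurePreserving (fun p : Base m × ℝ => (p.2, p.1.ofLp)) := by
    have h := (MeasurePreserving.id (volume : Measure ℝ)).prod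
      (EuclideanSpace.volume_preserving_symm_measurableEquiv_toLp (Fin m))
    exact h.comp Measure.measurePreserving_swap
  have h2 := (volume_preserving_piFinSuccAbove (fun _ : Fin (m + 1) => ℝ) (Fin.last m)).symm
  have h3 := (EuclideanSpace.volume_preserving_symm_measurableEquiv_toLp (Fin (m + 1))).symm
  have h := h3.comp (h2.comp h1)
  convert h using 1
  funext p
  ext i
  refine Fin.lastCases ?_ (fun i => ?_) i
  · simp [joinLast_last, MeasurableEquiv.piFinSuccAbove]
  · simp [joinLast_castSucc, MeasurableEquiv.piFinSuccAbove]

/-- A rotation that maps the transversal unit vector to a given unit vector. -/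
theorem exists_rotation {e : Space m} (he : ‖e‖ = 1) :
    ∃ R : Space m ≃ₗᵢ[ℝ] Space m, R (lastVec m) = e := by
  have hon : Orthonormal ℝ (({Fin.last m} : Set (Fin (m + 1))).domRestrict fun _ => e) := by
    refine ⟨fun i => he, ?_⟩
    intro i j hij
    exact absurd (Subtype.ext (i.2.trans j.2.symm)) hij
  obtain ⟨b, hb⟩ := hon.exists_orthonormalBasis_extension_of_card_eq (by simp)
  refine ⟨b.repr.symm, ?_⟩
  have : lastVec m = EuclideanSpace.single (Fin.last m) (1 : ℝ) := by
    ext i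
    refine Fin.lastCases ?_ (fun i => ?_) i <;>
      simp [lastVec, joinLast_castSucc, joinLast_last]
  rw [this, OrthonormalBasis.repr_symm_single]
  exact hb _ rfl

/-! ### The trace inequality on bounded Lipschitz domains -/

theorem euclideanHausdorffMeasure_image_le {X Y : Type*} [EMetricSpace X] [MeasurableSpace X]
    [BorelSpace X] [EMetricSpace Y] [MeasurableSpace Y] [BorelSpace Y] {K : ℝ≥0} {f : X → Y}
    (hf : LipschitzWith K f) (d : ℕ) (s : Set X) :
    Measure.euclideanHausdorffMeasure d (f '' s)
      ≤ (K : ℝ≥0∞) ^ d * Measure.euclideanHausdorffMeasure d s := by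
  have h := hf.hausdorffMeasure_image_le (d := d) (by positivity) s
  rw [ENNReal.rpow_natCast] at h
  rw [Measure.euclideanHausdorffMeasure_def, Measure.euclideanHausdorffMeasure_def,
    Measure.smul_apply, Measure.smul_apply, ENNReal.smul_def, ENNReal.smul_def, smul_eq_mul,
    smul_eq_mul, ← mul_assoc, mul_comm ((K : ℝ≥0∞) ^ d), mul_assoc]
  gcongr

/-- A boundary point in a chart lies on the graph. -/
theorem inner_eq_of_mem_frontier {U : Set (Space m)} (hU : IsOpen U) {p e : Space m}
    {γ : Space m → ℝ} (hγ : Continuous γ) {δ : ℝ}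
    (hx : ∀ x ∈ Metric.ball p δ, (x ∈ U ↔ inner ℝ x e < γ (x - (inner ℝ x e : ℝ) • e)))
    {y : Space m} (hy : y ∈ frontier U) (hyp : y ∈ Metric.ball p δ) :
    (inner ℝ y e : ℝ) = γ (y - (inner ℝ y e : ℝ) • e) := by
  have hnot : y ∉ U := by
    rw [hU.frontier_eq] at hy
    exact hy.2
  refine le_antisymm ?_ (not_lt.1 fun h => hnot ((hx y hyp).2 h))
  have hcl : y ∈ closure (U ∩ Metric.ball p δ) :=
    Metric.isOpen_ball.closure_inter ⟨hy.1, hyp⟩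
  have hclosed : IsClosed {x : Space m | (inner ℝ x e : ℝ) ≤ γ (x - (inner ℝ x e : ℝ) • e)} :=
    isClosed_le (by fun_prop) (by fun_prop)
  exact closure_minimal (fun x hxx => ((hx x hxx.2).1 hxx.1).le) hclosed hcl

end

section

variable {m : ℕ}

/-- Fubini's theorem in rotated coordinates. -/
theorem lintegral_comp_rotation (R : Space m ≃ₗᵢ[ℝ] Space m) {F : Space m → ℝ≥0∞}
    (hF : Measurable F) :
    ∫⁻ a : Base m, ∫⁻ s : ℝ, F (R (baseEmbedding m a) + s • R (lastVec m)) = ∫⁻ x, F x := by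
  have hmp : MeasurePreserving (fun p : Base m × ℝ => R (joinLast p.1.ofLp p.2)) :=
    R.measurePreserving.comp (measurePreserving_joinLast m)
  rw [← hmp.lintegral_comp hF, Measure.volume_eq_prod,
    lintegral_prod (fun p : Base m × ℝ => F (R (joinLast p.1.ofLp p.2)))
      (hF.comp hmp.measurable).aemeasurable]
  simp only [joinLast_eq, map_add, map_smul]

/-- In a chart, integrals over the strip of width `l` below the boundary are controlled by the
integral over the domain: the strip is parametrized by the graph and the transversal direction, and
the surface measure of a Lipschitz graph is bounded by the Lebesgue measure of its projection. -/
theorem lintegral_strip_le {U : Set (Space m)} (hU : IsOpen U) {p e : Space m}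
    {γ : Space m → ℝ} {K : ℝ≥0} {δ l : ℝ} (he : ‖e‖ = 1) (hγ : LipschitzWith K γ)
    (hx : ∀ x ∈ Metric.ball p δ, (x ∈ U ↔ inner ℝ x e < γ (x - (inner ℝ x e : ℝ) • e)))
    (hl : l ≤ δ / 2) {F : Space m → ℝ≥0∞} (hF : Measurable F) :
    ∫⁻ y in frontier U ∩ Metric.ball p (δ / 2), (∫⁻ s in Ioo 0 l, F (y - s • e))
        ∂(Measure.euclideanHausdorffMeasure m)
      ≤ ((1 + K : ℝ≥0) : ℝ≥0∞) ^ m * ∫⁻ x in U, F x := by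
  obtain ⟨R, hR⟩ := exists_rotation he
  set Γ := frontier U ∩ Metric.ball p (δ / 2) with hΓ
  have hΓm : MeasurableSet Γ := isClosed_frontier.measurableSet.inter measurableSet_ball
  set j : Base m →ₗᵢ[ℝ] Space m := R.toLinearIsometry.comp (baseEmbedding m) with hj
  have hjR : ∀ a, j a = R (baseEmbedding m a) := fun a => rfl
  set gr : Base m → Space m := fun a => j a + γ (j a) • e with hgr
  have hperp : ∀ a, (inner ℝ (j a) e : ℝ) = 0 := by
    intro a
    rw [hjR, ← hR, LinearIsometryEquiv.inner_map_map]
    simp [baseEmbedding, lastVec, PiLp.inner_apply, Fin.sum_univ_castSucc, joinLast_castSucc,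
      joinLast_last]
  have hee : (inner ℝ e e : ℝ) = 1 := by rw [real_inner_self_eq_norm_sq, he]; norm_num
  have hinner : ∀ a (s : ℝ), (inner ℝ (j a + s • e) e : ℝ) = s := by
    intro a s
    rw [inner_add_left, hperp, real_inner_smul_left, hee]; ring
  have hproj : ∀ a (s : ℝ), j a + s • e - (inner ℝ (j a + s • e) e : ℝ) • e = j a := by
    intro a s
    rw [hinner, add_sub_cancel_right]
  have hdec : ∀ y : Space m, ∃ (a : Base m) (s : ℝ), y = j a + s • e := by
    intro y
    refine ⟨bar (R.symm y), lastCoord (R.symm y), ?_⟩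
    rw [hjR, ← hR, ← map_smul, ← map_add, ← joinLast_eq, joinLast_bar_lastCoord,
      LinearIsometryEquiv.apply_symm_apply]
  have hgrlip : LipschitzWith (1 + K) gr := by
    have h1 : LipschitzWith 1 j := j.lipschitz
    have h2 : LipschitzWith K (fun a => γ (j a) • e) := by
      refine LipschitzWith.of_dist_le_mul fun a b => ?_
      rw [dist_eq_norm, ← sub_smul, norm_smul, he, mul_one, ← dist_eq_norm]
      have := hγ.dist_le_mul (j a) (j b)
      rwa [j.dist_map] at this
    exact h1.add h2
  have hgrm : Measurable gr := hgrlip.continuous.measurable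
  have hsurj : ∀ y ∈ Γ, ∃ a, gr a = y := by
    intro y hy
    obtain ⟨a, s, rfl⟩ := hdec y
    have hb : j a + s • e ∈ Metric.ball p δ :=
      Metric.ball_subset_ball (by linarith [Metric.pos_of_mem_ball hy.2]) hy.2
    have := inner_eq_of_mem_frontier hU hγ.continuous hx hy.1 hb
    rw [hproj, hinner] at this
    exact ⟨a, by simp only [hgr]; rw [← this]⟩
  have hmeas : (Measure.euclideanHausdorffMeasure m).restrict Γ
      ≤ (((1 + K : ℝ≥0) : ℝ≥0∞) ^ m) • Measure.map gr (volume.restrict (gr ⁻¹' Γ)) := by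
    refine Measure.le_iff.2 fun B hB => ?_
    rw [Measure.restrict_apply hB, Measure.smul_apply, Measure.map_apply hgrm hB,
      Measure.restrict_apply (hgrm hB), smul_eq_mul, ← preimage_inter,
      ← EuclideanSpace.euclideanHausdorffMeasure_eq_volume m]
    refine le_trans (measure_mono ?_) (euclideanHausdorffMeasure_image_le hgrlip m _)
    intro y hy
    obtain ⟨a, rfl⟩ := hsurj y hy.2
    exact mem_image_of_mem gr hy
  have hHm : Measurable fun y : Space m => ∫⁻ s in Ioo 0 l, F (y - s • e) := by
    refine Measurable.lintegral_prod_right' (f := fun q : Space m × ℝ => F (q.1 - q.2 • e)) ?_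
    exact hF.comp (by fun_prop)
  have hUF : Measurable (U.indicator F) := hF.indicator hU.measurableSet
  calc ∫⁻ y in Γ, (∫⁻ s in Ioo 0 l, F (y - s • e)) ∂(Measure.euclideanHausdorffMeasure m)
      ≤ ∫⁻ y, (∫⁻ s in Ioo 0 l, F (y - s • e)) ∂((((1 + K : ℝ≥0) : ℝ≥0∞) ^ m) •
          Measure.map gr (volume.restrict (gr ⁻¹' Γ))) := lintegral_mono' hmeas le_rfl
    _ = ((1 + K : ℝ≥0) : ℝ≥0∞) ^ m *
          ∫⁻ a in gr ⁻¹' Γ, ∫⁻ s in Ioo 0 l, F (gr a - s • e) := by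
        rw [lintegral_smul_measure, lintegral_map hHm hgrm, smul_eq_mul]
    _ ≤ ((1 + K : ℝ≥0) : ℝ≥0∞) ^ m * ∫⁻ a, ∫⁻ s : ℝ, U.indicator F (j a + s • e) := by
        refine mul_le_mul_right ?_ _
        refine (setLIntegral_mono' (hgrm hΓm) (g := fun a => ∫⁻ s : ℝ, U.indicator F (j a + s • e))
          fun a ha => ?_).trans (setLIntegral_le_lintegral _ _)
        calc ∫⁻ s in Ioo 0 l, F (gr a - s • e)
            ≤ ∫⁻ s in Ioo 0 l, U.indicator F (j a + (γ (j a) - s) • e) := by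
              refine setLIntegral_mono' measurableSet_Ioo fun s hs => ?_
              have e1 : gr a - s • e = j a + (γ (j a) - s) • e := by
                simp only [hgr, sub_smul]; abel
              have hball : j a + (γ (j a) - s) • e ∈ Metric.ball p δ := by
                rw [← e1, Metric.mem_ball]
                have h1 : dist (gr a) p < δ / 2 := ha.2
                have h2 : dist (gr a - s • e) (gr a) = s := by
                  rw [dist_eq_norm, sub_sub_cancel_left, norm_neg, norm_smul, he, mul_one,
                    Real.norm_of_nonneg hs.1.le]
                linarith [dist_triangle (gr a - s • e) (gr a) p, hs.2]
              have hmem : j a + (γ (j a) - s) • e ∈ U := by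
                rw [hx _ hball, hproj, hinner]
                linarith [hs.1]
              rw [e1, indicator_of_mem hmem]
          _ ≤ ∫⁻ s : ℝ, U.indicator F (j a + (γ (j a) - s) • e) := setLIntegral_le_lintegral _ _
          _ = ∫⁻ s : ℝ, U.indicator F (j a + s • e) :=
              lintegral_sub_left_eq_self (fun s : ℝ => U.indicator F (j a + s • e)) _
    _ = ((1 + K : ℝ≥0) : ℝ≥0∞) ^ m * ∫⁻ x in U, F x := by
        rw [← lintegral_indicator hU.measurableSet, ← lintegral_comp_rotation R hUF, hR]
        rfl

/-- One-dimensional trace inequality along a segment of length `l`: the average over the segment of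
the fundamental theorem of calculus for `φ²`, with Young's inequality for the derivative
`2 φ ∂φ`. -/
theorem sq_le_integral_segment {φ : Space m → ℝ} (hφ : ContDiff ℝ ∞ φ) {e : Space m}
    (he : ‖e‖ = 1) (y : Space m) {l θ : ℝ} (hl : 0 < l) (hθ : 0 < θ) :
    φ y ^ 2 ≤ ∫ s in (0 : ℝ)..l, ((1 / l + 1 / θ) * φ (y - s • e) ^ 2
      + θ * ‖gradient φ (y - s • e)‖ ^ 2) := by
  have hgc := continuous_gradient_smooth hφ
  have hφc := hφ.continuous
  set q' : ℝ → ℝ := fun s => 2 * φ (y - s • e) * inner ℝ (gradient φ (y - s • e)) (-e) with hq'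
  have hder : ∀ s : ℝ, HasDerivAt (fun s => φ (y - s • e) ^ 2) (q' s) s := by
    intro s
    have h1 : HasDerivAt (fun s : ℝ => y - s • e) (-e) s := by
      simpa using (((hasDerivAt_id s).smul_const e).const_sub y)
    have h2 := ((hφ.differentiable (by simp) (y - s • e)).hasGradientAt.hasFDerivAt).comp_hasDerivAt
      s h1
    have h3 := h2.pow 2
    refine h3.congr_deriv ?_
    simp [hq']
  have hq'c : Continuous q' := by fun_prop
  set P : ℝ → ℝ := fun s => (1 / θ) * φ (y - s • e) ^ 2 + θ * ‖gradient φ (y - s • e)‖ ^ 2 with hP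
  have hPc : Continuous P := by fun_prop
  have hqP : ∀ s, -q' s ≤ P s := by
    intro s
    have h1 : |(inner ℝ (gradient φ (y - s • e)) (-e) : ℝ)| ≤ ‖gradient φ (y - s • e)‖ := by
      have := abs_real_inner_le_norm (gradient φ (y - s • e)) (-e)
      rwa [norm_neg, he, mul_one] at this
    set A := φ (y - s • e)
    set B := ‖gradient φ (y - s • e)‖
    have h2 : -q' s ≤ 2 * |A| * B := by
      have h3 : |q' s| ≤ 2 * |A| * B := by
        simp only [hq', abs_mul, abs_two]
        gcongr
      exact (neg_le_abs _).trans h3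
    have h4 : 2 * |A| * B ≤ (1 / θ) * A ^ 2 + θ * B ^ 2 := by
      have h5 : (1 / θ) * A ^ 2 + θ * B ^ 2 - 2 * |A| * B = (1 / θ) * (|A| - θ * B) ^ 2 := by
        rw [sub_sq, sq_abs]; field_simp; ring
      have h6 : 0 ≤ (1 / θ) * (|A| - θ * B) ^ 2 := by positivity
      linarith
    exact h2.trans h4
  have hP0 : ∀ s, 0 ≤ P s := fun s => by positivity
  have hstep : ∀ s ∈ Icc 0 l, φ y ^ 2 ≤ φ (y - s • e) ^ 2 + ∫ r in (0 : ℝ)..l, P r := by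
    intro s hs
    have h1 := intervalIntegral.integral_eq_sub_of_hasDerivAt (fun r _ => hder r)
      (hq'c.intervalIntegrable 0 s)
    simp only [zero_smul, sub_zero] at h1
    have h2 : ∫ r in (0 : ℝ)..s, -q' r ≤ ∫ r in (0 : ℝ)..s, P r :=
      intervalIntegral.integral_mono_on hs.1 (hq'c.neg.intervalIntegrable _ _)
        (hPc.intervalIntegrable _ _) fun r _ => hqP r
    have h3 : ∫ r in (0 : ℝ)..s, P r ≤ ∫ r in (0 : ℝ)..l, P r :=
      intervalIntegral.integral_mono_interval le_rfl hs.1 hs.2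
        (Eventually.of_forall hP0) (hPc.intervalIntegrable _ _)
    rw [intervalIntegral.integral_neg] at h2
    linarith
  have hint := intervalIntegral.integral_mono_on hl.le (intervalIntegrable_const (μ := volume))
    ((by fun_prop : Continuous fun s : ℝ => φ (y - s • e) ^ 2 + ∫ r in (0 : ℝ)..l, P r
      ).intervalIntegrable 0 l) hstep
  rw [intervalIntegral.integral_const, intervalIntegral.integral_add
    ((by fun_prop : Continuous fun s : ℝ => φ (y - s • e) ^ 2).intervalIntegrable 0 l)
    (intervalIntegrable_const), intervalIntegral.integral_const] at hint
  simp only [sub_zero, smul_eq_mul] at hint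
  have e1 : ∫ s in (0 : ℝ)..l, ((1 / l + 1 / θ) * φ (y - s • e) ^ 2
      + θ * ‖gradient φ (y - s • e)‖ ^ 2)
      = (1 / l) * (∫ s in (0 : ℝ)..l, φ (y - s • e) ^ 2) + ∫ r in (0 : ℝ)..l, P r := by
    rw [← intervalIntegral.integral_const_mul, ← intervalIntegral.integral_add
      ((by fun_prop : Continuous fun s : ℝ => (1 / l) * φ (y - s • e) ^ 2).intervalIntegrable 0 l)
      (hPc.intervalIntegrable _ _)]
    refine intervalIntegral.integral_congr fun s _ => ?_
    simp only [hP]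
    ring
  rw [e1]
  have h7 : l * φ y ^ 2 ≤ l * ((1 / l) * (∫ s in (0 : ℝ)..l, φ (y - s • e) ^ 2)
      + ∫ r in (0 : ℝ)..l, P r) := by
    refine hint.trans (le_of_eq ?_)
    field_simp
  exact le_of_mul_le_mul_left h7 hl

theorem enorm_sq_le_lintegral_segment {φ : Space m → ℝ} (hφ : ContDiff ℝ ∞ φ) {e : Space m}
    (he : ‖e‖ = 1) (y : Space m) {l θ : ℝ} (hl : 0 < l) (hθ : 0 < θ) :
    ‖φ y‖ₑ ^ 2 ≤ ∫⁻ s in Ioo 0 l, (ENNReal.ofReal (1 / l + 1 / θ) * ‖φ (y - s • e)‖ₑ ^ 2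
      + ENNReal.ofReal θ * ‖gradient φ (y - s • e)‖ₑ ^ 2) := by
  have hgc := continuous_gradient_smooth hφ
  have hφc := hφ.continuous
  have h := ENNReal.ofReal_le_ofReal (sq_le_integral_segment hφ he y hl hθ)
  rw [intervalIntegral.integral_of_le hl.le, integral_Ioc_eq_integral_Ioo,
    ofReal_integral_eq_lintegral_ofReal
      (((by fun_prop : Continuous fun s : ℝ => (1 / l + 1 / θ) * φ (y - s • e) ^ 2
        + θ * ‖gradient φ (y - s • e)‖ ^ 2).integrableOn_Icc (a := 0) (b := l)).mono_set
        Ioo_subset_Icc_self)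
      (Eventually.of_forall fun s => by positivity)] at h
  have e1 : ∀ z : ℝ, ENNReal.ofReal (z ^ 2) = ‖z‖ₑ ^ 2 := by
    intro z
    rw [← sq_abs, ENNReal.ofReal_pow (abs_nonneg _), ← Real.norm_eq_abs, ofReal_norm]
  rw [e1] at h
  refine h.trans (le_of_eq ?_)
  refine lintegral_congr fun s => ?_
  rw [ENNReal.ofReal_add (by positivity) (by positivity), ENNReal.ofReal_mul (by positivity),
    ENNReal.ofReal_mul hθ.le, e1, ENNReal.ofReal_pow (norm_nonneg _), ofReal_norm]

/-- The trace inequality for smooth functions on a bounded Lipschitz domain, with an arbitrarily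
small factor in front of the gradient. The boundary is covered by finitely many charts, and the
one-dimensional inequality is integrated over the part of the boundary in a chart. -/
theorem trace_inequality {U : Set (Space m)} (hU : IsOpen U) (hb : Bornology.IsBounded U)
    (hL : HasLipschitzBoundary U) {θ : ℝ} (hθ : 0 < θ) :
    ∃ C : ℝ≥0, ∀ φ : Space m → ℝ, ContDiff ℝ ∞ φ →
      ∫⁻ y in frontier U, ‖φ y‖ₑ ^ 2 ∂(Measure.euclideanHausdorffMeasure m)
        ≤ C * (∫⁻ x in U, ‖φ x‖ₑ ^ 2) + ENNReal.ofReal θ * ∫⁻ x in U, ‖gradient φ x‖ₑ ^ 2 := by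
  have hcomp : IsCompact (frontier U) :=
    hb.isCompact_closure.of_isClosed_subset isClosed_frontier frontier_subset_closure
  revert θ
  refine hcomp.induction_on (p := fun s => ∀ {θ : ℝ}, 0 < θ →
    ∃ C : ℝ≥0, ∀ φ : Space m → ℝ, ContDiff ℝ ∞ φ →
      ∫⁻ y in s, ‖φ y‖ₑ ^ 2 ∂(Measure.euclideanHausdorffMeasure m)
        ≤ C * (∫⁻ x in U, ‖φ x‖ₑ ^ 2) + ENNReal.ofReal θ * ∫⁻ x in U, ‖gradient φ x‖ₑ ^ 2)
    ?_ ?_ ?_ ?_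
  · intro θ _
    exact ⟨0, fun φ _ => by simp⟩
  · intro s t hst ht θ hθ
    obtain ⟨C, hC⟩ := ht hθ
    exact ⟨C, fun φ hφ => (lintegral_mono_set hst).trans (hC φ hφ)⟩
  · intro s t hs ht θ hθ
    obtain ⟨C, hC⟩ := hs (half_pos hθ)
    obtain ⟨C', hC'⟩ := ht (half_pos hθ)
    refine ⟨C + C', fun φ hφ => (lintegral_union_le _ _ _).trans
      ((add_le_add (hC φ hφ) (hC' φ hφ)).trans (le_of_eq ?_))⟩
    have : ENNReal.ofReal θ = ENNReal.ofReal (θ / 2) + ENNReal.ofReal (θ / 2) := by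
      rw [← ENNReal.ofReal_add (by positivity) (by positivity), add_halves]
    rw [this, ENNReal.coe_add]
    ring
  · intro p hp
    obtain ⟨e, γ, K, δ, he, hγ, hδ, hx⟩ := hL p hp
    refine ⟨frontier U ∩ Metric.ball p (δ / 2),
      inter_mem_nhdsWithin _ (Metric.ball_mem_nhds p (half_pos hδ)), fun {θ} hθ => ?_⟩
    have hKpos : (0 : ℝ) < (1 + K) ^ m := by positivity
    -- the factor `(1 + K) ^ m` is the Lipschitz bound for the surface measure in the chart
    set η : ℝ := θ / (1 + K) ^ m with hη
    have hη0 : 0 < η := by positivity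
    set A : ℝ := 1 / (δ / 2) + 1 / η with hA
    refine ⟨(1 + K) ^ m * A.toNNReal, fun φ hφ => ?_⟩
    have hφm : Measurable fun x => ‖φ x‖ₑ ^ 2 := (hφ.continuous.enorm.measurable.pow_const 2)
    have hgm : Measurable fun x => ‖gradient φ x‖ₑ ^ 2 :=
      ((continuous_gradient_smooth hφ).enorm.measurable.pow_const 2)
    calc ∫⁻ y in frontier U ∩ Metric.ball p (δ / 2), ‖φ y‖ₑ ^ 2
          ∂(Measure.euclideanHausdorffMeasure m)
        ≤ ∫⁻ y in frontier U ∩ Metric.ball p (δ / 2), (∫⁻ s in Ioo 0 (δ / 2),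
            (ENNReal.ofReal A * ‖φ (y - s • e)‖ₑ ^ 2
              + ENNReal.ofReal η * ‖gradient φ (y - s • e)‖ₑ ^ 2))
            ∂(Measure.euclideanHausdorffMeasure m) :=
          lintegral_mono fun y => enorm_sq_le_lintegral_segment hφ he y (half_pos hδ) hη0
      _ ≤ ((1 + K : ℝ≥0) : ℝ≥0∞) ^ m * ∫⁻ x in U, (ENNReal.ofReal A * ‖φ x‖ₑ ^ 2
              + ENNReal.ofReal η * ‖gradient φ x‖ₑ ^ 2) :=
          lintegral_strip_le hU he hγ hx le_rfl ((hφm.const_mul _).add (hgm.const_mul _))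
      _ = _ := by
          rw [lintegral_add_left (hφm.const_mul _), lintegral_const_mul _ hφm,
            lintegral_const_mul _ hgm, mul_add, ← mul_assoc, ← mul_assoc]
          congr 2
          · have : ((1 + K : ℝ≥0) : ℝ≥0∞) ^ m = ENNReal.ofReal ((1 + K) ^ m) := by
              rw [ENNReal.ofReal_pow (by positivity)]
              congr 1
              rw [ENNReal.coe_nnreal_eq]
              simp
            rw [this, ← ENNReal.ofReal_mul hKpos.le, hη, mul_div_cancel₀ _ hKpos.ne']

end

section

variable {m : ℕ}

/-! ### Scaled cells -/

/-- The affine bijection `y ↦ ε (y + (k̄, 0))` that maps the standard cell to a cell of size `ε`. -/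
noncomputable def cellEquiv {ε : ℝ} (hε : 0 < ε) (k : Fin m → ℤ) : Space m ≃ₜ Space m :=
  (Homeomorph.addRight (latticeVec k)).trans (Homeomorph.smulOfNeZero ε hε.ne')

theorem cellEquiv_apply {ε : ℝ} (hε : 0 < ε) (k : Fin m → ℤ) (y : Space m) :
    cellEquiv hε k y = ε • (y + latticeVec k) := rfl

theorem cellCopy_eq_image {ε : ℝ} (hε : 0 < ε) (k : Fin m → ℤ) (A : Set (Space m)) :
    ChannelGeometry.cellCopy ε k A = cellEquiv hε k '' A := rfl

theorem restrict_cellCopy {ε : ℝ} (hε : 0 < ε) (k : Fin m → ℤ) (A : Set (Space m)) :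
    volume.restrict (ChannelGeometry.cellCopy ε k A)
      = ENNReal.ofReal (ε ^ (m + 1)) • (volume.restrict A).map (cellEquiv hε k) := by
  have h1 : (volume : Measure (Space m)).map (cellEquiv hε k)
      = ENNReal.ofReal ((ε ^ (m + 1))⁻¹) • volume := by
    have h2 : (volume : Measure (Space m)).map (cellEquiv hε k)
        = ((volume : Measure (Space m)).map (fun y => y + latticeVec k)).map (fun y => ε • y) := by
      rw [Measure.map_map (by fun_prop) (by fun_prop)]
      rfl
    rw [h2, map_add_right_eq_self, Measure.map_addHaar_smul _ hε.ne']
    simp [abs_of_pos hε]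
  have h3 : (volume : Measure (Space m))
      = ENNReal.ofReal (ε ^ (m + 1)) • (volume : Measure (Space m)).map (cellEquiv hε k) := by
    rw [h1, smul_smul, ← ENNReal.ofReal_mul (by positivity), mul_inv_cancel₀ (by positivity),
      ENNReal.ofReal_one, one_smul]
  have h4 := (cellEquiv hε k).toMeasurableEquiv.restrict_map volume
    (ChannelGeometry.cellCopy ε k A)
  conv_lhs => rw [h3, Measure.restrict_smul]
  congr 1
  rw [Homeomorph.toMeasurableEquiv_coe] at h4
  rw [h4, cellCopy_eq_image hε, preimage_image_eq _ (cellEquiv hε k).injective]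

theorem setLIntegral_cellCopy {ε : ℝ} (hε : 0 < ε) (k : Fin m → ℤ) (A : Set (Space m))
    (F : Space m → ℝ≥0∞) :
    ∫⁻ x in ChannelGeometry.cellCopy ε k A, F x
      = ENNReal.ofReal (ε ^ (m + 1)) * ∫⁻ y in A, F (cellEquiv hε k y) := by
  rw [restrict_cellCopy hε, lintegral_smul_measure, smul_eq_mul]
  congr 1
  exact lintegral_map_equiv F (cellEquiv hε k).toMeasurableEquiv

/-- Scaling of surface integrals. An inequality suffices here and follows from the behaviour of
Hausdorff measures under Lipschitz maps. -/
theorem setLIntegral_hausdorff_cellCopy_le {ε : ℝ} (hε : 0 < ε) (k : Fin m → ℤ) (A : Set (Space m))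
    (F : Space m → ℝ≥0∞) :
    ∫⁻ x in ChannelGeometry.cellCopy ε k A, F x ∂(Measure.euclideanHausdorffMeasure m)
      ≤ ENNReal.ofReal (ε ^ m)
        * ∫⁻ y in A, F (cellEquiv hε k y) ∂(Measure.euclideanHausdorffMeasure m) := by
  have hlip : LipschitzWith ε.toNNReal (cellEquiv hε k) := by
    refine LipschitzWith.of_dist_le_mul fun x y => ?_
    rw [cellEquiv_apply, cellEquiv_apply, dist_smul₀, dist_add_right, Real.coe_toNNReal _ hε.le,
      Real.norm_of_nonneg hε.le]
  have hle : (Measure.euclideanHausdorffMeasure m).restrict (ChannelGeometry.cellCopy ε k A)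
      ≤ ENNReal.ofReal (ε ^ m)
        • ((Measure.euclideanHausdorffMeasure m).restrict A).map (cellEquiv hε k) := by
    have hmeas : Measurable (cellEquiv hε k) := (cellEquiv hε k).continuous.measurable
    refine Measure.le_iff.2 fun B hB => ?_
    rw [Measure.restrict_apply hB, Measure.smul_apply, Measure.map_apply hmeas hB,
      Measure.restrict_apply (hmeas hB), smul_eq_mul, ENNReal.ofReal_pow hε.le]
    refine le_trans (measure_mono ?_) (euclideanHausdorffMeasure_image_le hlip m _)
    rintro _ ⟨hyB, y, hyA, rfl⟩
    exact ⟨y, ⟨hyB, hyA⟩, rfl⟩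
  refine (lintegral_mono' hle le_rfl).trans (le_of_eq ?_)
  rw [lintegral_smul_measure, smul_eq_mul]
  congr 1
  exact lintegral_map_equiv F (cellEquiv hε k).toMeasurableEquiv

theorem gradient_comp_cellEquiv {ε : ℝ} (hε : 0 < ε) (k : Fin m → ℤ) {φ : Space m → ℝ}
    (hφ : ContDiff ℝ ∞ φ) (y : Space m) :
    gradient (fun y => φ (cellEquiv hε k y)) y = ε • gradient φ (cellEquiv hε k y) := by
  have h1 : HasFDerivAt (fun y : Space m => cellEquiv hε k y)
      (ε • ContinuousLinearMap.id ℝ (Space m)) y :=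
    ((hasFDerivAt_id y).add_const (latticeVec k)).const_smul ε
  have h2 := ((hφ.differentiable (by simp)
    (cellEquiv hε k y)).hasGradientAt.hasFDerivAt).comp y h1
  refine HasGradientAt.gradient ?_
  rw [hasGradientAt_iff_hasFDerivAt]
  refine h2.congr_fderiv ?_
  ext z
  simp

theorem cellArg_add_latticeVec {y : Space m} (hy : ∀ i, bar y i ∈ Ioo (0 : ℝ) 1)
    (k : Fin m → ℤ) : cellArg (y + latticeVec k) = y := by
  have h : ∀ i : Fin m, Int.fract ((y + latticeVec k) i.castSucc) = y i.castSucc := by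
    intro i
    have hi : y i.castSucc ∈ Ioo (0 : ℝ) 1 := hy i
    simp only [latticeVec, PiLp.add_apply, joinLast_castSucc, Int.fract_add_intCast]
    exact Int.fract_eq_self.2 ⟨hi.1.le, hi.2⟩
  ext i
  refine Fin.lastCases ?_ (fun i => ?_) i
  · simp [cellArg, joinLast_last, latticeVec, lastCoord]
  · simp only [cellArg, joinLast_castSucc]
    exact h i

theorem cellArg_cellEquiv {ε : ℝ} (hε : 0 < ε) (k : Fin m → ℤ) {y : Space m}
    (hy : ∀ i, bar y i ∈ Ioo (0 : ℝ) 1) : cellArg (ε⁻¹ • cellEquiv hε k y) = y := by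
  rw [cellEquiv_apply, inv_smul_smul₀ hε.ne', cellArg_add_latticeVec hy]

namespace ChannelGeometry

theorem disjoint_cellCopy {ε : ℝ} (hε : 0 < ε) {k k' : Fin m → ℤ} (h : k ≠ k')
    {A : Set (Space m)} (hA : ∀ y ∈ A, ∀ i, bar y i ∈ Ioo (0 : ℝ) 1) :
    Disjoint (cellCopy ε k A) (cellCopy ε k' A) := by
  rw [Set.disjoint_left]
  rintro x ⟨y, hy, rfl⟩ ⟨y', hy', heq⟩
  have e1 : y = y' := by
    have h1 := cellArg_cellEquiv hε k (hA y hy)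
    have h2 := cellArg_cellEquiv hε k' (hA y' hy')
    rw [← h1, ← h2]
    exact congrArg (fun x => cellArg (ε⁻¹ • x)) heq.symm
  subst e1
  apply h
  have h3 : latticeVec k' = latticeVec k := by
    have := smul_right_injective (Space m) hε.ne' heq
    exact add_left_cancel this
  funext i
  have h4 := congrArg (fun z : Space m => z i.castSucc) h3
  simp only [latticeVec, joinLast_castSucc] at h4
  exact_mod_cast h4.symm

variable (G : ChannelGeometry m)

theorem bar_mem_of_mem_Zs {y : Space m} (hy : y ∈ G.Zs) : ∀ i, bar y i ∈ Ioo (0 : ℝ) 1 :=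
  (G.Zs_subset hy).1

theorem isBounded_stdCell (m : ℕ) : Bornology.IsBounded (stdCell m) := by
  refine (Metric.isBounded_closedBall (x := (0 : Space m)) (r := √(m + 1))).subset fun y hy => ?_
  rw [mem_closedBall_zero_iff, EuclideanSpace.norm_eq]
  refine Real.sqrt_le_sqrt ?_
  rw [Fin.sum_univ_castSucc]
  have h1 : ∀ i : Fin m, ‖y i.castSucc‖ ^ 2 ≤ 1 := by
    intro i
    have hi : y i.castSucc ∈ Ioo (0 : ℝ) 1 := hy.1 i
    rw [Real.norm_of_nonneg hi.1.le]
    nlinarith [hi.1, hi.2]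
  have h2 : ‖y (Fin.last m)‖ ^ 2 ≤ 1 := by
    have hi : y (Fin.last m) ∈ Ioo (-1 : ℝ) 1 := hy.2
    rw [Real.norm_eq_abs, sq_abs]
    nlinarith [hi.1, hi.2]
  have h3 := Finset.sum_le_sum (s := Finset.univ) fun i _ => h1 i
  simp at h3
  simp only [Real.norm_eq_abs, sq_abs] at h2 ⊢
  linarith

theorem isBounded_Zs : Bornology.IsBounded G.Zs := (isBounded_stdCell m).subset G.Zs_subset

theorem isOpen_cellCopy_Zs {ε : ℝ} (hε : 0 < ε) (k : Fin m → ℤ) : IsOpen (cellCopy ε k G.Zs) := by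
  rw [cellCopy_eq_image hε]
  exact (cellEquiv hε k).isOpenMap _ G.Zs_open

theorem isOpen_channels {ε : ℝ} (hε : 0 < ε) : IsOpen (G.channels ε) :=
  isOpen_biUnion fun k _ => G.isOpen_cellCopy_Zs hε k

theorem channels_subset_layer (ε : ℝ) : G.channels ε ⊆ G.layer ε :=
  iUnion₂_subset fun _ hk => (image_mono G.Zs_subset).trans hk

theorem volume_strip_eq {s : Set (Base m)} (hs : MeasurableSet s) {t : Set ℝ}
    (ht : MeasurableSet t) :
    volume {x : Space m | bar x ∈ s ∧ lastCoord x ∈ t} = volume s * volume t := by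
  have hm : MeasurableSet {x : Space m | bar x ∈ s ∧ lastCoord x ∈ t} := by
    have h1 : Measurable (bar : Space m → Base m) := by unfold bar; fun_prop
    have h2 : Measurable (lastCoord : Space m → ℝ) := by unfold lastCoord; fun_prop
    exact (h1 hs).inter (h2 ht)
  rw [← (measurePreserving_joinLast m).measure_preimage hm.nullMeasurableSet,
    ← Measure.prod_prod, ← Measure.volume_eq_prod]
  congr 1
  ext p
  simp

theorem volume_channels_le {ε : ℝ} (hε : 0 < ε) :
    volume (G.channels ε) ≤ ENNReal.ofReal ε * (2 * volume G.Sig) := by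
  refine (measure_mono (G.channels_subset_layer ε)).trans (le_of_eq ?_)
  have h : volume (G.layer ε) = volume G.Sig * volume (Ioo (-ε) ε) :=
    volume_strip_eq G.Sig_open.measurableSet measurableSet_Ioo
  rw [h, Real.volume_Ioo,
    show ε - -ε = ε * 2 by ring, ENNReal.ofReal_mul hε.le]
  simp
  ring

theorem setLIntegral_channels {ε : ℝ} (hε : 0 < ε) (F : Space m → ℝ≥0∞) :
    ∫⁻ x in G.channels ε, F x = ∑' k : G.cells ε, ∫⁻ x in cellCopy ε k.1 G.Zs, F x := by
  unfold channels
  rw [biUnion_eq_iUnion]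
  refine lintegral_iUnion (s := fun k : G.cells ε => cellCopy ε k.1 G.Zs)
    (fun k => (G.isOpen_cellCopy_Zs hε k.1).measurableSet) ?_ F
  intro k k' h
  exact disjoint_cellCopy hε (fun hh => h (Subtype.ext hh)) fun y hy => G.bar_mem_of_mem_Zs hy

/-- The trace inequality on the channels: that of the standard channel, scaled by `ε` and summed over
the cells. The powers of `ε` are those of the norm of `𝓗_ε`. -/
theorem trace_inequality_channels {θ : ℝ} (hθ : 0 < θ) :
    ∃ C : ℝ≥0, ∀ ε : ℝ, 0 < ε → ∀ φ : Space m → ℝ, ContDiff ℝ ∞ φ →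
      ∫⁻ y in G.lateral ε, ‖φ y‖ₑ ^ 2 ∂(Measure.euclideanHausdorffMeasure m)
        ≤ C * (ENNReal.ofReal ε⁻¹ * ∫⁻ x in G.channels ε, ‖φ x‖ₑ ^ 2)
          + ENNReal.ofReal θ * (ENNReal.ofReal ε * ∫⁻ x in G.channels ε, ‖gradient φ x‖ₑ ^ 2) := by
  obtain ⟨C, hC⟩ := trace_inequality G.Zs_open G.isBounded_Zs G.Zs_lipschitz hθ
  refine ⟨C, fun ε hε φ hφ => ?_⟩
  have hcell : ∀ k : Fin m → ℤ,
      ∫⁻ y in cellCopy ε k (cellLateral G.Zs), ‖φ y‖ₑ ^ 2 ∂(Measure.euclideanHausdorffMeasure m)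
        ≤ C * (ENNReal.ofReal ε⁻¹ * ∫⁻ x in cellCopy ε k G.Zs, ‖φ x‖ₑ ^ 2)
          + ENNReal.ofReal θ
            * (ENNReal.ofReal ε * ∫⁻ x in cellCopy ε k G.Zs, ‖gradient φ x‖ₑ ^ 2) := by
    intro k
    have hψ : ContDiff ℝ ∞ fun y => φ (cellEquiv hε k y) := by
      have : ContDiff ℝ ∞ fun y : Space m => cellEquiv hε k y := by
        simp only [cellEquiv_apply]; fun_prop
      exact hφ.comp this
    have h2 : ∀ y, ‖gradient (fun y => φ (cellEquiv hε k y)) y‖ₑ ^ 2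
        = ENNReal.ofReal (ε ^ 2) * ‖gradient φ (cellEquiv hε k y)‖ₑ ^ 2 := by
      intro y
      rw [gradient_comp_cellEquiv hε k hφ, enorm_smul, mul_pow, Real.enorm_of_nonneg hε.le,
        ENNReal.ofReal_pow hε.le]
    have hgm : Measurable fun y => ‖gradient φ (cellEquiv hε k y)‖ₑ ^ 2 :=
      (((continuous_gradient_smooth hφ).comp (cellEquiv hε k).continuous).enorm.measurable.pow_const
        2)
    have e1 : ENNReal.ofReal ε⁻¹ * ENNReal.ofReal (ε ^ (m + 1)) = ENNReal.ofReal (ε ^ m) := by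
      rw [← ENNReal.ofReal_mul (by positivity)]
      congr 1
      field_simp
      ring
    have e2 : ENNReal.ofReal ε * ENNReal.ofReal (ε ^ (m + 1))
        = ENNReal.ofReal (ε ^ m) * ENNReal.ofReal (ε ^ 2) := by
      rw [← ENNReal.ofReal_mul (by positivity), ← ENNReal.ofReal_mul (by positivity)]
      congr 1
      ring
    calc _ ≤ ENNReal.ofReal (ε ^ m) * ∫⁻ y in cellLateral G.Zs, ‖φ (cellEquiv hε k y)‖ₑ ^ 2
            ∂(Measure.euclideanHausdorffMeasure m) := setLIntegral_hausdorff_cellCopy_le hε k _ _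
      _ ≤ ENNReal.ofReal (ε ^ m) * ∫⁻ y in frontier G.Zs, ‖φ (cellEquiv hε k y)‖ₑ ^ 2
            ∂(Measure.euclideanHausdorffMeasure m) :=
          mul_le_mul_right (lintegral_mono_set sdiff_subset) _
      _ ≤ ENNReal.ofReal (ε ^ m) * (C * (∫⁻ y in G.Zs, ‖φ (cellEquiv hε k y)‖ₑ ^ 2)
            + ENNReal.ofReal θ * ∫⁻ y in G.Zs, ENNReal.ofReal (ε ^ 2)
              * ‖gradient φ (cellEquiv hε k y)‖ₑ ^ 2) := by
          refine mul_le_mul_right ?_ _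
          have := hC _ hψ
          simp only [h2] at this
          exact this
      _ = _ := by
          rw [setLIntegral_cellCopy hε, setLIntegral_cellCopy hε, ← mul_assoc (ENNReal.ofReal ε⁻¹),
            ← mul_assoc (ENNReal.ofReal ε), e1, e2, lintegral_const_mul _ hgm]
          ring
  rw [G.setLIntegral_channels hε, G.setLIntegral_channels hε, ← ENNReal.tsum_mul_left,
    ← ENNReal.tsum_mul_left, ← ENNReal.tsum_mul_left, ← ENNReal.tsum_mul_left, ← ENNReal.tsum_add]
  refine le_trans ?_ (ENNReal.tsum_le_tsum fun k : G.cells ε => hcell k.1)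
  unfold lateral
  rw [biUnion_eq_iUnion]
  exact lintegral_iUnion_le _ _

end ChannelGeometry

end

section

variable {m : ℕ}

/-! ### Bounds for the elements of the energy space -/

theorem eLpNorm_two_sq {α F : Type*} [MeasurableSpace α] [NormedAddCommGroup F] (f : α → F)
    (μ : Measure α) : eLpNorm f 2 μ ^ 2 = ∫⁻ x, ‖f x‖ₑ ^ 2 ∂μ := by
  have h := eLpNorm_nnreal_pow_eq_lintegral (μ := μ) (f := f) (p := 2) (by norm_num)
  simpa using h

/-- An inequality between `L²` norms of smooth functions and of their gradients is inherited by
traces. -/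
theorem IsTrace.lintegral_le {U Γ : Set (Space m)} {u : Space m → ℝ} {g : Space m → Space m}
    {v : Space m → ℝ} (h : IsTrace U Γ u g v) (hu : MemLp u 2 (volume.restrict U))
    (hg : MemLp g 2 (volume.restrict U)) {A B : ℝ≥0∞} (hA : A ≠ ⊤) (hB : B ≠ ⊤)
    (hAB : ∀ φ : Space m → ℝ, ContDiff ℝ ∞ φ →
      ∫⁻ y in Γ, ‖φ y‖ₑ ^ 2 ∂(Measure.euclideanHausdorffMeasure m)
        ≤ A * (∫⁻ x in U, ‖φ x‖ₑ ^ 2) + B * ∫⁻ x in U, ‖gradient φ x‖ₑ ^ 2) :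
    ∫⁻ y in Γ, ‖v y‖ₑ ^ 2 ∂(Measure.euclideanHausdorffMeasure m)
      ≤ A * (∫⁻ x in U, ‖u x‖ₑ ^ 2) + B * ∫⁻ x in U, ‖g x‖ₑ ^ 2 := by
  obtain ⟨hv, φ, h0, h1, h2, h3⟩ := h
  set σ := (Measure.euclideanHausdorffMeasure m).restrict Γ
  set μ := volume.restrict U
  simp only [← eLpNorm_two_sq] at hAB ⊢
  have key : ∀ k, eLpNorm v 2 σ ≤ eLpNorm (fun x => v x - φ k x) 2 σ
      + (A * (eLpNorm (fun x => u x - φ k x) 2 μ + eLpNorm u 2 μ) ^ 2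
        + B * (eLpNorm (fun x => g x - gradient (φ k) x) 2 μ + eLpNorm g 2 μ) ^ 2)
          ^ ((2 : ℝ)⁻¹) := by
    intro k
    have m1 : ∀ ν : Measure (Space m), AEStronglyMeasurable (φ k) ν := fun ν =>
      (h0 k).continuous.aestronglyMeasurable
    have m2 : AEStronglyMeasurable (gradient (φ k)) μ :=
      (continuous_gradient_smooth (h0 k)).aestronglyMeasurable
    have e1 : eLpNorm v 2 σ ≤ eLpNorm (fun x => v x - φ k x) 2 σ + eLpNorm (φ k) 2 σ := by
      have := eLpNorm_add_le (hv.1.sub (m1 σ)) (m1 σ) (p := 2) (by norm_num)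
      rwa [sub_add_cancel] at this
    have e2 : eLpNorm (φ k) 2 μ ≤ eLpNorm (fun x => u x - φ k x) 2 μ + eLpNorm u 2 μ := by
      have := eLpNorm_sub_le hu.1 (hu.1.sub (m1 μ)) (p := 2) (by norm_num)
      simp only [sub_sub_cancel] at this
      exact this.trans (add_comm _ _).le
    have e3 : eLpNorm (gradient (φ k)) 2 μ
        ≤ eLpNorm (fun x => g x - gradient (φ k) x) 2 μ + eLpNorm g 2 μ := by
      have := eLpNorm_sub_le hg.1 (hg.1.sub m2) (p := 2) (by norm_num)
      simp only [sub_sub_cancel] at this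
      exact this.trans (add_comm _ _).le
    refine e1.trans (add_le_add le_rfl ?_)
    rw [ENNReal.le_rpow_inv_iff (by norm_num), ENNReal.rpow_two]
    refine (hAB (φ k) (h0 k)).trans ?_
    gcongr
  have hlim : Tendsto (fun k => eLpNorm (fun x => v x - φ k x) 2 σ
      + (A * (eLpNorm (fun x => u x - φ k x) 2 μ + eLpNorm u 2 μ) ^ 2
        + B * (eLpNorm (fun x => g x - gradient (φ k) x) 2 μ + eLpNorm g 2 μ) ^ 2)
          ^ ((2 : ℝ)⁻¹)) atTop
      (𝓝 (0 + (A * (0 + eLpNorm u 2 μ) ^ 2 + B * (0 + eLpNorm g 2 μ) ^ 2) ^ ((2 : ℝ)⁻¹))) := by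
    refine h3.add ((ENNReal.continuous_rpow_const.tendsto _).comp ?_)
    refine Tendsto.add ?_ ?_
    · exact ENNReal.Tendsto.const_mul (((ENNReal.continuous_pow 2).tendsto _).comp
        (h1.add tendsto_const_nhds)) (Or.inr hA)
    · exact ENNReal.Tendsto.const_mul (((ENNReal.continuous_pow 2).tendsto _).comp
        (h2.add tendsto_const_nhds)) (Or.inr hB)
  have hfin := ge_of_tendsto' hlim key
  simp only [zero_add] at hfin
  rwa [ENNReal.le_rpow_inv_iff (by norm_num), ENNReal.rpow_two] at hfin

/-- The Cauchy–Schwarz estimate behind all bounds of the right-hand side. No measurability of the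
integrand is needed, since a non-integrable function has integral zero. -/
theorem abs_integral_le_of_growth {α F₁ F₂ : Type*} [MeasurableSpace α] [NormedAddCommGroup F₁]
    [NormedAddCommGroup F₂] {μ : Measure α} [IsFiniteMeasure μ] {f : α → ℝ} {w : α → F₁}
    {φ : α → F₂} {K L : ℝ} (hK : 0 ≤ K) (hL : 0 ≤ L) (hw : MemLp w 2 μ) (hφ : MemLp φ 2 μ)
    (hf : ∀ᵐ x ∂μ, |f x| ≤ (K + L * ‖w x‖) * ‖φ x‖) :
    |∫ x, f x ∂μ| ≤ (K * √(μ.real univ) + L * (eLpNorm w 2 μ).toReal)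
      * (eLpNorm φ 2 μ).toReal := by
  have h1 : MemLp (fun _ : α => K) 2 μ := memLp_const K
  have h2 : MemLp (fun x => L * ‖w x‖) 2 μ := hw.norm.const_mul L
  have hG : MemLp (fun x => K + L * ‖w x‖) 2 μ := h1.add h2
  have hp : MemLp (fun x => ‖φ x‖) 2 μ := hφ.norm
  have hint : Integrable (fun x => (K + L * ‖w x‖) * ‖φ x‖) μ := hG.integrable_mul hp
  have b1 : |∫ x, f x ∂μ| ≤ ∫ x, (K + L * ‖w x‖) * ‖φ x‖ ∂μ := by
    rw [← Real.norm_eq_abs]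
    exact norm_integral_le_of_norm_le hint hf
  have b2 : ∫ x, (K + L * ‖w x‖) * ‖φ x‖ ∂μ ≤ (eLpNorm (fun x => K + L * ‖w x‖) 2 μ).toReal
      * (eLpNorm (fun x => ‖φ x‖) 2 μ).toReal := by
    have h := real_inner_le_norm (hp.toLp _) (hG.toLp _)
    rw [L2.inner_def, Lp.norm_toLp, Lp.norm_toLp, mul_comm] at h
    refine le_trans (le_of_eq (integral_congr_ae ?_)) h
    filter_upwards [hp.coeFn_toLp, hG.coeFn_toLp] with x hx1 hx2
    rw [hx1, hx2]
    simp
  have b3 : (eLpNorm (fun x => K + L * ‖w x‖) 2 μ).toReal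
      ≤ K * √(μ.real univ) + L * (eLpNorm w 2 μ).toReal := by
    have e1 : (eLpNorm (fun _ : α => K) 2 μ).toReal = K * √(μ.real univ) := by
      rw [eLpNorm_const' _ (by norm_num) (by norm_num), ENNReal.toReal_mul,
        Real.enorm_of_nonneg hK, ENNReal.toReal_ofReal hK, ← ENNReal.toReal_rpow,
        Real.sqrt_eq_rpow]
      simp [Measure.real]
    have e2 : (eLpNorm (fun x => L * ‖w x‖) 2 μ).toReal = L * (eLpNorm w 2 μ).toReal := by
      have : (fun x => L * ‖w x‖) = L • fun x => ‖w x‖ := rfl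
      rw [this, eLpNorm_const_smul, eLpNorm_norm, ENNReal.toReal_mul, Real.enorm_of_nonneg hL,
        ENNReal.toReal_ofReal hL]
    rw [← e1, ← e2, ← ENNReal.toReal_add h1.eLpNorm_ne_top h2.eLpNorm_ne_top]
    exact ENNReal.toReal_mono (ENNReal.add_ne_top.2 ⟨h1.eLpNorm_ne_top, h2.eLpNorm_ne_top⟩)
      (eLpNorm_add_le h1.1 h2.1 (by norm_num))
  rw [eLpNorm_norm] at b2
  exact b1.trans (b2.trans (mul_le_mul_of_nonneg_right b3 ENNReal.toReal_nonneg))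

namespace ChannelGeometry

variable (G : ChannelGeometry m)

theorem restrict_bulkPlus_le (ε : ℝ) (w : ℝ≥0∞) :
    volume.restrict (G.bulkPlus ε) ≤ G.weighted ε w :=
  Measure.le_add_right (Measure.le_add_right le_rfl)

theorem restrict_bulkMinus_le (ε : ℝ) (w : ℝ≥0∞) :
    volume.restrict (G.bulkMinus ε) ≤ G.weighted ε w :=
  Measure.le_add_right (Measure.le_add_left le_rfl)

theorem smul_restrict_channels_le (ε : ℝ) (w : ℝ≥0∞) :
    w • volume.restrict (G.channels ε) ≤ G.weighted ε w :=
  Measure.le_add_left le_rfl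

theorem volume_Sig_ne_top : volume G.Sig ≠ ⊤ := G.Sig_bounded.measure_lt_top.ne

theorem isBounded_strip {r : ℝ} {t : Set ℝ} (ht : t ⊆ Icc (-r) r) :
    Bornology.IsBounded {x : Space m | bar x ∈ G.Sig ∧ lastCoord x ∈ t} := by
  obtain ⟨R, hR⟩ := G.Sig_bounded.subset_closedBall (0 : Base m)
  refine (Metric.isBounded_closedBall (x := (0 : Space m)) (r := √(R ^ 2 + r ^ 2))).subset ?_
  intro x hx
  rw [mem_closedBall_zero_iff]
  refine Real.le_sqrt_of_sq_le ?_
  rw [← joinLast_bar_lastCoord x, norm_sq_joinLast]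
  have h1 : ‖bar x‖ ≤ R := mem_closedBall_zero_iff.1 (hR hx.1)
  have h2 := ht hx.2
  have h3 : lastCoord x ^ 2 ≤ r ^ 2 := sq_le_sq' h2.1 h2.2
  have h4 : ‖bar x‖ ^ 2 ≤ R ^ 2 := pow_le_pow_left₀ (norm_nonneg _) h1 2
  linarith

theorem isBounded_Omega : Bornology.IsBounded G.Omega :=
  G.isBounded_strip Ioo_subset_Icc_self

theorem bulkPlus_subset_Omega {ε : ℝ} (hε : 0 < ε) : G.bulkPlus ε ⊆ G.Omega :=
  fun _ hx => ⟨hx.1, by linarith [hx.2.1, G.H_pos], hx.2.2⟩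

theorem bulkMinus_subset_Omega {ε : ℝ} (hε : 0 < ε) : G.bulkMinus ε ⊆ G.Omega :=
  fun _ hx => ⟨hx.1, hx.2.1, by linarith [hx.2.2, G.H_pos]⟩

theorem measurableSet_strip {s : Set (Base m)} (hs : MeasurableSet s) {t : Set ℝ}
    (ht : MeasurableSet t) : MeasurableSet {x : Space m | bar x ∈ s ∧ lastCoord x ∈ t} := by
  have h1 : Measurable (bar : Space m → Base m) := by unfold bar; fun_prop
  have h2 : Measurable (lastCoord : Space m → ℝ) := by unfold lastCoord; fun_prop
  exact (h1 hs).inter (h2 ht)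

theorem measurableSet_bulkPlus (ε : ℝ) : MeasurableSet (G.bulkPlus ε) :=
  measurableSet_strip G.Sig_open.measurableSet measurableSet_Ioo

theorem measurableSet_bulkMinus (ε : ℝ) : MeasurableSet (G.bulkMinus ε) :=
  measurableSet_strip G.Sig_open.measurableSet measurableSet_Ioo

variable {G} {ε : ℝ} {hε : 0 < ε}

theorem HSpace.norm_sq (w : G.HSpace ε hε) : ‖w‖ ^ 2 = ‖w.toL‖ ^ 2 + ‖w.1.snd‖ ^ 2 :=
  WithLp.prod_norm_sq_eq_of_L2 w.1

theorem HSpace.norm_toL_le (w : G.HSpace ε hε) : ‖w.toL‖ ≤ ‖w‖ := by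
  have := w.norm_sq
  exact (sq_le_sq₀ (norm_nonneg _) (norm_nonneg _)).1 (by nlinarith [sq_nonneg ‖w.1.snd‖])

theorem HSpace.norm_snd_le (w : G.HSpace ε hε) : ‖w.1.snd‖ ≤ ‖w‖ := by
  have := w.norm_sq
  exact (sq_le_sq₀ (norm_nonneg _) (norm_nonneg _)).1 (by nlinarith [sq_nonneg ‖w.toL‖])

theorem HSpace.memLp_val (w : G.HSpace ε hε) {ν : Measure (Space m)}
    (hν : ν ≤ G.weighted ε (ENNReal.ofReal ε⁻¹)) : MemLp w.val 2 ν :=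
  (Lp.memLp w.1.fst).mono_measure hν

theorem HSpace.memLp_grad (w : G.HSpace ε hε) {ν : Measure (Space m)}
    (hν : ν ≤ G.weighted ε (ENNReal.ofReal ε)) : MemLp w.grad 2 ν :=
  (Lp.memLp w.1.snd).mono_measure hν

theorem HSpace.eLpNorm_val_le (w : G.HSpace ε hε) {ν : Measure (Space m)}
    (hν : ν ≤ G.weighted ε (ENNReal.ofReal ε⁻¹)) : (eLpNorm w.val 2 ν).toReal ≤ ‖w.toL‖ := by
  rw [Lp.norm_def]
  exact ENNReal.toReal_mono (Lp.memLp w.1.fst).eLpNorm_ne_top (eLpNorm_mono_measure _ hν)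

theorem HSpace.eLpNorm_grad_le (w : G.HSpace ε hε) {ν : Measure (Space m)}
    (hν : ν ≤ G.weighted ε (ENNReal.ofReal ε)) : (eLpNorm w.grad 2 ν).toReal ≤ ‖w.1.snd‖ := by
  rw [Lp.norm_def]
  exact ENNReal.toReal_mono (Lp.memLp w.1.snd).eLpNorm_ne_top (eLpNorm_mono_measure _ hν)

theorem HSpace.memLp_val_channels (w : G.HSpace ε hε) :
    MemLp w.val 2 (volume.restrict (G.channels ε)) :=
  (G.dominates_channels ε (by simpa using hε) ENNReal.ofReal_ne_top).memLp
    (w.memLp_val (G.smul_restrict_channels_le ε _))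

theorem HSpace.memLp_grad_channels (w : G.HSpace ε hε) :
    MemLp w.grad 2 (volume.restrict (G.channels ε)) :=
  (G.dominates_channels ε (by simpa using hε) ENNReal.ofReal_ne_top).memLp
    (w.memLp_grad (G.smul_restrict_channels_le ε _))

/-- The integral defining the weighted norm of the gradient. -/
theorem HSpace.norm_sq_snd (w : G.HSpace ε hε) :
    ‖w.1.snd‖ ^ 2 = (∫ x in G.bulkPlus ε, ‖w.grad x‖ ^ 2) + (∫ x in G.bulkMinus ε, ‖w.grad x‖ ^ 2)
      + ε * ∫ x in G.channels ε, ‖w.grad x‖ ^ 2 := by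
  have hi : ∀ {ν : Measure (Space m)}, ν ≤ G.weighted ε (ENNReal.ofReal ε) →
      Integrable (fun x => ‖w.grad x‖ ^ 2) ν := fun hν =>
    (memLp_two_iff_integrable_sq_norm (w.memLp_grad hν).1).1 (w.memLp_grad hν)
  have h1 : ‖w.1.snd‖ ^ 2 = ∫ x, ‖w.grad x‖ ^ 2 ∂(G.weighted ε (ENNReal.ofReal ε)) := by
    rw [← real_inner_self_eq_norm_sq, L2.inner_def]
    refine integral_congr_ae (Eventually.of_forall fun x => ?_)
    exact real_inner_self_eq_norm_sq _
  rw [h1]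
  unfold weighted
  rw [integral_add_measure, integral_add_measure, integral_smul_measure,
    ENNReal.toReal_ofReal hε.le, smul_eq_mul]
  · exact hi (G.restrict_bulkPlus_le ε _)
  · exact hi (G.restrict_bulkMinus_le ε _)
  · exact hi (Measure.le_add_right le_rfl)
  · exact hi (G.smul_restrict_channels_le ε _)

theorem HSpace.trace_eq_zero_or (w : G.HSpace ε hε) :
    w.trace = 0 ∨ IsTrace (G.channels ε) (G.lateral ε) w.val w.grad w.trace := by
  unfold HSpace.trace traceFun
  split_ifs with h
  · exact Or.inr h.choose_spec
  · exact Or.inl rfl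

theorem HSpace.memLp_trace (w : G.HSpace ε hε) :
    MemLp w.trace 2 ((Measure.euclideanHausdorffMeasure m).restrict (G.lateral ε)) := by
  rcases w.trace_eq_zero_or with h | h
  · rw [h]; exact MemLp.zero
  · exact h.1

variable (G)

/-- The trace inequality for the elements of the energy space, uniform in `ε`. If an element has no
trace, then `traceFun` is zero by convention, and the inequality still holds. -/
theorem exists_trace_bound {θ : ℝ} (hθ : 0 < θ) :
    ∃ C : ℝ, 0 ≤ C ∧ ∀ (ε : ℝ) (hε : 0 < ε) (w : G.HSpace ε hε),
      (eLpNorm w.trace 2 ((Measure.euclideanHausdorffMeasure m).restrict (G.lateral ε))).toReal ^ 2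
        ≤ C * ‖w.toL‖ ^ 2 + θ * ‖w.1.snd‖ ^ 2 := by
  obtain ⟨C, hC⟩ := G.trace_inequality_channels hθ
  refine ⟨C, C.2, fun ε hε w => ?_⟩
  rcases w.trace_eq_zero_or with h | h
  · rw [h, eLpNorm_zero]
    rw [ENNReal.toReal_zero, zero_pow two_ne_zero]
    exact add_nonneg (mul_nonneg C.2 (sq_nonneg _)) (mul_nonneg hθ.le (sq_nonneg _))
  have h1 := h.lintegral_le w.memLp_val_channels w.memLp_grad_channels
    (A := C * ENNReal.ofReal ε⁻¹) (B := ENNReal.ofReal θ * ENNReal.ofReal ε)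
    (ENNReal.mul_ne_top ENNReal.coe_ne_top ENNReal.ofReal_ne_top)
    (ENNReal.mul_ne_top ENNReal.ofReal_ne_top ENNReal.ofReal_ne_top)
    (fun φ hφ => by
      have := hC ε hε φ hφ
      rwa [← mul_assoc, ← mul_assoc] at this)
  rw [mul_assoc, mul_assoc, ← smul_eq_mul (ENNReal.ofReal ε⁻¹), ← smul_eq_mul (ENNReal.ofReal ε),
    ← lintegral_smul_measure, ← lintegral_smul_measure] at h1
  simp only [← eLpNorm_two_sq] at h1
  have f1 : eLpNorm w.val 2 (ENNReal.ofReal ε⁻¹ • volume.restrict (G.channels ε)) ≠ ⊤ :=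
    (w.memLp_val (G.smul_restrict_channels_le ε _)).eLpNorm_ne_top
  have f2 : eLpNorm w.grad 2 (ENNReal.ofReal ε • volume.restrict (G.channels ε)) ≠ ⊤ :=
    (w.memLp_grad (G.smul_restrict_channels_le ε _)).eLpNorm_ne_top
  have h2 := ENNReal.toReal_mono (by finiteness) h1
  rw [ENNReal.toReal_add (by finiteness) (by finiteness), ENNReal.toReal_mul, ENNReal.toReal_mul,
    ENNReal.toReal_pow, ENNReal.toReal_pow, ENNReal.toReal_pow, ENNReal.toReal_ofReal hθ.le,
    ENNReal.coe_toReal] at h2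
  refine h2.trans ?_
  have g1 := w.eLpNorm_val_le (G.smul_restrict_channels_le ε _)
  have g2 := w.eLpNorm_grad_le (G.smul_restrict_channels_le ε _)
  gcongr

/-- The surface measure of the lateral boundary of the channels is bounded uniformly in `ε`: apply
the trace inequality to the constant function `1`. -/
theorem exists_lateral_bound :
    ∃ C : ℝ, 0 ≤ C ∧ ∀ ε : ℝ, 0 < ε →
      Measure.euclideanHausdorffMeasure m (G.lateral ε) ≤ ENNReal.ofReal C := by
  obtain ⟨C, hC⟩ := G.trace_inequality_channels one_pos
  refine ⟨(C * (2 * volume G.Sig)).toReal, ENNReal.toReal_nonneg, fun ε hε => ?_⟩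
  rw [ENNReal.ofReal_toReal (by have := G.volume_Sig_ne_top; finiteness)]
  have h := hC ε hε (fun _ => 1) contDiff_const
  have hg : ∀ x : Space m, gradient (fun _ : Space m => (1 : ℝ)) x = 0 := fun x => by
    simp [gradient]
  simp only [hg, enorm_zero, enorm_one, one_pow, lintegral_one, Measure.restrict_apply_univ,
    ne_eq, OfNat.ofNat_ne_zero, not_false_eq_true, zero_pow, lintegral_zero, mul_zero,
    add_zero] at h
  refine h.trans (mul_le_mul_right ?_ _)
  refine (mul_le_mul_right (G.volume_channels_le hε) _).trans (le_of_eq ?_)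
  rw [← mul_assoc, ← ENNReal.ofReal_mul (by positivity), inv_mul_cancel₀ hε.ne',
    ENNReal.ofReal_one, one_mul]

end ChannelGeometry

end

section

variable {m : ℕ}

/-! ### The diffusion and reaction forms -/

theorem measurable_cellArg : Measurable (cellArg : Space m → Space m) := by
  have h : Measurable fun y : Space m =>
      ((WithLp.toLp 2 fun i => Int.fract (y i.castSucc), lastCoord y) : Base m × ℝ) := by
    refine Measurable.prodMk ?_ (by unfold lastCoord; fun_prop)
    refine (WithLp.measurable_toLp 2 _).comp (measurable_pi_lambda _ fun i => ?_)
    exact measurable_fract.comp (by fun_prop)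
  exact (measurePreserving_joinLast m).measurable.comp h

/-- The lateral boundary `N` lies over the open cell `Y`, by its distance to the faces. -/
theorem bar_mem_Ioo_of_mem_cellLateral (G : ChannelGeometry m) {y : Space m}
    (hy : y ∈ cellLateral G.Zs) : ∀ i, bar y i ∈ Ioo (0 : ℝ) 1 := by
  have hcl : y ∈ closure (stdCell m) := closure_mono G.Zs_subset (frontier_subset_closure hy.1)
  have hsub : closure (stdCell m)
      ⊆ {y | (∀ i, bar y i ∈ Icc (0 : ℝ) 1) ∧ lastCoord y ∈ Icc (-1 : ℝ) 1} := by
    refine closure_minimal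
      (fun z hz => ⟨fun i => Ioo_subset_Icc_self (hz.1 i), Ioo_subset_Icc_self hz.2⟩) ?_
    refine IsClosed.inter (s₁ := {y : Space m | ∀ i, bar y i ∈ Icc (0 : ℝ) 1})
      (s₂ := {y : Space m | lastCoord y ∈ Icc (-1 : ℝ) 1}) ?_ ?_
    · have : {y : Space m | ∀ i, bar y i ∈ Icc (0 : ℝ) 1}
          = ⋂ i, {y : Space m | bar y i ∈ Icc (0 : ℝ) 1} := by ext; simp
      rw [this]
      refine isClosed_iInter fun i => ?_
      have hc : Continuous fun y : Space m => bar y i := by unfold bar; fun_prop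
      exact isClosed_Icc.preimage hc
    · have hc : Continuous fun y : Space m => lastCoord y := by unfold lastCoord; fun_prop
      exact isClosed_Icc.preimage hc
  by_contra! hne
  obtain ⟨i, hi⟩ := hne
  obtain ⟨δ, hδ, hdist⟩ := G.lateral_dist
  -- a point of `N` on a lateral face of the cell would have distance zero to these faces
  have hlat : y ∈ stdCellLateral m := by
    refine ⟨⟨hcl, fun hint => hi ((interior_subset hint).1 i)⟩, fun h => hi (h.1 i)⟩
  have := hdist y hy y hlat
  rw [dist_self] at this
  linarith

theorem abs_matForm_le (A : Matrix (Fin (m + 1)) (Fin (m + 1)) ℝ) (ξ η : Space m) :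
    |matForm A ξ η| ≤ (∑ i, ∑ j, |A i j|) * ‖ξ‖ * ‖η‖ := by
  unfold matForm
  refine (Finset.abs_sum_le_sum_abs _ _).trans ?_
  rw [Finset.sum_mul, Finset.sum_mul]
  refine Finset.sum_le_sum fun i _ => ?_
  rw [abs_mul, ← Real.norm_eq_abs (η i)]
  refine mul_le_mul ?_ (PiLp.norm_apply_le η i) (norm_nonneg _) (by positivity)
  refine (Finset.abs_sum_le_sum_abs _ _).trans ?_
  rw [Finset.sum_mul]
  refine Finset.sum_le_sum fun j _ => ?_
  rw [abs_mul, ← Real.norm_eq_abs (ξ j)]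
  exact mul_le_mul_of_nonneg_left (PiLp.norm_apply_le ξ j) (abs_nonneg _)

/-- A continuous function that is Lipschitz in its last variable has linear growth, uniformly on
compact sets of the other variables. -/
theorem exists_linear_growth {X : Type*} [TopologicalSpace X] {S : Set X} (hS : IsCompact S)
    {T : ℝ} {f : ℝ → X → ℝ → ℝ}
    (hc : ContinuousOn (fun p : ℝ × X × ℝ => f p.1 p.2.1 p.2.2) (Icc 0 T ×ˢ S ×ˢ univ))
    (hl : ∃ L : ℝ≥0, ∀ t ∈ Icc 0 T, ∀ x ∈ S, LipschitzWith L (f t x)) :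
    ∃ K L : ℝ, 0 ≤ K ∧ 0 ≤ L ∧ ∀ t ∈ Icc 0 T, ∀ x ∈ S, ∀ z, |f t x z| ≤ K + L * |z| := by
  obtain ⟨L, hL⟩ := hl
  have h0 : ContinuousOn (fun p : ℝ × X => f p.1 p.2 0) (Icc 0 T ×ˢ S) :=
    hc.comp (f := fun p : ℝ × X => (p.1, p.2, (0 : ℝ))) (by fun_prop)
      fun p hp => ⟨hp.1, hp.2, mem_univ _⟩
  obtain ⟨K, hK⟩ := (isCompact_Icc.prod hS).exists_bound_of_continuousOn h0
  refine ⟨|K|, L, abs_nonneg _, L.2, fun t ht x hx z => ?_⟩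
  have h1 := (hL t ht x hx).dist_le_mul z 0
  rw [Real.dist_eq, Real.dist_eq, sub_zero] at h1
  have h2 : |f t x 0| ≤ |K| := (hK (t, x) ⟨ht, hx⟩).trans (le_abs_self _)
  have h3 := abs_sub_abs_le_abs_sub (f t x z) (f t x 0)
  linarith

theorem abs_integral_le_of_bilinear {α F₁ F₂ : Type*} [MeasurableSpace α]
    [NormedAddCommGroup F₁] [NormedAddCommGroup F₂] {μ : Measure α} [IsFiniteMeasure μ]
    {f : α → ℝ} {w : α → F₁} {φ : α → F₂} {B a b : ℝ} (hB : 0 ≤ B) (hw : MemLp w 2 μ)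
    (hφ : MemLp φ 2 μ) (hf : ∀ᵐ x ∂μ, |f x| ≤ B * ‖w x‖ * ‖φ x‖)
    (ha : (eLpNorm w 2 μ).toReal ≤ a) (hb : (eLpNorm φ 2 μ).toReal ≤ b) :
    |∫ x, f x ∂μ| ≤ B * (a * b) := by
  have h := abs_integral_le_of_growth (K := 0) le_rfl hB hw hφ (by simpa using hf)
  have h1 : 0 ≤ (eLpNorm w 2 μ).toReal := ENNReal.toReal_nonneg
  have h2 : 0 ≤ (eLpNorm φ 2 μ).toReal := ENNReal.toReal_nonneg
  refine h.trans ?_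
  rw [zero_mul, zero_add, mul_assoc]
  gcongr
  exact h1.trans ha

namespace ChannelGeometry

variable (G : ChannelGeometry m)

theorem exists_of_mem_channels {ε : ℝ} (hε : 0 < ε) {x : Space m} (hx : x ∈ G.channels ε) :
    ∃ k, ∃ y ∈ G.Zs, x = cellEquiv hε k y ∧ cellArg (ε⁻¹ • x) = y := by
  obtain ⟨k, -, y, hy, rfl⟩ := by simpa only [channels, mem_iUnion, exists_prop] using hx
  exact ⟨k, y, hy, rfl, cellArg_cellEquiv hε k (G.bar_mem_of_mem_Zs hy)⟩

theorem cellArg_mem_of_mem_channels {ε : ℝ} (hε : 0 < ε) {x : Space m} (hx : x ∈ G.channels ε) :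
    cellArg (ε⁻¹ • x) ∈ G.Zs := by
  obtain ⟨k, y, hy, -, h⟩ := G.exists_of_mem_channels hε hx
  rwa [h]

theorem cellArg_mem_of_mem_lateral {ε : ℝ} (hε : 0 < ε) {x : Space m} (hx : x ∈ G.lateral ε) :
    cellArg (ε⁻¹ • x) ∈ cellLateral G.Zs := by
  obtain ⟨k, -, y, hy, rfl⟩ := by simpa only [lateral, mem_iUnion, exists_prop] using hx
  have := cellArg_cellEquiv hε k (bar_mem_Ioo_of_mem_cellLateral G hy)
  rw [cellEquiv_apply] at this
  rwa [this]

theorem measurableSet_lateral {ε : ℝ} (hε : 0 < ε) : MeasurableSet (G.lateral ε) := by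
  have hlast : Measurable (lastCoord : Space m → ℝ) := by unfold lastCoord; fun_prop
  have h0 : ∀ s, MeasurableSet (cellMouth G.Zs s) := fun s =>
    isClosed_frontier.measurableSet.inter (hlast (measurableSet_singleton s))
  have h1 : MeasurableSet (cellLateral G.Zs) :=
    (isClosed_frontier.measurableSet : MeasurableSet (frontier G.Zs)).diff ((h0 1).union (h0 (-1)))
  refine MeasurableSet.biUnion (to_countable _) fun k _ => ?_
  rw [cellCopy_eq_image hε]
  exact (cellEquiv hε k).measurableEmbedding.measurableSet_image' h1

/-- The map to the standard cell transports properties that hold almost everywhere in `Z*` to the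
channels. -/
theorem quasiMeasurePreserving_cellArg {ε : ℝ} (hε : 0 < ε) :
    Measure.QuasiMeasurePreserving (fun x : Space m => cellArg (ε⁻¹ • x))
      (volume.restrict (G.channels ε)) (volume.restrict G.Zs) := by
  have hm : Measurable fun x : Space m => cellArg (ε⁻¹ • x) :=
    measurable_cellArg.comp (by fun_prop)
  refine ⟨hm, Measure.AbsolutelyContinuous.mk fun s hs h0 => ?_⟩
  rw [Measure.restrict_apply hs] at h0
  rw [Measure.map_apply hm hs, Measure.restrict_apply (hm hs)]
  refine measure_mono_null (t := ⋃ k : Fin m → ℤ, cellCopy ε k (s ∩ G.Zs)) ?_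
    (measure_iUnion_null fun k => ?_)
  · rintro x ⟨hxs, hx⟩
    obtain ⟨k, y, hy, hxy, hcell⟩ := G.exists_of_mem_channels hε hx
    refine mem_iUnion.2 ⟨k, y, ⟨?_, hy⟩, hxy.symm⟩
    rw [← hcell]
    exact hxs
  · have := setLIntegral_cellCopy hε k (s ∩ G.Zs) (fun _ => 1)
    simpa [h0] using this

theorem isFiniteMeasure_bulkPlus {ε : ℝ} (hε : 0 < ε) :
    IsFiniteMeasure (volume.restrict (G.bulkPlus ε)) :=
  ⟨by simpa using (G.isBounded_Omega.subset (G.bulkPlus_subset_Omega hε)).measure_lt_top⟩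

theorem isFiniteMeasure_bulkMinus {ε : ℝ} (hε : 0 < ε) :
    IsFiniteMeasure (volume.restrict (G.bulkMinus ε)) :=
  ⟨by simpa using (G.isBounded_Omega.subset (G.bulkMinus_subset_Omega hε)).measure_lt_top⟩

theorem isFiniteMeasure_channels {ε : ℝ} (hε : 0 < ε) (w : ℝ) :
    IsFiniteMeasure (ENNReal.ofReal w • volume.restrict (G.channels ε)) := by
  refine ⟨?_⟩
  have h1 := G.volume_channels_le hε
  have h2 := G.volume_Sig_ne_top
  have h3 : volume (G.channels ε) < ⊤ := h1.trans_lt (by finiteness)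
  simp only [Measure.smul_apply, Measure.restrict_apply_univ, smul_eq_mul]
  finiteness

/-- The `L²` norm of the trace on the lateral boundary of the channels. -/
noncomputable def HSpace.traceNorm {G : ChannelGeometry m} {ε : ℝ} {hε : 0 < ε}
    (w : G.HSpace ε hε) : ℝ :=
  (eLpNorm w.trace 2 ((Measure.euclideanHausdorffMeasure m).restrict (G.lateral ε))).toReal

end ChannelGeometry

variable {G : ChannelGeometry m} {T : ℝ}

namespace ProblemData

/-- The bounds of the diffusion matrix at almost every point of the standard channel. -/
theorem exists_matrix_bounds (P : ProblemData G T) : ∃ B c₀ : ℝ, 0 ≤ B ∧ 0 < c₀ ∧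
    ∀ᵐ y ∂(volume.restrict G.Zs), (∀ ξ η : Space m, |matForm (P.DM y) ξ η| ≤ B * ‖ξ‖ * ‖η‖) ∧
      ∀ ξ : Space m, c₀ * ‖ξ‖ ^ 2 ≤ matForm (P.DM y) ξ ξ := by
  obtain ⟨c₀, hc₀, hcoer⟩ := P.DM_coercive
  have hb : ∀ i j, ∃ b : ℝ, ∀ᵐ y ∂(volume.restrict G.Zs), |P.DM y i j| ≤ b := by
    intro i j
    obtain ⟨h1, h2⟩ := P.DM_bounded i j
    refine ⟨(eLpNorm (fun y => P.DM y i j) ⊤ (volume.restrict G.Zs)).toReal, ?_⟩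
    filter_upwards [ae_le_eLpNormEssSup (f := fun y => P.DM y i j)
      (μ := volume.restrict G.Zs)] with y hy
    rw [← eLpNorm_exponent_top] at hy
    have := ENNReal.toReal_mono h2.ne hy
    rwa [toReal_enorm, Real.norm_eq_abs] at this
  choose b hb using hb
  refine ⟨∑ i, ∑ j, |b i j|, c₀, by positivity, hc₀, ?_⟩
  filter_upwards [hcoer, ae_all_iff.2 fun i => ae_all_iff.2 fun j => hb i j] with y h1 h2
  refine ⟨fun ξ η => (abs_matForm_le _ ξ η).trans ?_, h1⟩
  have h3 : ∑ i, ∑ j, |P.DM y i j| ≤ ∑ i, ∑ j, |b i j| :=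
    Finset.sum_le_sum fun i _ => Finset.sum_le_sum fun j _ => (h2 i j).trans (le_abs_self _)
  exact mul_le_mul_of_nonneg_right (mul_le_mul_of_nonneg_right h3 (norm_nonneg _)) (norm_nonneg _)

variable {ε : ℝ} {hε : 0 < ε}

/-- The bilinear form of the diffusion terms. -/
noncomputable def diffusion (P : ProblemData G T) (w φ : G.HSpace ε hε) : ℝ :=
  P.Dp * (∫ x in G.bulkPlus ε, inner ℝ (w.grad x) (φ.grad x))
    + P.Dm * (∫ x in G.bulkMinus ε, inner ℝ (w.grad x) (φ.grad x))
    + ε * (∫ x in G.channels ε, matForm (P.DM (cellArg (ε⁻¹ • x))) (w.grad x) (φ.grad x))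

/-- The right-hand side of the weak formulation. -/
noncomputable def reaction (P : ProblemData G T) (t : ℝ) (w φ : G.HSpace ε hε) : ℝ :=
  (∫ x in G.bulkPlus ε, P.fp t x (w.val x) * φ.val x)
    + (∫ x in G.bulkMinus ε, P.fm t x (w.val x) * φ.val x)
    + ε⁻¹ * (∫ x in G.channels ε, P.g t (cellArg (ε⁻¹ • x)) (w.val x) * φ.val x)
    - ∫ x in G.lateral ε, P.h t (cellArg (ε⁻¹ • x)) (w.trace x) * φ.trace x
        ∂(Measure.euclideanHausdorffMeasure m)

/-- The diffusion form is bounded, uniformly in `ε`. -/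
theorem exists_diffusion_le (P : ProblemData G T) : ∃ A : ℝ, 0 ≤ A ∧
    ∀ (ε : ℝ) (hε : 0 < ε) (w φ : G.HSpace ε hε),
      |P.diffusion w φ| ≤ A * (‖w.1.snd‖ * ‖φ.1.snd‖) := by
  obtain ⟨B, c₀, hB, -, hM⟩ := P.exists_matrix_bounds
  refine ⟨P.Dp + P.Dm + B, by have := P.Dp_pos; have := P.Dm_pos; positivity,
    fun ε hε w φ => ?_⟩
  have := G.isFiniteMeasure_bulkPlus hε
  have := G.isFiniteMeasure_bulkMinus hε
  have := G.isFiniteMeasure_channels hε ε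
  have hinner : ∀ x, |(inner ℝ (w.grad x) (φ.grad x) : ℝ)| ≤ 1 * ‖w.grad x‖ * ‖φ.grad x‖ := by
    intro x
    rw [one_mul]
    exact abs_real_inner_le_norm _ _
  have bound : ∀ {ν : Measure (Space m)} [IsFiniteMeasure ν] {f : Space m → ℝ} {b : ℝ}, 0 ≤ b →
      ν ≤ G.weighted ε (ENNReal.ofReal ε) → (∀ᵐ x ∂ν, |f x| ≤ b * ‖w.grad x‖ * ‖φ.grad x‖) →
      |∫ x, f x ∂ν| ≤ b * (‖w.1.snd‖ * ‖φ.1.snd‖) := fun hb hν hf =>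
    abs_integral_le_of_bilinear hb (w.memLp_grad hν) (φ.memLp_grad hν) hf (w.eLpNorm_grad_le hν)
      (φ.eLpNorm_grad_le hν)
  have b1 := bound zero_le_one (G.restrict_bulkPlus_le ε _) (Eventually.of_forall hinner)
  have b2 := bound zero_le_one (G.restrict_bulkMinus_le ε _) (Eventually.of_forall hinner)
  have b3 : |ε * ∫ x in G.channels ε, matForm (P.DM (cellArg (ε⁻¹ • x))) (w.grad x) (φ.grad x)|
      ≤ B * (‖w.1.snd‖ * ‖φ.1.snd‖) := by
    have hae : ∀ᵐ x ∂(ENNReal.ofReal ε • volume.restrict (G.channels ε)),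
        |matForm (P.DM (cellArg (ε⁻¹ • x))) (w.grad x) (φ.grad x)|
          ≤ B * ‖w.grad x‖ * ‖φ.grad x‖ := by
      refine Measure.ae_smul_measure ?_ _
      filter_upwards [(G.quasiMeasurePreserving_cellArg hε).ae hM] with x hx
      exact hx.1 _ _
    have := bound hB (G.smul_restrict_channels_le ε _) hae
    rwa [integral_smul_measure, ENNReal.toReal_ofReal hε.le, smul_eq_mul] at this
  unfold diffusion
  have c1 := abs_le.1 b1
  have c2 := abs_le.1 b2
  have c3 := abs_le.1 b3
  have hp := P.Dp_pos
  have hm := P.Dm_pos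
  rw [abs_le]
  constructor <;> nlinarith [c1.1, c1.2, c2.1, c2.2, c3.1, c3.2]

/-- The diffusion form is coercive in the gradient, uniformly in `ε`. -/
theorem exists_diffusion_ge (P : ProblemData G T) : ∃ c : ℝ, 0 < c ∧
    ∀ (ε : ℝ) (hε : 0 < ε) (w : G.HSpace ε hε), c * ‖w.1.snd‖ ^ 2 ≤ P.diffusion w w := by
  obtain ⟨B, c₀, hB, hc₀, hM⟩ := P.exists_matrix_bounds
  have hp := P.Dp_pos
  have hm := P.Dm_pos
  refine ⟨min P.Dp (min P.Dm c₀), by positivity, fun ε hε w => ?_⟩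
  set c := min P.Dp (min P.Dm c₀)
  have hc1 : c ≤ P.Dp := min_le_left _ _
  have hc2 : c ≤ P.Dm := (min_le_right _ _).trans (min_le_left _ _)
  have hc3 : c ≤ c₀ := (min_le_right _ _).trans (min_le_right _ _)
  have hg := w.memLp_grad_channels
  have hg2 : Integrable (fun x => ‖w.grad x‖ ^ 2) (volume.restrict (G.channels ε)) :=
    (memLp_two_iff_integrable_sq_norm hg.1).1 hg
  have hae := (G.quasiMeasurePreserving_cellArg hε).ae hM
  have hmeas : AEStronglyMeasurable
      (fun x => matForm (P.DM (cellArg (ε⁻¹ • x))) (w.grad x) (w.grad x))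
      (volume.restrict (G.channels ε)) := by
    have hcomp : ∀ i, AEStronglyMeasurable (fun x => w.grad x i)
        (volume.restrict (G.channels ε)) := fun i =>
      (by fun_prop : Continuous fun z : Space m => z i).comp_aestronglyMeasurable hg.1
    have hD : ∀ i j, AEStronglyMeasurable (fun x => P.DM (cellArg (ε⁻¹ • x)) i j)
        (volume.restrict (G.channels ε)) := fun i j =>
      (P.DM_bounded i j).1.comp_quasiMeasurePreserving (G.quasiMeasurePreserving_cellArg hε)
    unfold matForm
    refine Finset.aestronglyMeasurable_fun_sum _ fun i _ => ?_
    exact (Finset.aestronglyMeasurable_fun_sum _ fun j _ => (hD i j).mul (hcomp j)).mul (hcomp i)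
  have hint : Integrable (fun x => matForm (P.DM (cellArg (ε⁻¹ • x))) (w.grad x) (w.grad x))
      (volume.restrict (G.channels ε)) := by
    refine (hg2.const_mul B).mono' hmeas ?_
    filter_upwards [hae] with x hx
    rw [Real.norm_eq_abs]
    refine (hx.1 _ _).trans (le_of_eq ?_)
    ring
  have h3 : c₀ * ∫ x in G.channels ε, ‖w.grad x‖ ^ 2
      ≤ ∫ x in G.channels ε, matForm (P.DM (cellArg (ε⁻¹ • x))) (w.grad x) (w.grad x) := by
    rw [← integral_const_mul]
    refine integral_mono_ae (hg2.const_mul c₀) hint ?_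
    filter_upwards [hae] with x hx
    exact hx.2 _
  have i1 : 0 ≤ ∫ x in G.bulkPlus ε, ‖w.grad x‖ ^ 2 := integral_nonneg fun _ => sq_nonneg _
  have i2 : 0 ≤ ∫ x in G.bulkMinus ε, ‖w.grad x‖ ^ 2 := integral_nonneg fun _ => sq_nonneg _
  have i3 : 0 ≤ ∫ x in G.channels ε, ‖w.grad x‖ ^ 2 := integral_nonneg fun _ => sq_nonneg _
  rw [w.norm_sq_snd]
  unfold diffusion
  simp only [real_inner_self_eq_norm_sq]
  have d1 := mul_le_mul_of_nonneg_right hc1 i1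
  have d2 := mul_le_mul_of_nonneg_right hc2 i2
  have d3 := mul_le_mul_of_nonneg_left ((mul_le_mul_of_nonneg_right hc3 i3).trans h3) hε.le
  linarith

/-- The reaction terms grow linearly, uniformly in `ε`: the factor `ε⁻¹` of the term in the channels
is the weight of `𝓛_ε`, and the measure of the channels is of the order `ε`. -/
theorem exists_reaction_le (P : ProblemData G T) : ∃ K : ℝ, 0 ≤ K ∧
    ∀ (ε : ℝ) (hε : 0 < ε) (t : ℝ), t ∈ Icc 0 T → ∀ w φ : G.HSpace ε hε,
      |P.reaction t w φ| ≤ K * (1 + ‖w.toL‖) * ‖φ.toL‖ + K * (1 + w.traceNorm) * φ.traceNorm := by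
  obtain ⟨K₁, L₁, hK₁, hL₁, hfp⟩ := exists_linear_growth G.isBounded_Omega.isCompact_closure
    P.fp_continuous P.fp_lipschitz
  obtain ⟨K₂, L₂, hK₂, hL₂, hfm⟩ := exists_linear_growth G.isBounded_Omega.isCompact_closure
    P.fm_continuous P.fm_lipschitz
  obtain ⟨K₃, L₃, hK₃, hL₃, hg⟩ := exists_linear_growth G.isBounded_Zs.isCompact_closure
    P.g_continuous P.g_lipschitz
  have hNc : IsCompact (closure (cellLateral G.Zs)) :=
    G.isBounded_Zs.isCompact_closure.of_isClosed_subset isClosed_closure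
      (closure_minimal (sdiff_subset.trans frontier_subset_closure) isClosed_closure)
  obtain ⟨K₄, L₄, hK₄, hL₄, hh⟩ := exists_linear_growth hNc P.h_continuous P.h_lipschitz
  obtain ⟨S, hS, hlat⟩ := G.exists_lateral_bound
  have hV : volume G.Omega ≠ ⊤ := G.isBounded_Omega.measure_lt_top.ne
  set V := √(volume G.Omega).toReal with hVdef
  set W := √(2 * volume G.Sig).toReal with hWdef
  have hSig := G.volume_Sig_ne_top
  set K := (K₁ * V + L₁) + (K₂ * V + L₂) + (K₃ * W + L₃) + (K₄ * √S + L₄) with hKdef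
  refine ⟨K, by positivity, fun ε hε t ht w φ => ?_⟩
  have := G.isFiniteMeasure_bulkPlus hε
  have := G.isFiniteMeasure_bulkMinus hε
  have := G.isFiniteMeasure_channels hε ε⁻¹
  have hfin : IsFiniteMeasure ((Measure.euclideanHausdorffMeasure m).restrict (G.lateral ε)) :=
    ⟨by simpa using (hlat ε hε).trans_lt ENNReal.ofReal_lt_top⟩
  have bound : ∀ {ν : Measure (Space m)} [IsFiniteMeasure ν] {f : Space m → ℝ} {k l v : ℝ}, 0 ≤ k →
      0 ≤ l → ν ≤ G.weighted ε (ENNReal.ofReal ε⁻¹) → √(ν.real univ) ≤ v →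
      (∀ᵐ x ∂ν, |f x| ≤ k + l * |w.val x|) →
      |∫ x, f x * φ.val x ∂ν| ≤ (k * v + l) * (1 + ‖w.toL‖) * ‖φ.toL‖ := by
    intro ν _ f k l v hk hl hν hv hf
    have h1 := abs_integral_le_of_growth (f := fun x => f x * φ.val x) hk hl (w.memLp_val hν)
      (φ.memLp_val hν) (by
        filter_upwards [hf] with x hx
        rw [abs_mul]
        exact mul_le_mul_of_nonneg_right hx (abs_nonneg _))
    have hv0 : 0 ≤ v := (Real.sqrt_nonneg _).trans hv
    refine h1.trans (mul_le_mul ?_ (φ.eLpNorm_val_le hν) ENNReal.toReal_nonneg ?_)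
    · have h2 := mul_le_mul_of_nonneg_left hv hk
      have h3 := mul_le_mul_of_nonneg_left (w.eLpNorm_val_le hν) hl
      have h4 : 0 ≤ k * v * ‖w.toL‖ := by positivity
      linarith
    · positivity
  have b1 := bound (f := fun x => P.fp t x (w.val x)) hK₁ hL₁ (G.restrict_bulkPlus_le ε _)
    (v := V) (Real.sqrt_le_sqrt (by
      simpa [Measure.real] using
        ENNReal.toReal_mono hV (measure_mono (G.bulkPlus_subset_Omega hε)))) (by
      filter_upwards [ae_restrict_mem (G.measurableSet_bulkPlus ε)] with x hx
      exact hfp t ht x (subset_closure (G.bulkPlus_subset_Omega hε hx)) _)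
  have b2 := bound (f := fun x => P.fm t x (w.val x)) hK₂ hL₂ (G.restrict_bulkMinus_le ε _)
    (v := V) (Real.sqrt_le_sqrt (by
      simpa [Measure.real] using
        ENNReal.toReal_mono hV (measure_mono (G.bulkMinus_subset_Omega hε)))) (by
      filter_upwards [ae_restrict_mem (G.measurableSet_bulkMinus ε)] with x hx
      exact hfm t ht x (subset_closure (G.bulkMinus_subset_Omega hε hx)) _)
  have b3 := bound (f := fun x => P.g t (cellArg (ε⁻¹ • x)) (w.val x)) hK₃ hL₃
    (G.smul_restrict_channels_le ε _) (v := W) (Real.sqrt_le_sqrt (by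
      refine ENNReal.toReal_mono (by finiteness) ?_
      simp only [Measure.smul_apply, Measure.restrict_apply_univ, smul_eq_mul]
      refine (mul_le_mul_right (G.volume_channels_le hε) _).trans (le_of_eq ?_)
      rw [← mul_assoc, ← ENNReal.ofReal_mul (by positivity), inv_mul_cancel₀ hε.ne',
        ENNReal.ofReal_one, one_mul])) (by
      refine Measure.ae_smul_measure ?_ _
      filter_upwards [ae_restrict_mem (G.isOpen_channels hε).measurableSet] with x hx
      exact hg t ht _ (subset_closure (G.cellArg_mem_of_mem_channels hε hx)) _)
  rw [integral_smul_measure, ENNReal.toReal_ofReal (by positivity), smul_eq_mul] at b3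
  have b4 : |∫ x in G.lateral ε, P.h t (cellArg (ε⁻¹ • x)) (w.trace x) * φ.trace x
        ∂(Measure.euclideanHausdorffMeasure m)|
      ≤ (K₄ * √S + L₄) * (1 + w.traceNorm) * φ.traceNorm := by
    have h1 := abs_integral_le_of_growth
      (f := fun x => P.h t (cellArg (ε⁻¹ • x)) (w.trace x) * φ.trace x) hK₄ hL₄ w.memLp_trace
      φ.memLp_trace (by
        filter_upwards [ae_restrict_mem (G.measurableSet_lateral hε)] with x hx
        rw [abs_mul]
        exact mul_le_mul_of_nonneg_right
          (hh t ht _ (subset_closure (G.cellArg_mem_of_mem_lateral hε hx)) _) (abs_nonneg _))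
    refine h1.trans (mul_le_mul_of_nonneg_right ?_ ENNReal.toReal_nonneg)
    have h2 : √(((Measure.euclideanHausdorffMeasure m).restrict (G.lateral ε)).real univ) ≤ √S := by
      refine Real.sqrt_le_sqrt (ENNReal.toReal_le_of_le_ofReal hS ?_)
      simpa using hlat ε hε
    have h3 := mul_le_mul_of_nonneg_left h2 hK₄
    have h4 : 0 ≤ w.traceNorm := ENNReal.toReal_nonneg
    have h5 : 0 ≤ K₄ * √S * w.traceNorm := by positivity
    change _ + L₄ * w.traceNorm ≤ _
    linarith
  have hτ : 0 ≤ (1 + w.traceNorm) * φ.traceNorm := by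
    have h4 : 0 ≤ w.traceNorm := ENNReal.toReal_nonneg
    have h5 : 0 ≤ φ.traceNorm := ENNReal.toReal_nonneg
    positivity
  have hn : 0 ≤ (1 + ‖w.toL‖) * ‖φ.toL‖ := by positivity
  unfold reaction
  have htri : ∀ a b c d : ℝ, |a + b + c - d| ≤ |a| + |b| + |c| + |d| := fun a b c d =>
    (abs_sub _ _).trans (by linarith [abs_add_le (a + b) c, abs_add_le a b])
  refine (htri _ _ _ _).trans ?_
  have e1 : K * (1 + ‖w.toL‖) * ‖φ.toL‖ = K * ((1 + ‖w.toL‖) * ‖φ.toL‖) := by ring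
  have e2 : K * (1 + w.traceNorm) * φ.traceNorm = K * ((1 + w.traceNorm) * φ.traceNorm) := by ring
  have k1 : (K₁ * V + L₁) + (K₂ * V + L₂) + (K₃ * W + L₃) ≤ K := by
    have : 0 ≤ K₄ * √S + L₄ := by positivity
    linarith
  have k2 : K₄ * √S + L₄ ≤ K := by
    have : 0 ≤ (K₁ * V + L₁) + (K₂ * V + L₂) + (K₃ * W + L₃) := by positivity
    linarith
  have m1 := mul_le_mul_of_nonneg_right k1 hn
  have m2 := mul_le_mul_of_nonneg_right k2 hτ
  rw [e1, e2]
  linarith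

end ProblemData

end

section

variable {m : ℕ} {G : ChannelGeometry m} {T : ℝ}

/-! ### Growth and coercivity of the weak formulation -/

/-- The constants of the form bounds combine to a bound for the time derivative. Here `n, n'` stand
for the norms of a solution and a test function, `l, l'` for their norms in `𝓛_ε`, and `τ, τ'` for
their trace norms. -/
theorem functional_bound_arith {A K Q n n' l l' τ τ' r d : ℝ} (hA : 0 ≤ A)
    (hK : 0 ≤ K) (hQ : 0 ≤ Q) (hn : 0 ≤ n) (hn' : 0 ≤ n') (hl' : 0 ≤ l') (hτ' : 0 ≤ τ')
    (hl : l ≤ n) (hln : l' ≤ n') (hτ : τ ≤ (Q + 1) * n) (hτn : τ' ≤ (Q + 1) * n')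
    (hd : d ≤ A * (n * n')) (hr : r ≤ K * (1 + l) * l' + K * (1 + τ) * τ') :
    r + d ≤ (A + K + K * (Q + 1) ^ 2) * (1 + n) * n' := by
  have d2 : K * (1 + l) * l' ≤ K * (1 + n) * n' := by gcongr
  have d3 : K * (1 + τ) * τ' ≤ K * ((Q + 1) * (1 + n)) * ((Q + 1) * n') := by
    have h2 : 1 + τ ≤ (Q + 1) * (1 + n) := by linarith
    gcongr
  have h0 : 0 ≤ A * n' := mul_nonneg hA hn'
  calc r + d ≤ K * (1 + n) * n' + K * ((Q + 1) * (1 + n)) * ((Q + 1) * n') + A * (n * n') := by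
        linarith
    _ ≤ K * (1 + n) * n' + K * ((Q + 1) * (1 + n)) * ((Q + 1) * n') + A * (n * n') + A * n' := by
        linarith
    _ = _ := by ring

/-- The constants of the form bounds combine to a coercivity estimate: the trace norm `τ` is absorbed
into the diffusion, because its bound contains the gradient norm `s` with a small factor. -/
theorem coercivity_arith {K c Q l s τ r : ℝ} (hK : 0 ≤ K) (hQ : 0 ≤ Q)
    (hτ : τ ^ 2 ≤ Q * l ^ 2 + c / (4 * K + 4) * s ^ 2) (hc : 0 < c)
    (hr : r ≤ K * (1 + l) * l + K * (1 + τ) * τ) :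
    r - c * s ^ 2 + c / 2 * (l ^ 2 + s ^ 2) ≤ (2 * K + 2 * K * Q + c / 2) * (1 + l ^ 2) := by
  have e1 : ∀ x : ℝ, K * (1 + x) * x ≤ K * (1 + 2 * x ^ 2) := by
    intro x
    rw [mul_assoc]
    refine mul_le_mul_of_nonneg_left ?_ hK
    nlinarith [sq_nonneg (x - 1)]
  have e2 : 2 * K * (c / (4 * K + 4)) ≤ c / 2 := by
    rw [← mul_div_assoc, div_le_iff₀ (by positivity)]
    nlinarith
  have e3 := mul_le_mul_of_nonneg_left hτ (by positivity : 0 ≤ 2 * K)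
  have e4 := mul_le_mul_of_nonneg_right e2 (sq_nonneg s)
  have e6 := e1 τ
  have e7 := e1 l
  have e8 : 0 ≤ K * Q := by positivity
  have e9 : (2 * K + 2 * K * Q + c / 2) * (1 + l ^ 2)
      = 2 * K + 2 * K * Q + c / 2 + 2 * (K * l ^ 2) + 2 * K * Q * l ^ 2 + c / 2 * l ^ 2 := by ring
  rw [e9]
  linarith

namespace ProblemData

/-- The weak formulation at a fixed time bounds the time derivative and gives the coercivity
estimate, with constants that do not depend on `ε`. -/
theorem exists_structure_constants (P : ProblemData G T) : ∃ c C : ℝ, 0 < c ∧ 0 ≤ C ∧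
    ∀ (ε : ℝ) (hε : 0 < ε) (t : ℝ), t ∈ Icc 0 T → ∀ (w : G.HSpace ε hε)
      (ℓ : StrongDual ℝ (G.HSpace ε hε)),
      (∀ φ : G.HSpace ε hε, ℓ φ + P.diffusion w φ = P.reaction t w φ) →
      ‖ℓ‖ ≤ C * (1 + ‖w‖) ∧ ℓ w + c * ‖w‖ ^ 2 ≤ C * (1 + ‖w.toL‖ ^ 2) := by
  obtain ⟨A, hA, hdiff⟩ := P.exists_diffusion_le
  obtain ⟨c, hc, hcoer⟩ := P.exists_diffusion_ge
  obtain ⟨K, hK, hreac⟩ := P.exists_reaction_le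
  obtain ⟨Q, hQ, htr₁⟩ := G.exists_trace_bound one_pos
  -- the small factor makes the trace terms cost at most half of the coercivity
  obtain ⟨Q', hQ', htr₂⟩ := G.exists_trace_bound (θ := c / (4 * K + 4)) (by positivity)
  have hD₁ : 0 ≤ A + K + K * (Q + 1) ^ 2 := by positivity
  have hD₂ : 0 ≤ 2 * K + 2 * K * Q' + c / 2 := by positivity
  refine ⟨c / 2, (A + K + K * (Q + 1) ^ 2) + (2 * K + 2 * K * Q' + c / 2), by positivity,
    add_nonneg hD₁ hD₂, fun ε hε t ht w ℓ heq => ⟨?_, ?_⟩⟩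
  · have hτ : ∀ z : G.HSpace ε hε, z.traceNorm ≤ (Q + 1) * ‖z‖ := by
      intro z
      have h1 : z.traceNorm ^ 2 ≤ Q * ‖z.toL‖ ^ 2 + 1 * ‖z.1.snd‖ ^ 2 := htr₁ ε hε z
      have h2 := z.norm_sq
      refine (sq_le_sq₀ ENNReal.toReal_nonneg
        (mul_nonneg (by linarith) (norm_nonneg _))).1 ?_
      have h4 := mul_nonneg hQ (sq_nonneg ‖z.1.snd‖)
      have h5 := sq_nonneg ‖z.toL‖
      rw [mul_pow, h2]
      have h6 : Q + 1 ≤ (Q + 1) ^ 2 := by nlinarith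
      refine le_trans ?_ (mul_le_mul_of_nonneg_right h6 (add_nonneg h5 (sq_nonneg _)))
      exact h1.trans (by linarith)
    refine ℓ.opNorm_le_bound (mul_nonneg (add_nonneg hD₁ hD₂)
      (add_nonneg zero_le_one (norm_nonneg _))) fun φ => ?_
    have h1 : ℓ φ = P.reaction t w φ - P.diffusion w φ := by linarith [heq φ]
    have d1 : |P.diffusion w φ| ≤ A * (‖w‖ * ‖φ‖) := by
      refine (hdiff ε hε w φ).trans (mul_le_mul_of_nonneg_left ?_ hA)
      exact mul_le_mul w.norm_snd_le φ.norm_snd_le (norm_nonneg _) (norm_nonneg _)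
    have h2 := functional_bound_arith hA hK hQ (norm_nonneg w) (norm_nonneg φ)
      (norm_nonneg φ.toL) ENNReal.toReal_nonneg w.norm_toL_le φ.norm_toL_le (hτ w) (hτ φ) d1
      (hreac ε hε t ht w φ)
    rw [Real.norm_eq_abs, h1]
    refine (abs_sub _ _).trans (h2.trans ?_)
    rw [mul_assoc, mul_assoc]
    exact mul_le_mul_of_nonneg_right (le_add_of_nonneg_right hD₂)
      (mul_nonneg (add_nonneg zero_le_one (norm_nonneg _)) (norm_nonneg _))
  · have h1 : ℓ w = P.reaction t w w - P.diffusion w w := by linarith [heq w]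
    have h2 := coercivity_arith hK hQ' (htr₂ ε hε w) hc (abs_le.1 (hreac ε hε t ht w w)).2
    have hd := hcoer ε hε w
    rw [h1, w.norm_sq]
    refine le_trans (by linarith) (h2.trans (mul_le_mul_of_nonneg_right
      (le_add_of_nonneg_left hD₁) (add_nonneg zero_le_one (sq_nonneg _))))

end ProblemData

/-! ### The initial value -/

theorem map_bar_restrict_strip {s : Set (Base m)} (hs : MeasurableSet s) {t : Set ℝ}
    (ht : MeasurableSet t) :
    (volume.restrict {x : Space m | bar x ∈ s ∧ lastCoord x ∈ t}).map bar
      = volume t • volume.restrict s := by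
  have hbar : Measurable (bar : Space m → Base m) := by unfold bar; fun_prop
  refine Measure.ext fun B hB => ?_
  rw [Measure.map_apply hbar hB, Measure.restrict_apply (hbar hB), Measure.smul_apply,
    Measure.restrict_apply hB, smul_eq_mul, mul_comm,
    ← ChannelGeometry.volume_strip_eq (hB.inter hs) ht]
  congr 1
  ext x
  simp [and_assoc]

theorem ChannelGeometry.not_mem_bulk_of_mem_channels (G : ChannelGeometry m) {ε : ℝ} {x : Space m}
    (hx : x ∈ G.channels ε) : x ∉ G.bulkPlus ε ∧ x ∉ G.bulkMinus ε := by
  have h := G.channels_subset_layer ε hx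
  exact ⟨fun h1 => absurd h1.2.1 (not_lt.2 h.2.2.le), fun h1 => absurd h1.2.2 (not_lt.2 h.2.1.le)⟩

/-- The initial values are bounded in `𝓛_ε`, uniformly in `ε`: the factor `ε⁻¹` compensates for the
thickness of the layer. -/
theorem ProblemData.exists_initial_bound (P : ProblemData G T) : ∃ M : ℝ,
    ∀ (ε : ℝ), 0 < ε → ∀ v : G.LSpace ε,
      v =ᵐ[G.weighted ε (ENNReal.ofReal ε⁻¹)] P.initial ε → ‖v‖ ^ 2 ≤ M := by
  set M : ℝ≥0∞ := (∫⁻ x in G.OmegaPlus, ‖P.uip x‖ₑ ^ 2) + (∫⁻ x in G.OmegaMinus, ‖P.uim x‖ₑ ^ 2)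
    + 2 * ∫⁻ a in G.Sig, ‖P.uiM a‖ₑ ^ 2 with hM
  have hMtop : M ≠ ⊤ := by
    rw [hM]
    simp only [← eLpNorm_two_sq]
    have h1 := P.uip_memLp.eLpNorm_ne_top
    have h2 := P.uim_memLp.eLpNorm_ne_top
    have h3 := P.uiM_memLp.eLpNorm_ne_top
    finiteness
  refine ⟨M.toReal, fun ε hε v hv => ?_⟩
  rw [Lp.norm_def, ← ENNReal.toReal_pow]
  refine ENNReal.toReal_mono hMtop ?_
  rw [eLpNorm_congr_ae hv, eLpNorm_two_sq]
  unfold ChannelGeometry.weighted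
  rw [lintegral_add_measure, lintegral_add_measure, lintegral_smul_measure, smul_eq_mul]
  have hp : G.bulkPlus ε ⊆ G.OmegaPlus := fun x hx => ⟨hx.1, hε.trans hx.2.1, hx.2.2⟩
  have hm : G.bulkMinus ε ⊆ G.OmegaMinus := fun x hx =>
    ⟨hx.1, hx.2.1, hx.2.2.trans (neg_lt_zero.2 hε)⟩
  have b1 : ∫⁻ x in G.bulkPlus ε, ‖P.initial ε x‖ₑ ^ 2 ≤ ∫⁻ x in G.OmegaPlus, ‖P.uip x‖ₑ ^ 2 := by
    calc _ = ∫⁻ x in G.bulkPlus ε, ‖P.uip x‖ₑ ^ 2 := by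
          refine setLIntegral_congr_fun (G.measurableSet_bulkPlus ε) fun x hx => ?_
          simp only [ProblemData.initial, if_pos hx]
      _ ≤ _ := lintegral_mono_set hp
  have b2 : ∫⁻ x in G.bulkMinus ε, ‖P.initial ε x‖ₑ ^ 2
      ≤ ∫⁻ x in G.OmegaMinus, ‖P.uim x‖ₑ ^ 2 := by
    calc _ = ∫⁻ x in G.bulkMinus ε, ‖P.uim x‖ₑ ^ 2 := by
          refine setLIntegral_congr_fun (G.measurableSet_bulkMinus ε) fun x hx => ?_
          have hn : x ∉ G.bulkPlus ε := fun h => by linarith [h.2.1, hx.2.2]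
          simp only [ProblemData.initial, if_neg hn, if_pos hx]
      _ ≤ _ := lintegral_mono_set hm
  have b3 : ∫⁻ x in G.channels ε, ‖P.initial ε x‖ₑ ^ 2
      ≤ ENNReal.ofReal ε * (2 * ∫⁻ a in G.Sig, ‖P.uiM a‖ₑ ^ 2) := by
    have hmap : (volume.restrict (G.layer ε)).map bar
        = volume (Ioo (-ε) ε) • volume.restrict G.Sig :=
      map_bar_restrict_strip G.Sig_open.measurableSet measurableSet_Ioo
    have hbar : Measurable (bar : Space m → Base m) := by unfold bar; fun_prop
    have hae : AEMeasurable (fun a => ‖P.uiM a‖ₑ ^ 2) (volume.restrict G.Sig) :=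
      P.uiM_memLp.1.enorm.pow_const 2
    calc _ ≤ ∫⁻ x in G.channels ε, ‖P.uiM (bar x)‖ₑ ^ 2 := by
          refine setLIntegral_mono' (G.isOpen_channels hε).measurableSet fun x hx => ?_
          obtain ⟨h1, h2⟩ := G.not_mem_bulk_of_mem_channels hx
          have h3 : cellArg (ε⁻¹ • x) ∈ closure G.Zs :=
            subset_closure (G.cellArg_mem_of_mem_channels hε hx)
          simp only [ProblemData.initial, if_neg h1, if_neg h2, dif_pos h3]
          gcongr
          exact enorm_le_iff_norm_le.2 (BoundedContinuousFunction.norm_coe_le_norm _ _)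
      _ ≤ ∫⁻ x in G.layer ε, ‖P.uiM (bar x)‖ₑ ^ 2 :=
          lintegral_mono_set (G.channels_subset_layer ε)
      _ = ∫⁻ a, ‖P.uiM a‖ₑ ^ 2 ∂((volume.restrict (G.layer ε)).map bar) := by
          rw [lintegral_map' _ hbar.aemeasurable]
          rw [hmap]
          exact hae.smul_measure _
      _ = _ := by
          rw [hmap, lintegral_smul_measure, Real.volume_Ioo, show ε - -ε = ε * 2 by ring,
            ENNReal.ofReal_mul hε.le, smul_eq_mul, mul_assoc]
          simp
  refine add_le_add (add_le_add b1 b2) ((mul_le_mul_right b3 _).trans (le_of_eq ?_))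
  rw [← mul_assoc, ← ENNReal.ofReal_mul (by positivity), inv_mul_cancel₀ hε.ne',
    ENNReal.ofReal_one, one_mul]

end

section

variable {m : ℕ}

/-! ### Integration by parts in a strip -/

theorem integral_fderiv_eq_zero {f : Base m → ℝ} (hf : ContDiff ℝ 1 f) (hc : HasCompactSupport f)
    (v : Base m) : ∫ a, fderiv ℝ f a v = 0 := by
  have h1 : Continuous (fun a => fderiv ℝ f a v) :=
    (hf.continuous_fderiv one_ne_zero).clm_apply continuous_const
  have hi : Integrable f := hf.continuous.integrable_of_hasCompactSupport hc
  have hi' : Integrable (fun a => fderiv ℝ f a v) :=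
    h1.integrable_of_hasCompactSupport (hc.fderiv_apply (𝕜 := ℝ) v)
  have h := integral_mul_fderiv_eq_neg_fderiv_mul_of_integrable (μ := (volume : Measure (Base m)))
    (f := fun _ => (1 : ℝ)) (g := f) (v := v) (by simp) (by simpa using hi') (by simpa using hi)
    (fun x _ => differentiableAt_const _) (fun x _ => hf.differentiable one_ne_zero x)
  simpa using h

theorem integral_strip_eq {r : ℝ} {h : Space m → ℝ} (hh : Continuous h)
    (hi : HasCompactSupport h) :
    ∫ x in {x : Space m | lastCoord x ∈ Ioo (-r) r}, h x
      = ∫ a : Base m, ∫ s in Ioo (-r) r, h (joinLast a.ofLp s) := by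
  have hlast : Measurable (lastCoord : Space m → ℝ) := by unfold lastCoord; fun_prop
  have hS : MeasurableSet {x : Space m | lastCoord x ∈ Ioo (-r) r} := hlast measurableSet_Ioo
  have hmp := (measurePreserving_joinLast m).restrict_preimage hS
  have hpre : (fun p : Base m × ℝ => joinLast p.1.ofLp p.2) ⁻¹'
      {x : Space m | lastCoord x ∈ Ioo (-r) r} = univ ×ˢ Ioo (-r) r := by
    ext p
    simp
  have hint : Integrable h (volume.restrict {x : Space m | lastCoord x ∈ Ioo (-r) r}) :=
    (hh.integrable_of_hasCompactSupport hi).integrableOn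
  have hmp' : MeasurePreserving (fun p : Base m × ℝ => joinLast p.1.ofLp p.2)
      ((volume : Measure (Base m)).prod (volume.restrict (Ioo (-r) r)))
      (volume.restrict {x : Space m | lastCoord x ∈ Ioo (-r) r}) := by
    rw [hpre] at hmp
    rwa [Measure.volume_eq_prod, ← Measure.prod_restrict, Measure.restrict_univ] at hmp
  rw [← hmp'.map_eq, integral_map hmp'.measurable.aemeasurable (by rw [hmp'.map_eq]; exact hint.1)]
  refine integral_prod _ ?_
  exact hmp'.integrable_comp_of_integrable hint

theorem isClosedEmbedding_joinLast (s : ℝ) :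
    IsClosedEmbedding (fun a : Base m => joinLast a.ofLp s) ∧
      Isometry (fun a : Base m => joinLast a.ofLp s) := by
  have h : Isometry (fun a : Base m => joinLast a.ofLp s) := by
    refine Isometry.of_dist_eq fun a b => ?_
    simp only [joinLast_eq, dist_add_right]
    exact (baseEmbedding m).isometry.dist_eq a b
  exact ⟨h.isClosedEmbedding, h⟩

/-- The divergence theorem in a strip: only the transversal derivative contributes. -/
theorem integral_strip_fderiv {r : ℝ} (hr : 0 < r) {F : Space m → ℝ} (hF : ContDiff ℝ ∞ F)
    (hc : HasCompactSupport F) (e : Space m) :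
    ∫ x in {x : Space m | lastCoord x ∈ Ioo (-r) r}, fderiv ℝ F x e
      = lastCoord e * ((∫ a : Base m, F (joinLast a.ofLp r))
          - ∫ a : Base m, F (joinLast a.ofLp (-r))) := by
  have hd : Continuous (fderiv ℝ F) := hF.continuous_fderiv (by simp)
  have hcd : ∀ v, Continuous (fun x => fderiv ℝ F x v) := fun v => hd.clm_apply continuous_const
  have hsd : ∀ v, HasCompactSupport (fun x => fderiv ℝ F x v) := fun v =>
    hc.fderiv_apply (𝕜 := ℝ) v
  have hi : ∀ v, Integrable (fun x => fderiv ℝ F x v)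
      (volume.restrict {x : Space m | lastCoord x ∈ Ioo (-r) r}) := fun v =>
    ((hcd v).integrable_of_hasCompactSupport (hsd v)).integrableOn
  have hdec : e = baseEmbedding m (bar e) + lastCoord e • lastVec m := by
    rw [← joinLast_eq, joinLast_bar_lastCoord]
  have hjc : Continuous (fun p : Base m × ℝ => joinLast p.1.ofLp p.2) := by
    simp only [joinLast_eq]
    have := (baseEmbedding m).continuous
    fun_prop
  have hFd : Differentiable ℝ F := hF.differentiable (by simp)
  -- the tangential derivatives integrate to zero in every hyperplane
  have htan : ∫ x in {x : Space m | lastCoord x ∈ Ioo (-r) r},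
      fderiv ℝ F x (baseEmbedding m (bar e)) = 0 := by
    rw [integral_strip_eq (hcd _) (hsd _)]
    rw [integral_integral_swap]
    · refine integral_eq_zero_of_ae (Eventually.of_forall fun s => ?_)
      have hcomp : ContDiff ℝ 1 (fun a : Base m => F (joinLast a.ofLp s)) := by
        simp only [joinLast_eq]
        exact (hF.of_le (by simp)).comp
          ((baseEmbedding m).toContinuousLinearMap.contDiff.add contDiff_const)
      have h := integral_fderiv_eq_zero hcomp
        (hc.comp_isClosedEmbedding (isClosedEmbedding_joinLast s).1) (bar e)
      rw [Pi.zero_apply, ← h]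
      refine integral_congr_ae (Eventually.of_forall fun a => ?_)
      have h1 : HasFDerivAt (fun a : Base m => F (joinLast a.ofLp s))
          ((fderiv ℝ F (joinLast a.ofLp s)).comp (baseEmbedding m).toContinuousLinearMap) a := by
        have h2 : HasFDerivAt (fun a : Base m => joinLast a.ofLp s)
            (baseEmbedding m).toContinuousLinearMap a := by
          simp only [joinLast_eq]
          exact ((baseEmbedding m).toContinuousLinearMap.hasFDerivAt).add_const _
        exact (hFd _).hasFDerivAt.comp a h2
      beta_reduce
      rw [h1.fderiv]
      rfl
    · have hmp := measurePreserving_joinLast m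
      have h1 : Integrable (fun p : Base m × ℝ =>
          fderiv ℝ F (joinLast p.1.ofLp p.2) (baseEmbedding m (bar e)))
          ((volume : Measure (Base m)).prod (volume : Measure ℝ)) :=
        hmp.integrable_comp_of_integrable ((hcd _).integrable_of_hasCompactSupport (hsd _))
      refine h1.mono_measure ?_
      exact Measure.prod_mono le_rfl Measure.restrict_le_self
  have hnor : ∫ x in {x : Space m | lastCoord x ∈ Ioo (-r) r}, fderiv ℝ F x (lastVec m)
      = (∫ a : Base m, F (joinLast a.ofLp r)) - ∫ a : Base m, F (joinLast a.ofLp (-r)) := by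
    rw [integral_strip_eq (hcd _) (hsd _)]
    have hia : ∀ s : ℝ, Integrable (fun a : Base m => F (joinLast a.ofLp s)) := fun s =>
      (hF.continuous.comp (isClosedEmbedding_joinLast s).1.continuous).integrable_of_hasCompactSupport
        (hc.comp_isClosedEmbedding (isClosedEmbedding_joinLast s).1)
    rw [← integral_sub (hia r) (hia (-r))]
    refine integral_congr_ae (Eventually.of_forall fun a => ?_)
    have h1 : ∀ s : ℝ, HasDerivAt (fun s : ℝ => F (joinLast a.ofLp s))
        (fderiv ℝ F (joinLast a.ofLp s) (lastVec m)) s := by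
      intro s
      have h2 : HasDerivAt (fun s : ℝ => joinLast a.ofLp s) (lastVec m) s := by
        simp only [joinLast_eq]
        simpa using ((hasDerivAt_id s).smul_const (lastVec m)).const_add (baseEmbedding m a)
      exact (hFd _).hasFDerivAt.comp_hasDerivAt s h2
    beta_reduce
    rw [← integral_Ioc_eq_integral_Ioo, ← intervalIntegral.integral_of_le (by linarith)]
    refine intervalIntegral.integral_eq_sub_of_hasDerivAt (fun s _ => h1 s) ?_
    exact ((hcd _).comp (hjc.comp (by fun_prop : Continuous fun s : ℝ => (a, s)))).intervalIntegrable
      _ _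
  have hsplit : ∀ x, fderiv ℝ F x e = fderiv ℝ F x (baseEmbedding m (bar e))
      + lastCoord e * fderiv ℝ F x (lastVec m) := by
    intro x
    conv_lhs => rw [hdec]
    rw [map_add, map_smul, smul_eq_mul]
  simp only [hsplit]
  rw [integral_add (hi _) ((hi _).const_mul _), integral_const_mul, htan, hnor, zero_add]

/-! ### Passage to the limit in products -/

theorem tendsto_integral_mul {α : Type*} [MeasurableSpace α] {μ : Measure α} {f : α → ℝ}
    {φ : ℕ → α → ℝ} {h : α → ℝ} (hf : MemLp f 2 μ) (hh : MemLp h 2 μ)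
    (hφ : ∀ k, AEStronglyMeasurable (φ k) μ)
    (hlim : Tendsto (fun k => eLpNorm (fun x => f x - φ k x) 2 μ) atTop (𝓝 0)) :
    Tendsto (fun k => ∫ x, φ k x * h x ∂μ) atTop (𝓝 (∫ x, f x * h x ∂μ)) := by
  have hfin : ∀ᶠ k in atTop, MemLp (φ k) 2 μ := by
    filter_upwards [hlim.eventually (gt_mem_nhds ENNReal.zero_lt_top)] with k hk
    have h1 : MemLp (fun x => f x - φ k x) 2 μ := ⟨hf.1.sub (hφ k), hk⟩
    convert hf.sub h1 using 1
    funext x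
    simp
  have hle : ∀ k, eLpNorm ((fun x => φ k x * h x) - fun x => f x * h x) 1 μ
      ≤ eLpNorm (fun x => f x - φ k x) 2 μ * eLpNorm h 2 μ := by
    intro k
    have h1 := eLpNorm_smul_le_mul_eLpNorm (p := 2) (q := 2) (r := 1) hh.1 (hf.1.sub (hφ k))
    refine le_trans (le_of_eq ?_) h1
    rw [← eLpNorm_neg]
    congr 1
    funext x
    simp only [Pi.neg_apply, Pi.sub_apply, Pi.smul_apply', smul_eq_mul]
    ring
  refine tendsto_integral_of_L1' _ (hf.integrable_mul hh).1
    (hfin.mono fun k hk => hk.integrable_mul hh) ?_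
  have h0 : Tendsto (fun k => eLpNorm (fun x => f x - φ k x) 2 μ * eLpNorm h 2 μ) atTop (𝓝 0) := by
    simpa using ENNReal.Tendsto.mul_const hlim (Or.inr hh.eLpNorm_ne_top)
  exact tendsto_of_tendsto_of_tendsto_of_le_of_le tendsto_const_nhds h0 (fun _ => zero_le) hle

end

section

variable {m : ℕ}

/-! ### The channels inside the microscopic domain -/

namespace ChannelGeometry

variable (G : ChannelGeometry m)

theorem channels_subset_microDomain {ε : ℝ} (hε : 0 < ε) : G.channels ε ⊆ G.microDomain ε :=
  interior_maximal (fun _ hx => Or.inl (Or.inl (Or.inr hx))) (G.isOpen_channels hε)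

/-- The part of the microscopic domain in the open layer consists of the channels. -/
theorem mem_channels_of_mem_microDomain {ε : ℝ} {x : Space m}
    (hx : x ∈ G.microDomain ε) (hl : lastCoord x ∈ Ioo (-ε) ε) : x ∈ G.channels ε := by
  rcases interior_subset hx with (((h | h) | h) | h) | h
  · exact absurd h.2.1 (not_lt.2 hl.2.le)
  · exact absurd h.2.2 (not_lt.2 hl.1.le)
  · exact h
  · have h1 : lastCoord x = ε * 1 := G.mouths_subset ε 1 h
    exact absurd hl.2 (by rw [h1, mul_one]; exact lt_irrefl _)
  · have h1 : lastCoord x = ε * -1 := G.mouths_subset ε (-1) h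
    exact absurd hl.1 (by rw [h1, mul_neg_one]; exact lt_irrefl _)

theorem mem_mouths_of_mem_microDomain {ε : ℝ} (hε : 0 < ε) {x : Space m}
    (hx : x ∈ G.microDomain ε) {s : ℝ} (hs : s = 1 ∨ s = -1) (hl : lastCoord x = ε * s) :
    x ∈ G.mouths ε 1 ∪ G.mouths ε (-1) := by
  have hr : lastCoord x = ε ∨ lastCoord x = -ε := by
    rcases hs with rfl | rfl
    · exact Or.inl (by rw [hl, mul_one])
    · exact Or.inr (by rw [hl, mul_neg_one])
  rcases interior_subset hx with (((h | h) | h) | h) | h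
  · have := h.2.1
    rcases hr with hr | hr <;> linarith
  · have := h.2.2
    rcases hr with hr | hr <;> linarith
  · have := (G.channels_subset_layer ε h).2
    rcases hr with hr | hr <;> linarith [this.1, this.2]
  · exact Or.inl h
  · exact Or.inr h

/-- Test functions are square integrable over the mouths, which lie in two hyperplanes. -/
theorem memLp_mouths {ε : ℝ} {ψ : Space m → ℝ} (hψ : Continuous ψ) (hc : HasCompactSupport ψ) :
    MemLp ψ 2 ((Measure.euclideanHausdorffMeasure m).restrict
      (G.mouths ε 1 ∪ G.mouths ε (-1))) := by
  have hplane : ∀ s : ℝ, MemLp ψ 2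
      ((Measure.euclideanHausdorffMeasure m).restrict (G.mouths ε s)) := by
    intro s
    obtain ⟨hemb, hiso⟩ := isClosedEmbedding_joinLast (m := m) (ε * s)
    have h1 : MemLp (ψ ∘ fun a : Base m => joinLast a.ofLp (ε * s)) 2 (volume : Measure (Base m)) :=
      (hψ.comp hemb.continuous).memLp_of_hasCompactSupport (hc.comp_isClosedEmbedding hemb)
    rw [← hemb.measurableEmbedding.memLp_map_measure_iff,
      ← EuclideanSpace.euclideanHausdorffMeasure_eq_volume, hiso.map_euclideanHausdorffMeasure] at h1
    refine h1.mono_measure (Measure.restrict_mono_set _ ?_)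
    intro x hx
    refine ⟨bar x, ?_⟩
    have h2 : lastCoord x = ε * s := G.mouths_subset ε s hx
    beta_reduce
    rw [← h2, joinLast_bar_lastCoord]
  refine MemLp.mono_measure (Measure.restrict_union_le _ _) ?_
  refine ⟨hψ.aestronglyMeasurable, ?_⟩
  have h1 : eLpNorm ψ 2 ((Measure.euclideanHausdorffMeasure m).restrict (G.mouths ε 1)
      + (Measure.euclideanHausdorffMeasure m).restrict (G.mouths ε (-1))) ^ 2 < ⊤ := by
    have h2 := (hplane 1).2
    have h3 := (hplane (-1)).2
    rw [eLpNorm_two_sq, lintegral_add_measure, ← eLpNorm_two_sq, ← eLpNorm_two_sq]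
    finiteness
  exact (ENNReal.pow_lt_top_iff.1 h1).resolve_right two_ne_zero

/-- A function supported in the microscopic domain lives on the mouths in the hyperplanes
`xₙ = ± ε`. -/
theorem lintegral_slice_le {ε : ℝ} (hε : 0 < ε) {F : Space m → ℝ} (hF : Continuous F)
    (hs : tsupport F ⊆ G.microDomain ε) {s : ℝ} (hs1 : s = 1 ∨ s = -1) :
    ∫⁻ a : Base m, ‖F (joinLast a.ofLp (ε * s))‖ₑ
      ≤ ∫⁻ x in G.mouths ε 1 ∪ G.mouths ε (-1), ‖F x‖ₑ ∂(Measure.euclideanHausdorffMeasure m) := by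
  obtain ⟨hemb, hiso⟩ := isClosedEmbedding_joinLast (m := m) (ε * s)
  have hS : MeasurableSet (Function.support F) := hF.isOpen_support.measurableSet
  set R := range (fun a : Base m => joinLast a.ofLp (ε * s)) with hR
  have hRm : MeasurableSet R := hemb.isClosed_range.measurableSet
  calc ∫⁻ a : Base m, ‖F (joinLast a.ofLp (ε * s))‖ₑ
      = ∫⁻ x in R, ‖F x‖ₑ ∂(Measure.euclideanHausdorffMeasure m) := by
        rw [hR, ← hiso.map_euclideanHausdorffMeasure, hemb.measurableEmbedding.lintegral_map,
          EuclideanSpace.euclideanHausdorffMeasure_eq_volume]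
    _ = ∫⁻ x in R ∩ Function.support F, ‖F x‖ₑ ∂(Measure.euclideanHausdorffMeasure m) := by
        rw [← lintegral_inter_add_sdiff (B := Function.support F) _ R hS,
          setLIntegral_eq_zero (s := R \ Function.support F) (hRm.diff hS), add_zero]
        intro x hx
        have : F x = 0 := by simpa using hx.2
        simp [this]
    _ ≤ _ := by
        refine lintegral_mono_set ?_
        rintro x ⟨⟨a, rfl⟩, hx⟩
        exact G.mem_mouths_of_mem_microDomain hε (hs (subset_tsupport _ hx)) hs1
          (lastCoord_joinLast _ _)

/-- The divergence theorem in the channels, for functions supported in the microscopic domain: only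
the mouths contribute. -/
theorem abs_integral_channels_fderiv_le {ε : ℝ} (hε : 0 < ε) {F : Space m → ℝ}
    (hF : ContDiff ℝ ∞ F) (hc : HasCompactSupport F) (hs : tsupport F ⊆ G.microDomain ε)
    (hfin : ∫⁻ x in G.mouths ε 1 ∪ G.mouths ε (-1), ‖F x‖ₑ
      ∂(Measure.euclideanHausdorffMeasure m) ≠ ⊤) (e : Space m) :
    |∫ x in G.channels ε, fderiv ℝ F x e| ≤ |lastCoord e| *
      (2 * (∫⁻ x in G.mouths ε 1 ∪ G.mouths ε (-1), ‖F x‖ₑ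
        ∂(Measure.euclideanHausdorffMeasure m)).toReal) := by
  have hlast : Measurable (lastCoord : Space m → ℝ) := by unfold lastCoord; fun_prop
  have h1 : ∫ x in {x : Space m | lastCoord x ∈ Ioo (-ε) ε}, fderiv ℝ F x e
      = ∫ x in G.channels ε, fderiv ℝ F x e := by
    refine setIntegral_eq_of_subset_of_forall_sdiff_eq_zero (hlast measurableSet_Ioo)
      (fun x hx => (G.channels_subset_layer ε hx).2) fun x hx => ?_
    have hx1 : x ∉ tsupport (fderiv ℝ F) := fun h =>
      hx.2 (G.mem_channels_of_mem_microDomain (hs (tsupport_fderiv_subset ℝ h)) hx.1)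
    rw [image_eq_zero_of_notMem_tsupport hx1]
    rfl
  have h2 : ∀ s : ℝ, s = 1 ∨ s = -1 → |∫ a : Base m, F (joinLast a.ofLp (ε * s))|
      ≤ (∫⁻ x in G.mouths ε 1 ∪ G.mouths ε (-1), ‖F x‖ₑ
        ∂(Measure.euclideanHausdorffMeasure m)).toReal := by
    intro s hs1
    have h3 := norm_integral_le_lintegral_norm (μ := (volume : Measure (Base m)))
      (fun a : Base m => F (joinLast a.ofLp (ε * s)))
    rw [Real.norm_eq_abs] at h3
    refine h3.trans (ENNReal.toReal_mono hfin ?_)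
    simp only [ofReal_norm]
    exact G.lintegral_slice_le hε hF.continuous hs hs1
  have h3 := h2 1 (Or.inl rfl)
  have h4 := h2 (-1) (Or.inr rfl)
  rw [mul_one] at h3
  rw [mul_neg_one] at h4
  rw [← h1, integral_strip_fderiv hε hF hc, abs_mul]
  refine mul_le_mul_of_nonneg_left ?_ (abs_nonneg _)
  refine (abs_sub _ _).trans ?_
  linarith

/-- Integration by parts in the channels for a function with zero trace on the mouths. The test
function need not vanish on the mouths. -/
theorem integral_channels_of_trace_zero {ε : ℝ} (hε : 0 < ε) {u : Space m → ℝ}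
    {g : Space m → Space m} (hu : MemLp u 2 (volume.restrict (G.channels ε)))
    (hg : MemLp g 2 (volume.restrict (G.channels ε)))
    (htr : IsTrace (G.channels ε) (G.mouths ε 1 ∪ G.mouths ε (-1)) u g 0)
    {ψ : Space m → ℝ} (hψ : ContDiff ℝ ∞ ψ) (hc : HasCompactSupport ψ)
    (hs : tsupport ψ ⊆ G.microDomain ε) (e : Space m) :
    ∫ x in G.channels ε, u x * fderiv ℝ ψ x e
      = - ∫ x in G.channels ε, inner ℝ (g x) e * ψ x := by
  obtain ⟨-, φ, hφ, hφu, hφg, hφv⟩ := htr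
  set Γ := G.mouths ε 1 ∪ G.mouths ε (-1) with hΓ
  have hψΓ : MemLp ψ 2 ((Measure.euclideanHausdorffMeasure m).restrict Γ) :=
    G.memLp_mouths hψ.continuous hc
  have l1 := tendsto_integral_mul hu (memLp_fderiv_apply (U := G.channels ε) hψ hc e)
    (fun k => (hφ k).continuous.aestronglyMeasurable) hφu
  have l2 : Tendsto (fun k => ∫ x in G.channels ε, inner ℝ (gradient (φ k) x) e * ψ x) atTop
      (𝓝 (∫ x in G.channels ε, inner ℝ (g x) e * ψ x)) := by
    refine tendsto_integral_mul (hg.inner_const e) (memLp_test (U := G.channels ε) hψ hc)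
      (fun k => ((continuous_gradient_smooth (hφ k)).inner continuous_const).aestronglyMeasurable) ?_
    have h0 : Tendsto (fun k => ENNReal.ofReal ‖e‖ * eLpNorm (fun x => g x - gradient (φ k) x) 2
        (volume.restrict (G.channels ε))) atTop (𝓝 0) := by
      simpa using ENNReal.Tendsto.const_mul hφg (Or.inr (ENNReal.ofReal_ne_top (r := ‖e‖)))
    refine tendsto_of_tendsto_of_tendsto_of_le_of_le tendsto_const_nhds h0 (fun _ => zero_le)
      fun k => ?_
    refine eLpNorm_le_mul_eLpNorm_of_ae_le_mul (Eventually.of_forall fun x => ?_) 2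
    rw [← inner_sub_left, mul_comm]
    exact norm_inner_le_norm _ _
  -- the boundary term tends to zero because the approximating functions do so on the mouths
  have l3 : Tendsto (fun k => eLpNorm (φ k) 2 ((Measure.euclideanHausdorffMeasure m).restrict Γ)
      * eLpNorm ψ 2 ((Measure.euclideanHausdorffMeasure m).restrict Γ)) atTop (𝓝 0) := by
    have h0 : Tendsto (fun k => eLpNorm (φ k) 2
        ((Measure.euclideanHausdorffMeasure m).restrict Γ)) atTop (𝓝 0) := by
      refine hφv.congr fun k => ?_
      rw [← eLpNorm_neg]
      congr 1
      funext x
      simp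
    simpa using ENNReal.Tendsto.mul_const h0 (Or.inr hψΓ.eLpNorm_ne_top)
  have hmeasΓ : ∀ f : Space m → ℝ, Continuous f → AEStronglyMeasurable f
      ((Measure.euclideanHausdorffMeasure m).restrict Γ) := fun f hf => hf.aestronglyMeasurable
  have hle : ∀ k, ∫⁻ x in Γ, ‖φ k x * ψ x‖ₑ ∂(Measure.euclideanHausdorffMeasure m)
      ≤ eLpNorm (φ k) 2 ((Measure.euclideanHausdorffMeasure m).restrict Γ)
        * eLpNorm ψ 2 ((Measure.euclideanHausdorffMeasure m).restrict Γ) := by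
    intro k
    have h := eLpNorm_smul_le_mul_eLpNorm (p := 2) (q := 2) (r := 1)
      (hmeasΓ ψ hψ.continuous) (hmeasΓ (φ k) (hφ k).continuous)
    rw [eLpNorm_one_eq_lintegral_enorm] at h
    exact h
  have hsupp : ∀ k, tsupport (fun x => φ k x * ψ x) ⊆ tsupport ψ := fun k =>
    tsupport_mul_subset_right
  have l4 : Tendsto (fun k => ∫ x in G.channels ε, fderiv ℝ (fun x => φ k x * ψ x) x e) atTop
      (𝓝 0) := by
    have h0 : Tendsto (fun k => |lastCoord e| *
        (2 * (eLpNorm (φ k) 2 ((Measure.euclideanHausdorffMeasure m).restrict Γ)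
        * eLpNorm ψ 2 ((Measure.euclideanHausdorffMeasure m).restrict Γ)).toReal)) atTop (𝓝 0) := by
      have h1 := (ENNReal.tendsto_toReal ENNReal.zero_ne_top).comp l3
      simpa using! (h1.const_mul 2).const_mul |lastCoord e|
    refine squeeze_zero_norm' ?_ h0
    filter_upwards [l3.eventually (gt_mem_nhds ENNReal.zero_lt_top)] with k hk
    rw [Real.norm_eq_abs]
    refine (G.abs_integral_channels_fderiv_le hε ((hφ k).mul hψ) hc.mul_left
      ((hsupp k).trans hs) ((hle k).trans_lt hk).ne e).trans ?_
    have := ENNReal.toReal_mono hk.ne (hle k)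
    gcongr
  have heq : ∀ k, ∫ x in G.channels ε, fderiv ℝ (fun x => φ k x * ψ x) x e
      = (∫ x in G.channels ε, φ k x * fderiv ℝ ψ x e)
        + ∫ x in G.channels ε, inner ℝ (gradient (φ k) x) e * ψ x := by
    intro k
    have i1 : Integrable (fun x => φ k x * fderiv ℝ ψ x e) (volume.restrict (G.channels ε)) := by
      refine (Continuous.integrable_of_hasCompactSupport ?_ ?_).integrableOn
      · exact (hφ k).continuous.mul
          ((hψ.continuous_fderiv (by simp)).clm_apply continuous_const)
      · exact (hc.fderiv_apply (𝕜 := ℝ) e).mul_left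
    have i2 : Integrable (fun x => inner ℝ (gradient (φ k) x) e * ψ x)
        (volume.restrict (G.channels ε)) := by
      refine (Continuous.integrable_of_hasCompactSupport ?_ hc.mul_left).integrableOn
      exact ((continuous_gradient_smooth (hφ k)).inner continuous_const).mul hψ.continuous
    rw [← integral_add i1 i2]
    refine integral_congr_ae (Eventually.of_forall fun x => ?_)
    beta_reduce
    have d1 := (hφ k).differentiable (by simp) x
    have d2 := hψ.differentiable (by simp) x
    have h := fderiv_mul d1 d2
    change fderiv ℝ (φ k * ψ) x e = _
    rw [h]
    have h2 : inner ℝ (gradient (φ k) x) e = fderiv ℝ (φ k) x e := by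
      simp [gradient]
    rw [h2]
    simp only [add_apply, smul_apply, smul_eq_mul]
    ring
  have l5 := l1.add l2
  have l6 := tendsto_nhds_unique (l5.congr fun k => (heq k).symm) l4
  linarith

end ChannelGeometry

end

section

variable {m : ℕ}

/-! ### Extension by zero -/

theorem memLp_indicator_coe {F : Type*} [NormedAddCommGroup F] {α : Type*} [MeasurableSpace α]
    {μ ν : Measure α} {s : Set α} (hs : MeasurableSet s) (h : μ.restrict s = ν) (f : Lp F 2 ν) :
    MemLp (s.indicator f) 2 μ := by
  rw [memLp_indicator_iff_restrict hs, h]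
  exact Lp.memLp f

/-- Extension by zero of a square integrable function on a measurable set `s`, as a linear isometry
of `L²` spaces. The measure `ν` is the restriction of `μ` to `s`. -/
noncomputable def zeroExtension (F : Type*) [NormedAddCommGroup F] [NormedSpace ℝ F] {α : Type*}
    [MeasurableSpace α] {μ ν : Measure α} {s : Set α} (hs : MeasurableSet s)
    (h : μ.restrict s = ν) : Lp F 2 ν →ₗᵢ[ℝ] Lp F 2 μ where
  toFun f := (memLp_indicator_coe hs h f).toLp (s.indicator f)
  map_add' f g := by
    rw [← MemLp.toLp_add]
    refine MemLp.toLp_congr _ _ ?_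
    have hfg : ∀ᵐ x ∂(μ.restrict s), (f + g : Lp F 2 ν) x = f x + g x := by
      rw [h]
      exact Lp.coeFn_add f g
    rw [ae_restrict_iff' hs] at hfg
    filter_upwards [hfg] with x hx
    by_cases hxs : x ∈ s
    · simp only [Pi.add_apply, indicator_of_mem hxs, hx hxs]
    · simp [hxs]
  map_smul' c f := by
    rw [RingHom.id_apply, ← MemLp.toLp_const_smul]
    refine MemLp.toLp_congr _ _ ?_
    have hf : ∀ᵐ x ∂(μ.restrict s), (c • f : Lp F 2 ν) x = c • f x := by
      rw [h]
      exact Lp.coeFn_smul c f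
    rw [ae_restrict_iff' hs] at hf
    filter_upwards [hf] with x hx
    by_cases hxs : x ∈ s
    · simp [hxs, hx hxs]
    · simp [hxs]
  norm_map' f := by
    refine (Lp.norm_toLp _ (memLp_indicator_coe hs h f)).trans ?_
    rw [eLpNorm_indicator_eq_eLpNorm_restrict hs, h, Lp.norm_def]

theorem zeroExtension_ae_eq {F : Type*} [NormedAddCommGroup F] [NormedSpace ℝ F] {α : Type*}
    [MeasurableSpace α] {μ ν : Measure α} {s : Set α} (hs : MeasurableSet s)
    (h : μ.restrict s = ν) (f : Lp F 2 ν) : zeroExtension F hs h f =ᵐ[μ] s.indicator f :=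
  MemLp.coeFn_toLp (memLp_indicator_coe hs h f)

/-- The product of two linear isometries, as a linear isometry of Hilbert sums. -/
noncomputable def prodIsometry {E₁ E₂ F₁ F₂ : Type*} [NormedAddCommGroup E₁] [NormedSpace ℝ E₁]
    [NormedAddCommGroup E₂] [NormedSpace ℝ E₂] [NormedAddCommGroup F₁] [NormedSpace ℝ F₁]
    [NormedAddCommGroup F₂] [NormedSpace ℝ F₂] (a : E₁ →ₗᵢ[ℝ] F₁) (b : E₂ →ₗᵢ[ℝ] F₂) :
    WithLp 2 (E₁ × E₂) →ₗᵢ[ℝ] WithLp 2 (F₁ × F₂) where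
  toFun p := WithLp.toLp 2 (a p.fst, b p.snd)
  map_add' p q := by
    simp only [WithLp.add_fst, WithLp.add_snd, map_add]
    rfl
  map_smul' c p := by
    simp only [WithLp.smul_fst, WithLp.smul_snd, map_smul]
    rfl
  norm_map' p := by
    refine (sq_eq_sq₀ (norm_nonneg _) (norm_nonneg _)).1 ?_
    refine (WithLp.prod_norm_sq_eq_of_L2 _).trans ((?_ : _ = _).trans
      (WithLp.prod_norm_sq_eq_of_L2 p).symm)
    exact congrArg₂ (fun x y => x ^ 2 + y ^ 2) (a.norm_map _) (b.norm_map _)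

namespace ChannelGeometry

variable {G : ChannelGeometry m} {ε : ℝ} {hε : 0 < ε}

theorem weighted_restrict_channels (G : ChannelGeometry m) {ε : ℝ} (hε : 0 < ε) (w : ℝ≥0∞) :
    (G.weighted ε w).restrict (G.channels ε) = w • volume.restrict (G.channels ε) := by
  have hm := (G.isOpen_channels hε).measurableSet
  have h1 : (volume.restrict (G.bulkPlus ε)).restrict (G.channels ε) = 0 := by
    rw [Measure.restrict_restrict hm, Measure.restrict_eq_zero]
    have : G.channels ε ∩ G.bulkPlus ε = ∅ :=
      eq_empty_of_forall_notMem fun x hx => (G.not_mem_bulk_of_mem_channels hx.1).1 hx.2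
    rw [this, measure_empty]
  have h2 : (volume.restrict (G.bulkMinus ε)).restrict (G.channels ε) = 0 := by
    rw [Measure.restrict_restrict hm, Measure.restrict_eq_zero]
    have : G.channels ε ∩ G.bulkMinus ε = ∅ :=
      eq_empty_of_forall_notMem fun x hx => (G.not_mem_bulk_of_mem_channels hx.1).2 hx.2
    rw [this, measure_empty]
  unfold weighted
  rw [Measure.restrict_add, Measure.restrict_add, h1, h2, zero_add, zero_add,
    Measure.restrict_smul, Measure.restrict_restrict hm, inter_self]

/-- The extension by zero of a function with zero trace on the mouths is weakly differentiable across
the mouths. -/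
theorem isWeakGradient_indicator (φ : G.HSpaceM0 ε hε) :
    IsWeakGradient (G.microDomain ε) ((G.channels ε).indicator φ.1.fst)
      ((G.channels ε).indicator φ.1.snd) := by
  intro ψ hψ hc hs e
  have hm := (G.isOpen_channels hε).measurableSet
  have hsub : G.microDomain ε ∩ G.channels ε = G.channels ε :=
    inter_eq_right.2 (G.channels_subset_microDomain hε)
  have e1 : ∀ x, (G.channels ε).indicator φ.1.fst x * fderiv ℝ ψ x e
      = (G.channels ε).indicator (fun x => φ.1.fst x * fderiv ℝ ψ x e) x := by
    intro x
    by_cases hx : x ∈ G.channels ε <;> simp [hx]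
  have e2 : ∀ x, inner ℝ ((G.channels ε).indicator φ.1.snd x) e * ψ x
      = (G.channels ε).indicator (fun x => inner ℝ (φ.1.snd x) e * ψ x) x := by
    intro x
    by_cases hx : x ∈ G.channels ε <;> simp [hx]
  simp only [e1, e2]
  rw [setIntegral_indicator hm, setIntegral_indicator hm, hsub]
  exact G.integral_channels_of_trace_zero hε
    ((G.dominates_channels ε (by simpa using hε) ENNReal.ofReal_ne_top).memLp (Lp.memLp φ.1.fst))
    ((G.dominates_channels ε (by simpa using hε) ENNReal.ofReal_ne_top).memLp (Lp.memLp φ.1.snd))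
    φ.2.2 hψ hc hs e

/-- Extension by zero of the functions of `𝓗_{ε,0}^M` to elements of `𝓗_ε`. -/
noncomputable def HSpaceM0.zeroExtend (G : ChannelGeometry m) (ε : ℝ) (hε : 0 < ε) :
    G.HSpaceM0 ε hε →L[ℝ] G.HSpace ε hε :=
  ((prodIsometry
      (zeroExtension ℝ (G.isOpen_channels hε).measurableSet (G.weighted_restrict_channels hε _))
      (zeroExtension (Space m) (G.isOpen_channels hε).measurableSet
        (G.weighted_restrict_channels hε _))).toContinuousLinearMap.comp
    (Submodule.subtypeL _)).codRestrict _ fun φ =>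
      (isWeakGradient_indicator (hε := hε) φ).congr
        ((G.dominates_weighted ε (by simpa using hε) ENNReal.ofReal_ne_top).ac.ae_eq
          (zeroExtension_ae_eq _ (G.weighted_restrict_channels hε _) φ.1.fst))
        ((G.dominates_weighted ε (by simpa using hε) ENNReal.ofReal_ne_top).ac.ae_eq
          (zeroExtension_ae_eq _ (G.weighted_restrict_channels hε _) φ.1.snd))

theorem HSpaceM0.norm_zeroExtend_le (G : ChannelGeometry m) (ε : ℝ) (hε : 0 < ε) :
    ‖HSpaceM0.zeroExtend G ε hε‖ ≤ 1 := by
  refine ContinuousLinearMap.opNorm_le_bound _ zero_le_one fun φ => ?_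
  rw [one_mul]
  exact ((prodIsometry
      (zeroExtension ℝ (G.isOpen_channels hε).measurableSet (G.weighted_restrict_channels hε _))
      (zeroExtension (Space m) (G.isOpen_channels hε).measurableSet
        (G.weighted_restrict_channels hε _))).norm_map φ.1).le

/-- The usual inner product of `L²(Ω_{*,ε}^M)` is `ε` times the inner product of `𝓛_ε` with the
extension by zero. -/
theorem HSpaceM0.inner_toL_zeroExtend (w : G.HSpace ε hε) (φ : G.HSpaceM0 ε hε) :
    ∫ x in G.channels ε, w.val x * φ.val x
      = ε * inner ℝ w.toL (HSpaceM0.zeroExtend G ε hε φ).toL := by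
  have hm := (G.isOpen_channels hε).measurableSet
  have hz : (HSpaceM0.zeroExtend G ε hε φ).toL
      =ᵐ[G.weighted ε (ENNReal.ofReal ε⁻¹)] (G.channels ε).indicator φ.val :=
    zeroExtension_ae_eq _ _ _
  have h1 : inner ℝ w.toL (HSpaceM0.zeroExtend G ε hε φ).toL
      = ∫ x, (G.channels ε).indicator (fun x => w.val x * φ.val x) x
          ∂(G.weighted ε (ENNReal.ofReal ε⁻¹)) := by
    rw [L2.inner_def]
    refine integral_congr_ae ?_
    filter_upwards [hz] with x hx
    rw [hx]
    by_cases hxc : x ∈ G.channels ε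
    · simp only [indicator_of_mem hxc]
      exact mul_comm _ _
    · simp only [indicator_of_notMem hxc, inner_zero_right]
  rw [h1, integral_indicator hm, G.weighted_restrict_channels hε, integral_smul_measure,
    ENNReal.toReal_ofReal (by positivity), smul_eq_mul, ← mul_assoc, mul_inv_cancel₀ hε.ne', one_mul]

end ChannelGeometry

theorem memLp_comp_dual {H H₀ : Type*} [NormedAddCommGroup H] [NormedSpace ℝ H]
    [NormedAddCommGroup H₀] [NormedSpace ℝ H₀] {α : Type*} [MeasurableSpace α] {μ : Measure α}
    (E : H₀ →L[ℝ] H) (hE : ‖E‖ ≤ 1) {c : ℝ} (hc : 0 ≤ c) {d : α → StrongDual ℝ H}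
    (hd : MemLp d 2 μ) :
    MemLp (fun t => c • (d t).comp E) 2 μ ∧
      eLpNorm (fun t => c • (d t).comp E) 2 μ ≤ ENNReal.ofReal c * eLpNorm d 2 μ := by
  have hn : ∀ t, ‖c • (d t).comp E‖ ≤ c * ‖d t‖ := fun t => by
    refine ContinuousLinearMap.opNorm_le_bound _ (by positivity) fun x => ?_
    change ‖c * d t (E x)‖ ≤ _
    rw [norm_mul, Real.norm_of_nonneg hc, mul_assoc]
    refine mul_le_mul_of_nonneg_left (((d t).le_opNorm _).trans ?_) hc
    refine mul_le_mul_of_nonneg_left ((E.le_opNorm x).trans ?_) (norm_nonneg _)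
    exact mul_le_of_le_one_left (norm_nonneg _) hE
  have hcont : Continuous fun ℓ : StrongDual ℝ H => c • ℓ.comp E := by fun_prop
  exact ⟨hd.of_le_mul (hcont.comp_aestronglyMeasurable hd.1) (Eventually.of_forall hn),
    eLpNorm_le_mul_eLpNorm_of_ae_le_mul (Eventually.of_forall hn) 2⟩

/-- The weak time derivative, tested with the image of `φ` under `E`. -/
theorem integral_comp_dual {H H₀ L : Type*} [NormedAddCommGroup H] [NormedSpace ℝ H]
    [NormedAddCommGroup H₀] [NormedSpace ℝ H₀] [NormedAddCommGroup L] [InnerProductSpace ℝ L]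
    {α : Type*} [MeasurableSpace α] {μ : Measure α} (E : H₀ →L[ℝ] H) (ι : H → L) {c : ℝ}
    {u : α → H} {d : α → StrongDual ℝ H} {ψ ψ' : α → ℝ} (φ : H₀) {b : H → ℝ}
    (hb : ∀ w, b w = c * inner ℝ (ι w) (ι (E φ)))
    (hweak : ∫ t, ψ' t * inner ℝ (ι (u t)) (ι (E φ)) ∂μ = - ∫ t, ψ t * d t (E φ) ∂μ) :
    ∫ t, ψ' t * b (u t) ∂μ = - ∫ t, ψ t * (c • (d t).comp E) φ ∂μ := by
  have e1 : ∀ t, ψ' t * b (u t) = c * (ψ' t * inner ℝ (ι (u t)) (ι (E φ))) := fun t => by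
    rw [hb]
    ring
  have e2 : ∀ t, ψ t * (c • (d t).comp E) φ = c * (ψ t * d t (E φ)) := fun t => by
    change ψ t * (c * d t (E φ)) = _
    ring
  simp only [e1, e2]
  rw [integral_const_mul, integral_const_mul, hweak, mul_neg]

/-- The time derivative of a solution, tested with functions that vanish outside of the channels, is
the time derivative of the restriction of the solution to the channels. The factor `ε` comes from the
weight `ε⁻¹` in the inner product of `𝓛_ε`. -/
theorem exists_channelTimeDerivative {G : ChannelGeometry m} {ε : ℝ} {hε : 0 < ε} {T : ℝ}
    {u : ℝ → G.HSpace ε hε} {du : ℝ → StrongDual ℝ (G.HSpace ε hε)}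
    (h : IsTimeDerivative T u du) :
    ∃ duM : ℝ → StrongDual ℝ (G.HSpaceM0 ε hε), IsChannelTimeDerivative T u duM ∧
      eLpNorm duM 2 (timeMeasure T) ≤ ENNReal.ofReal ε * eLpNorm du 2 (timeMeasure T) := by
  have key := memLp_comp_dual (ChannelGeometry.HSpaceM0.zeroExtend G ε hε)
    (ChannelGeometry.HSpaceM0.norm_zeroExtend_le G ε hε) hε.le h.1
  refine ⟨_, ⟨key.1, fun ψ hψ hc hs φ => ?_⟩, key.2⟩
  exact integral_comp_dual (ChannelGeometry.HSpaceM0.zeroExtend G ε hε)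
    ChannelGeometry.HSpace.toL φ (fun w => ChannelGeometry.HSpaceM0.inner_toL_zeroExtend w φ)
    (h.2 ψ hψ hc hs (ChannelGeometry.HSpaceM0.zeroExtend G ε hε φ))

end

section

variable {m : ℕ}

/-! ### The a priori estimates -/

theorem ChannelGeometry.HSpace.exists_eq_toL {G : ChannelGeometry m} {ε : ℝ} {hε : 0 < ε} :
    ∃ ι : G.HSpace ε hε →L[ℝ] G.LSpace ε, ∀ w, ι w = w.toL :=
  ⟨(WithLp.fstL 2 ℝ _ _).comp (Submodule.subtypeL _), fun _ => rfl⟩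

/-- The solution and its time derivative are bounded uniformly in `ε`. -/
theorem exists_uniform_bound {G : ChannelGeometry m} {T : ℝ} (hT : 0 < T) (P : ProblemData G T) :
    ∃ C : ℝ, ∀ (ε : ℝ) (hε : 0 < ε) (u : ℝ → G.HSpace ε hε)
      (du : ℝ → StrongDual ℝ (G.HSpace ε hε)), IsWeakSolution P u du →
      eLpNorm du 2 (timeMeasure T) + eLpNorm u 2 (timeMeasure T) ≤ ENNReal.ofReal C := by
  obtain ⟨c, C, hc, hC, hstr⟩ := P.exists_structure_constants
  obtain ⟨M, hM⟩ := P.exists_initial_bound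
  refine ⟨C * √T + (C + 1) * √((M + 2 * C * (T * (1 + energyBound T C M))) / (2 * c)),
    fun ε hε u du hsol => ?_⟩
  obtain ⟨v, hvc, hvu, hv0⟩ := hsol.initial
  obtain ⟨ι, hι⟩ := ChannelGeometry.HSpace.exists_eq_toL (G := G) (ε := ε) (hε := hε)
  have hpt : ∀ᵐ t ∂(timeMeasure T), ‖du t‖ ≤ C * (1 + ‖u t‖) ∧
      du t (u t) + c * ‖u t‖ ^ 2 ≤ C * (1 + ‖(u t).toL‖ ^ 2) := by
    filter_upwards [hsol.equation, ae_restrict_mem measurableSet_Ioo] with t ht htm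
    refine hstr ε hε t (Ioo_subset_Icc_self htm) (u t) (du t) fun φ => ?_
    have h := ht φ
    rw [add_assoc, add_assoc, ← add_assoc (P.Dp * _)] at h
    exact h
  refine eLpNorm_add_eLpNorm_le hT ι hsol.memLp hsol.timeDerivative.1 ?_ hvc ?_ hc hC
    (hM ε hε (v 0) hv0) ?_ ?_
  · intro ψ h1 h2 h3 φ
    simp only [hι]
    exact hsol.timeDerivative.2 ψ h1 h2 h3 φ
  · filter_upwards [hvu] with t ht
    rw [ht, hι]
  · filter_upwards [hpt] with t ht
    rw [hι]
    exact ht.2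
  · filter_upwards [hpt] with t ht using ht.1

theorem le_ofReal_mul_of_add_le {a b d : ℝ≥0∞} {C ε : ℝ} (hε : 0 ≤ ε)
    (h : a + b ≤ ENNReal.ofReal C) (hd : d ≤ ENNReal.ofReal ε * a) :
    d ≤ ENNReal.ofReal (C * ε) := by
  rw [mul_comm, ENNReal.ofReal_mul hε]
  exact hd.trans (mul_le_mul_right (le_self_add.trans h) _)

end

end ThinChannels

theorem mainTheorem8 (m : ℕ) (hm : 1 ≤ m) (G : ThinChannels.ChannelGeometry m)
    (T : ℝ) (hT : 0 < T) (P : ThinChannels.ProblemData G T) :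
    ∃ C : ℝ, 0 < C ∧ ∀ (ε : ℝ) (hε : 0 < ε), (∃ k : ℕ, ε⁻¹ = (k : ℝ)) → ε < G.H →
      ThinChannels.HasLipschitzBoundary (G.microDomain ε) →
      ∀ (u : ℝ → G.HSpace ε hε) (du : ℝ → StrongDual ℝ (G.HSpace ε hε)),
        ThinChannels.IsWeakSolution P u du →
        eLpNorm du 2 (ThinChannels.timeMeasure T) + eLpNorm u 2 (ThinChannels.timeMeasure T)
            ≤ ENNReal.ofReal C ∧
        ∃ duM : ℝ → StrongDual ℝ (G.HSpaceM0 ε hε),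
          ThinChannels.IsChannelTimeDerivative T u duM ∧
          eLpNorm duM 2 (ThinChannels.timeMeasure T) ≤ ENNReal.ofReal (C * ε) := by
  obtain ⟨C, hC⟩ := ThinChannels.exists_uniform_bound hT P
  refine ⟨max C 1, lt_max_of_lt_right one_pos, fun ε hε _ _ _ u du hsol => ?_⟩
  have h1 := (hC ε hε u du hsol).trans (ENNReal.ofReal_le_ofReal (le_max_left C 1))
  exact ⟨h1, (ThinChannels.exists_channelTimeDerivative hsol.timeDerivative).imp fun _ h =>
    ⟨h.1, ThinChannels.le_ofReal_mul_of_add_le hε.le h1 h.2⟩⟩
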